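/- Let $n\ge 4$ and let $D=\Omega+i\,\mathbb R^{n+1}\subset\mathbb C^{n+1}$ be an affinely homogeneous tube domain, i.e. its base $\Omega\subset\mathbb R^{n+1}$ is a domain (nonempty, open, connected) on which the group $\operatorname{Aff}(\Omega)$ of affine transformations of $\mathbb R^{n+1}$ preserving $\Omega$ acts transitively. Let $\Gamma\subset\partial\Omega$ be a nonempty connected relatively open part of the boundary of $\Omega$ that is a smooth hypersurface in $\mathbb R^{n+1}$, that is affinely homogeneous (at each $p\in\Gamma$ the affine vector fields on $\mathbb R^{n+1}$ tangent to $\Gamma$ along $\Gamma$ span $T_p\Gamma$), and whose affine second fundamental form, which is defined up to a nonzero factor, is Lorentzian, i.e. of signature $(n-1,1)$ for a suitable choice of the factor. Suppose that the affine isotropy of the domain, i.e. the stabilizer in $\operatorname{Aff}(\Omega)$ of a point of $\Omega$, has dimension at least $\frac{(n-2)(n-3)}2$. Then $\Gamma$ is locally affinely equivalent to one of the following hypersurfaces $M$ (there is one such $M$ such that every point of $\Gamma$ has a neighbourhood in $\Gamma$ that is mapped onto an open piece of $M$ by an invertible affine transformation of $\mathbb R^{n+1}$): \begin{enumerate} \item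 $x_{n+1}=x_1x_n+\sum_{i=2}^{n-1}x_i^2$; \item $x_{n+1}=x_1x_n+\sum_{i=2}^{n-1}x_i^2+x_1^3$; \item $x_{n+1}=x_1x_n+\sum_{i=2}^{n-1}x_i^2+x_1^2x_2+\alpha x_1^4$ for some $\alpha\in\mathbb R$; \item $x_{n+1}=x_1x_n+x_1\sum_{i=2}^{n-1}x_i^2$; \item $0=x_{n+1}-2x_{n+1}x_n-2x_1x_n^2+x_1x_n+\frac12\sum_{i=2}^{n-1}x_i^2$; \item $x_{n+1}=x_1x_n+\sum_{i=2}^{n-1}x_i^2+x_1x_2^2$; \item $0=(1-2x_n)\bigl(x_{n+1}+x_1x_n+\frac12\sum_{i=2}^{n-1}x_i^2\bigr)+x_nx_2^2$. \end{enumerate} -/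

import Mathlib

open scoped ContDiff Topology

/-! Affinely homogeneous tube domains and affine hypersurfaces in `ℝ^{n+1}`. -/

namespace AffineTube

/-- The tube domain `Ω + i ℝ^m` in `ℂ^m` over the base `Ω ⊆ ℝ^m`. -/
def tubeDomain {m : ℕ} (Ω : Set (Fin m → ℝ)) : Set (Fin m → ℂ) :=
  {z | (fun i => (z i).re) ∈ Ω}

/-- An affinely homogeneous domain: a nonempty connected open set on which the group of affine
transformations preserving it acts transitively. -/
structure IsAffinelyHomogeneousDomain {m : ℕ} (Ω : Set (Fin m → ℝ)) : Prop where
  isOpen : IsOpen Ω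
  isConnected : IsConnected Ω
  transitive : ∀ p ∈ Ω, ∀ q ∈ Ω,
    ∃ g : (Fin m → ℝ) ≃ᵃ[ℝ] (Fin m → ℝ), g '' Ω = Ω ∧ g p = q

/-- `D` is an affinely homogeneous tube domain with base `Ω`. -/
structure IsAffinelyHomogeneousTubeDomain {m : ℕ}
    (D : Set (Fin m → ℂ)) (Ω : Set (Fin m → ℝ)) : Prop where
  eq_tube : D = tubeDomain Ω
  base : IsAffinelyHomogeneousDomain Ω

/-- The Lie algebra of the isotropy group at `p` of the group of affine automorphisms of `Ω`.
An element is recorded by the linear part `A` of the affine vector field `x ↦ A (x - p)`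
vanishing at `p`, whose flow `x ↦ p + exp (t A) (x - p)` has to preserve `Ω`.
(For open `Ω` the affine automorphisms form a closed subgroup of the affine group, so that
the set below is already a linear subspace, and the span adds nothing to it.) -/
noncomputable def isotropyAlgebra {m : ℕ} (Ω : Set (Fin m → ℝ)) (p : Fin m → ℝ) :
    Submodule ℝ ((Fin m → ℝ) →L[ℝ] (Fin m → ℝ)) :=
  Submodule.span ℝ
    {A | ∀ t : ℝ, (fun x => p + NormedSpace.exp (t • A) (x - p)) '' Ω = Ω}

/-- `F` is a smooth defining function of `Γ` on the open set `U`: there `Γ` is the zero set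
of `F`, and the differential of `F` does not vanish. -/
structure IsDefiningFunction {m : ℕ} (Γ U : Set (Fin m → ℝ)) (F : (Fin m → ℝ) → ℝ) :
    Prop where
  isOpen : IsOpen U
  contDiffOn : ContDiffOn ℝ ∞ F U
  mem_iff : ∀ x ∈ U, x ∈ Γ ↔ F x = 0
  fderiv_ne_zero : ∀ x ∈ U, fderiv ℝ F x ≠ 0

/-- `Γ` is a smooth embedded (not necessarily closed) hypersurface. -/
def IsSmoothHypersurface {m : ℕ} (Γ : Set (Fin m → ℝ)) : Prop :=
  ∀ p ∈ Γ, ∃ (U : Set (Fin m → ℝ)) (F : (Fin m → ℝ) → ℝ), p ∈ U ∧ IsDefiningFunction Γ U F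

/-- The tangent space at `p` of a smooth hypersurface `Γ`: the vectors annihilated by the
differentials of the defining functions (all of which have the same kernel). -/
noncomputable def tangentSpace {m : ℕ} (Γ : Set (Fin m → ℝ)) (p : Fin m → ℝ) :
    Submodule ℝ (Fin m → ℝ) where
  carrier := {v | ∀ (U : Set (Fin m → ℝ)) (F : (Fin m → ℝ) → ℝ),
    p ∈ U → IsDefiningFunction Γ U F → fderiv ℝ F p v = 0}
  add_mem' := by
    intro v w hv hw U F hp hF
    rw [map_add, hv U F hp hF, hw U F hp hF, add_zero]
  zero_mem' := by
    intro U F _ _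
    exact map_zero _
  smul_mem' := by
    intro c v hv U F hp hF
    rw [map_smul, hv U F hp hF, smul_zero]

/-- The affine symmetry algebra of `Γ`: the affine vector fields `x ↦ A x + b` on `ℝ^m` that
are tangent to `Γ` along `Γ`. -/
noncomputable def symmetryAlgebra {m : ℕ} (Γ : Set (Fin m → ℝ)) :
    Submodule ℝ ((Fin m → ℝ) →ᵃ[ℝ] (Fin m → ℝ)) where
  carrier := {X | ∀ p ∈ Γ, X p ∈ tangentSpace Γ p}
  add_mem' := by
    intro X Y hX hY p hp
    exact (tangentSpace Γ p).add_mem (hX p hp) (hY p hp)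
  zero_mem' := by
    intro p _
    exact (tangentSpace Γ p).zero_mem
  smul_mem' := by
    intro c X hX p hp
    exact (tangentSpace Γ p).smul_mem c (hX p hp)

/-- `Γ` is affinely homogeneous: its affine symmetries act locally transitively on it, i.e. at
every point the symmetry algebra spans the tangent space. -/
def IsAffinelyHomogeneousHypersurface {m : ℕ} (Γ : Set (Fin m → ℝ)) : Prop :=
  ∀ p ∈ Γ, ∀ v ∈ tangentSpace Γ p, ∃ X ∈ symmetryAlgebra Γ, X p = v

/-- The (affine) second fundamental form at `p` of the hypersurface `F = 0`, with respect to the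
conormal `dF`: the Hessian of `F`, restricted to the tangent space `ker dF`. Another defining
function multiplies it by a nonzero real number. For a graph, with `F = f (x₁,…,xₙ) - xₙ₊₁`, it
is the Hessian of `f`. -/
noncomputable def secondFundamentalForm {m : ℕ} (F : (Fin m → ℝ) → ℝ) (p : Fin m → ℝ)
    (v w : LinearMap.ker (fderiv ℝ F p).toLinearMap) : ℝ :=
  fderiv ℝ (fderiv ℝ F) p v w

/-- The second fundamental form at `p` of the hypersurface `Γ` in `ℝ^{n+1}` is Lorentzian: for a
suitable choice of the conormal (the form is defined only up to a nonzero factor) it is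
nondegenerate with one negative square and `n - 1` positive squares. -/
def HasLorentzianSecondFundamentalForm {n : ℕ} (Γ : Set (Fin (n + 1) → ℝ))
    (p : Fin (n + 1) → ℝ) : Prop :=
  ∃ (U : Set (Fin (n + 1) → ℝ)) (F : (Fin (n + 1) → ℝ) → ℝ), p ∈ U ∧ IsDefiningFunction Γ U F ∧
    ∃ b : Module.Basis (Fin n) ℝ (LinearMap.ker (fderiv ℝ F p).toLinearMap), ∀ i j : Fin n,
      secondFundamentalForm F p (b i) (b j) =
        if i = j then (if (i : ℕ) = 0 then -1 else 1) else 0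

/-- `Γ` is a part of the boundary of `Ω`: a relatively open subset of the frontier. -/
def IsBoundaryPart {m : ℕ} (Γ Ω : Set (Fin m → ℝ)) : Prop :=
  ∃ W : Set (Fin m → ℝ), IsOpen W ∧ Γ = W ∩ frontier Ω

/-- Near its point `p`, `Γ` is affinely equivalent to `M` near some point of `M`. -/
def LocallyAffinelyEquivalentAt {m : ℕ} (Γ M : Set (Fin m → ℝ)) (p : Fin m → ℝ) : Prop :=
  ∃ (g : (Fin m → ℝ) ≃ᵃ[ℝ] (Fin m → ℝ)) (U : Set (Fin m → ℝ)),
    IsOpen U ∧ p ∈ U ∧ g '' (Γ ∩ U) = M ∩ g '' U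

/-- The coordinates `x₁, …, xₙ₊₁` of a point of `ℝ^{n+1}`, numbered from `1`. -/
def coord {n : ℕ} (x : Fin (n + 1) → ℝ) (k : ℕ) : ℝ := x (Fin.ofNat (n + 1) (k - 1))

/-- `∑_{i=2}^{n-1} xᵢ²`. -/
def midSq {n : ℕ} (x : Fin (n + 1) → ℝ) : ℝ := ∑ i ∈ Finset.Icc 2 (n - 1), coord x i ^ 2

/-- The seven types of hypersurfaces in `ℝ^{n+1}`; the third one is a one-parameter family. -/
inductive IsListedHypersurface (n : ℕ) : Set (Fin (n + 1) → ℝ) → Prop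
  | quadric : IsListedHypersurface n
      {x | coord x (n + 1) = coord x 1 * coord x n + midSq x}
  | cubic : IsListedHypersurface n
      {x | coord x (n + 1) = coord x 1 * coord x n + midSq x + coord x 1 ^ 3}
  | winkelmann (α : ℝ) : IsListedHypersurface n
      {x | coord x (n + 1) =
        coord x 1 * coord x n + midSq x + coord x 1 ^ 2 * coord x 2 + α * coord x 1 ^ 4}
  | typeFour : IsListedHypersurface n
      {x | coord x (n + 1) = coord x 1 * coord x n + coord x 1 * midSq x}
  | typeFive : IsListedHypersurface n
      {x | 0 = coord x (n + 1) - 2 * coord x (n + 1) * coord x n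
        - 2 * coord x 1 * coord x n ^ 2 + coord x 1 * coord x n + (1 / 2) * midSq x}
  | typeSix : IsListedHypersurface n
      {x | coord x (n + 1) = coord x 1 * coord x n + midSq x + coord x 1 * coord x 2 ^ 2}
  | typeSeven : IsListedHypersurface n
      {x | 0 = (1 - 2 * coord x n) *
          (coord x (n + 1) + coord x 1 * coord x n + (1 / 2) * midSq x)
        + coord x n * coord x 2 ^ 2}

end AffineTube

open scoped ContDiff Topology
open Filter NormedSpace

set_option linter.unusedSectionVars false
set_option linter.unusedSimpArgs false

/-! The classification is reduced to linear algebra at one boundary point `q`, and the result is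
carried back to all of Γ by relative invariants.

Transitivity of the automorphism group of Ω becomes infinitesimal in
`exists_mem_lieSubspace_apply_eq`. A closed group is covered near 1 by exponentials of its Lie
algebra, the orbit map is open, and an image of a space of too small dimension cannot be a
neighbourhood. The generators obtained are tangent to Γ, so the symmetry algebra of Γ also spans the
tangent space at every point of Ω.

At `q` the space is split into the tangent space `T` and a transversal ξ in the affine normal
direction, i.e. such that the cubic form `C` is trace-free with respect to the second fundamental
form `Q`. Rewriting the symmetries in this splitting gives a `SymmetryModel`. Trace-freeness forces
`a` to vanish on brackets, so the shape operator is symmetric and a symmetry vanishing at `q` has `w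
= 0` (`a_bracket_eq_zero`, `w_eq_zero`). On the normal line such a symmetry is determined by `a`
alone. Since Ω meets that line and symmetries are transitive there, some `D` has `b D = 0` and `a D
= 2` (`exists_symmetryModel`). This `D` is a grading element: `A D = id + s` with `s` skew, `C` has
weight -1 under `s`, and both the shape operator and the derivative `K` of `C` have weight -2.

If `C = 0`, the shape operator vanishes too and Γ is the quadric. Otherwise a nonzero tensor of
negative weight forces an eigenvalue of `s` off the imaginary axis. In Lorentzian signature this
gives a null pair `e, f` with eigenvalues `σ < 0` and `-σ`, whose complement is positive definite
and is only rotated by `s`. By `weight_tensor_eq_zero` the components of `C` sit in one total weight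
`m = -1/σ`, which is 1, 2 or 3 (`σ_cases`). For `m = 3` only `C e e e` survives and the model is
type two. For `m = 2` it is type three, the single surviving component of `K` supplying α.

For `m = 1` the form `C e` is diagonal on the complement with entries `q i`, and β denotes `C e e
f`. An isotropy element is determined by one number for each `i` with `q i = β/2` and one for each
pair with `q i = q j` (`finrank_isotropy_le`). The assumed dimension then leaves two possibilities:
all `q i` agree, or all but one equal β/2 (`q_eq_or`). With `c` the deviation from β/2, one bracket
computation (`quadratic`) gives `ν = c` or `ν = -c`. The two possibilities and two signs produce
types four to seven.

In every case an explicit polynomial `P` with `P(q) = 0` is multiplied by a function under each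
symmetry. A Gronwall argument and connectedness give `P = 0` on Γ (`IsRelativeInvariant.eq_zero`),
and Γ is locally the zero set of `P` wherever `dP ≠ 0` (`exists_inter_eq_zeroSet`). In types five
and seven `dP` can vanish only where `1 - c x₁` does; this is itself a relative invariant and is
nonzero at `q`, hence on Γ. -/

namespace AffineTube

/-! ### Closed groups in a Banach algebra and their Lie algebras. -/

section ClosedGroup

variable {𝔸 : Type*} [NormedRing 𝔸] [NormedAlgebra ℝ 𝔸] [CompleteSpace 𝔸]

theorem exp_add_smul (Y : 𝔸) (s t : ℝ) : exp ((s + t) • Y) = exp (s • Y) * exp (t • Y) := by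
  let _ : NormedAlgebra ℚ 𝔸 := NormedAlgebra.restrictScalars ℚ ℝ 𝔸
  rw [add_smul]
  exact exp_add_of_commute (((Commute.refl Y).smul_left s).smul_right t)

theorem exp_smul_mul_exp_neg_smul (Y : 𝔸) (t : ℝ) : exp (t • Y) * exp (-t • Y) = 1 := by
  rw [← exp_add_smul, add_neg_cancel, zero_smul, exp_zero]

theorem exp_neg_smul_mul_exp_smul (Y : 𝔸) (t : ℝ) : exp (-t • Y) * exp (t • Y) = 1 := by
  rw [← exp_add_smul, neg_add_cancel, zero_smul, exp_zero]

theorem exp_smul_pow (Y : 𝔸) (t : ℝ) (n : ℕ) : exp (t • Y) ^ n = exp ((n * t) • Y) := by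
  induction n with
  | zero => simp
  | succ n ih => rw [pow_succ, ih, ← exp_add_smul]; push_cast; ring_nf

theorem isUnit_exp_real (Y : 𝔸) : IsUnit (exp Y) := by
  let _ : NormedAlgebra ℚ 𝔸 := NormedAlgebra.restrictScalars ℚ ℝ 𝔸
  exact isUnit_exp Y

theorem continuous_exp_real : Continuous (exp : 𝔸 → 𝔸) := by
  let _ : NormedAlgebra ℚ 𝔸 := NormedAlgebra.restrictScalars ℚ ℝ 𝔸
  exact exp_continuous

/-- Telescoping. The crude factor `M ^ n` is harmless because it is applied with `M` close to 1,
where `M ^ n` stays bounded. -/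
theorem norm_pow_sub_pow_le [NormOneClass 𝔸] {a b : 𝔸} {M : ℝ} (hM : 1 ≤ M) (ha : ‖a‖ ≤ M)
    (hb : ‖b‖ ≤ M) (n : ℕ) : ‖a ^ n - b ^ n‖ ≤ n * M ^ n * ‖a - b‖ := by
  induction n with
  | zero => simp
  | succ n ih =>
    have h0 : (0 : ℝ) ≤ M := by linarith
    have e : a ^ (n + 1) - b ^ (n + 1) = a ^ n * (a - b) + (a ^ n - b ^ n) * b := by
      rw [pow_succ, pow_succ]; noncomm_ring
    have h1 : ‖a ^ n * (a - b)‖ ≤ M ^ n * ‖a - b‖ := by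
      refine (norm_mul_le _ _).trans ?_
      gcongr
      exact (norm_pow_le _ _).trans (by gcongr)
    have h2 : ‖(a ^ n - b ^ n) * b‖ ≤ n * M ^ n * ‖a - b‖ * M :=
      (norm_mul_le _ _).trans (by gcongr)
    have h3 : M ^ n * ‖a - b‖ ≤ M ^ n * ‖a - b‖ * M :=
      le_mul_of_one_le_right (by positivity) hM
    rw [e]
    refine (norm_add_le _ _).trans ?_
    push_cast
    rw [pow_succ]
    nlinarith

/-- Powers of a sequence approaching `1` in the direction `Y` converge to the one-parameter
group of `Y`. -/
theorem tendsto_pow_exp [NormOneClass 𝔸] {u : ℕ → 𝔸} {h : ℕ → ℝ} {N : ℕ → ℕ} {t : ℝ} {Y : 𝔸}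
    (hpos : ∀ k, 0 < h k) (hh : Tendsto h atTop (𝓝 0))
    (hN : Tendsto (fun k => N k * h k) atTop (𝓝 t))
    (hu : Tendsto (fun k => (h k)⁻¹ • (u k - 1)) atTop (𝓝 Y)) :
    Tendsto (fun k => u k ^ N k) atTop (𝓝 (exp (t • Y))) := by
  -- The comparison sequence has explicit powers and agrees with `u` to order `o(h)`; it remains to
  -- bound the difference of the powers.
  set v : ℕ → 𝔸 := fun k => exp (h k • Y) with hv
  have hvd : Tendsto (fun k => (h k)⁻¹ • (v k - 1)) atTop (𝓝 Y) := by
    have hd : HasDerivAt (fun s : ℝ => exp (s • Y)) Y 0 := by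
      simpa using hasDerivAt_exp_smul_const (𝕂 := ℝ) Y (0 : ℝ)
    have := hd.tendsto_slope_zero
    have h2 : Tendsto h atTop (𝓝[≠] 0) :=
      tendsto_nhdsWithin_iff.2 ⟨hh, Eventually.of_forall fun k => (hpos k).ne'⟩
    simpa [hv, Function.comp_def] using this.comp h2
  have hvN : Tendsto (fun k => v k ^ N k) atTop (𝓝 (exp (t • Y))) := by
    simp only [hv, exp_smul_pow]
    exact (continuous_exp_real.tendsto _).comp (hN.smul_const Y)
  -- Both sequences are eventually bounded by `exp (h k * C)`, whose `N k`-th power converges.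
  set C := ‖Y‖ + 1 with hC
  have hbound : ∀ {w : ℕ → 𝔸}, Tendsto (fun k => (h k)⁻¹ • (w k - 1)) atTop (𝓝 Y) →
      ∀ᶠ k in atTop, ‖w k‖ ≤ Real.exp (h k * C) := by
    intro w hw
    filter_upwards [hw.norm.eventually_lt_const (lt_add_one ‖Y‖)] with k hk
    rw [norm_smul, norm_inv, Real.norm_of_nonneg (hpos k).le, inv_mul_lt_iff₀ (hpos k)] at hk
    have h1 : ‖w k‖ ≤ ‖w k - 1‖ + 1 := by
      simpa using norm_add_le (w k - 1) 1
    have h2 := Real.add_one_le_exp (h k * C)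
    rw [hC] at h2 ⊢
    linarith
  have hdiff : Tendsto (fun k => (N k * h k) * ‖(h k)⁻¹ • (u k - v k)‖ *
      Real.exp ((N k * h k) * C)) atTop (𝓝 (t * ‖(0 : 𝔸)‖ * Real.exp (t * C))) := by
    refine (hN.mul (Tendsto.norm ?_)).mul ((Real.continuous_exp.tendsto _).comp (hN.mul_const C))
    have := hu.sub hvd
    simp only [sub_self, ← smul_sub, sub_sub_sub_cancel_right] at this
    exact this
  rw [norm_zero, mul_zero, zero_mul] at hdiff
  have hz : Tendsto (fun k => u k ^ N k - v k ^ N k) atTop (𝓝 0) := by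
    refine squeeze_zero_norm' ?_ hdiff
    filter_upwards [hbound hu, hbound hvd] with k h1 h2
    have h3 : 1 ≤ Real.exp (h k * C) := Real.one_le_exp (by have := (hpos k).le; positivity)
    refine (norm_pow_sub_pow_le h3 h1 h2 (N k)).trans_eq ?_
    rw [← Real.exp_nat_mul, norm_smul, norm_inv, Real.norm_of_nonneg (hpos k).le]
    have := (hpos k).ne'
    field_simp
  simpa using hz.add hvN

/-- A group of invertible elements that is closed among the invertible elements. -/
structure IsClosedUnitGroup (S : Set 𝔸) : Prop where
  one_mem : 1 ∈ S
  mul_mem : ∀ a ∈ S, ∀ b ∈ S, a * b ∈ S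
  exists_inv : ∀ a ∈ S, ∃ b ∈ S, b * a = 1
  of_tendsto : ∀ (u : ℕ → 𝔸) (a : 𝔸), (∀ k, u k ∈ S) → IsUnit a →
    Tendsto u atTop (𝓝 a) → a ∈ S

namespace IsClosedUnitGroup

variable {S : Set 𝔸}

theorem pow_mem (hS : IsClosedUnitGroup S) {a : 𝔸} (ha : a ∈ S) (n : ℕ) : a ^ n ∈ S := by
  induction n with
  | zero => simpa using hS.one_mem
  | succ n ih => rw [pow_succ]; exact hS.mul_mem _ ih _ ha

theorem of_mul_eq_one (hS : IsClosedUnitGroup S) {a b : 𝔸} (ha : a ∈ S) (h : a * b = 1) :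
    b ∈ S := by
  obtain ⟨c, hc, hca⟩ := hS.exists_inv a ha
  rwa [← left_inv_eq_right_inv hca h]

/-- Every limiting direction of group elements tending to 1 belongs to the Lie algebra: for `t ≥ 0`
the powers with exponent `⌊t / h k⌋` converge to `exp (t • Y)`, which lies in the closed group;
negative times follow by inversion. -/
theorem exp_mem_of_tendsto [NormOneClass 𝔸] (hS : IsClosedUnitGroup S) {u : ℕ → 𝔸} {h : ℕ → ℝ}
    {Y : 𝔸} (hpos : ∀ k, 0 < h k) (hh : Tendsto h atTop (𝓝 0)) (huS : ∀ k, u k ∈ S)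
    (hu : Tendsto (fun k => (h k)⁻¹ • (u k - 1)) atTop (𝓝 Y)) (t : ℝ) : exp (t • Y) ∈ S := by
  have key : ∀ t : ℝ, 0 ≤ t → exp (t • Y) ∈ S := by
    intro t ht
    have hN : Tendsto (fun k => (⌊t / h k⌋₊ : ℝ) * h k) atTop (𝓝 t) := by
      have hl : Tendsto (fun k => t - h k) atTop (𝓝 t) := by simpa using hh.const_sub t
      refine tendsto_of_tendsto_of_tendsto_of_le_of_le hl tendsto_const_nhds ?_ ?_
      · intro k
        have h1 := Nat.lt_floor_add_one (t / h k)
        rw [div_lt_iff₀ (hpos k)] at h1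
        simp only
        linarith
      · intro k
        have h1 := Nat.floor_le (div_nonneg ht (hpos k).le)
        rwa [le_div_iff₀ (hpos k)] at h1
    exact hS.of_tendsto _ _ (fun k => hS.pow_mem (huS k) _) (isUnit_exp_real _)
      (tendsto_pow_exp hpos hh hN hu)
  rcases le_total 0 t with ht | ht
  · exact key t ht
  · refine hS.of_mul_eq_one (key (-t) (by linarith)) ?_
    simpa using exp_neg_smul_mul_exp_smul Y t

/-- The Lie algebra of a closed group, as a subspace. -/
def lieSubspace [NormOneClass 𝔸] (hS : IsClosedUnitGroup S) : Submodule ℝ 𝔸 where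
  carrier := {Y | ∀ t : ℝ, exp (t • Y) ∈ S}
  zero_mem' := by intro t; simpa using hS.one_mem
  smul_mem' := by intro c Y hY t; rw [smul_smul]; exact hY _
  add_mem' := by
    intro X Y hX hY t
    have hpos : ∀ k : ℕ, (0 : ℝ) < 1 / ((k : ℝ) + 1) := fun k => by positivity
    have hh := tendsto_one_div_add_atTop_nhds_zero_nat (𝕜 := ℝ)
    -- The products `exp (hX) exp (hY)` leave 1 in the direction `X + Y`.
    refine hS.exp_mem_of_tendsto (u := fun k : ℕ => exp ((1 / ((k : ℝ) + 1)) • X) *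
      exp ((1 / ((k : ℝ) + 1)) • Y)) hpos hh (fun k => hS.mul_mem _ (hX _) _ (hY _)) ?_ t
    have hd : HasDerivAt (fun s : ℝ => exp (s • X) * exp (s • Y)) (X + Y) 0 := by
      have h1 : HasDerivAt (fun s : ℝ => exp (s • X)) X 0 := by
        simpa using hasDerivAt_exp_smul_const (𝕂 := ℝ) X (0 : ℝ)
      have h2 : HasDerivAt (fun s : ℝ => exp (s • Y)) Y 0 := by
        simpa using hasDerivAt_exp_smul_const (𝕂 := ℝ) Y (0 : ℝ)
      simpa [Pi.mul_def] using h1.mul h2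
    have h2 : Tendsto (fun k : ℕ => 1 / ((k : ℝ) + 1)) atTop (𝓝[≠] 0) :=
      tendsto_nhdsWithin_iff.2 ⟨hh, Eventually.of_forall fun k => (hpos k).ne'⟩
    simpa [Function.comp_def] using hd.tendsto_slope_zero.comp h2

/-- Near `1`, a closed group is covered by the products of exponentials of two complementary
parts of its Lie algebra. -/
theorem eventually_eq_exp_mul_exp [NormOneClass 𝔸] [FiniteDimensional ℝ 𝔸]
    (hS : IsClosedUnitGroup S) (I R : Submodule ℝ 𝔸) (hI : I ≤ hS.lieSubspace)
    (hR : R ≤ hS.lieSubspace) (hIR : hS.lieSubspace ≤ R ⊔ I) :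
    ∀ᶠ g in 𝓝 (1 : 𝔸), g ∈ S → ∃ b ∈ R, ∃ c ∈ I, g = exp b * exp c := by
  -- With a complement `W` of the Lie algebra, `Θ` is a submersion at 0. The claim is that group
  -- elements near 1 can be written without the `W`-factor.
  obtain ⟨W, hW⟩ := Submodule.exists_isCompl hS.lieSubspace
  let Θ : W × R × I → 𝔸 := fun x => exp (x.1 : 𝔸) * (exp (x.2.1 : 𝔸) * exp (x.2.2 : 𝔸))
  let Θ' : W × R × I →L[ℝ] 𝔸 :=
    W.subtypeL.comp (ContinuousLinearMap.fst ℝ W (R × I)) +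
    (R.subtypeL.comp ((ContinuousLinearMap.fst ℝ R I).comp (ContinuousLinearMap.snd ℝ W (R × I))) +
    I.subtypeL.comp ((ContinuousLinearMap.snd ℝ R I).comp (ContinuousLinearMap.snd ℝ W (R × I))))
  have hexp : ∀ (f : W × R × I →L[ℝ] 𝔸), HasStrictFDerivAt (fun x => exp (f x)) f 0 := by
    intro f
    have h0 : HasStrictFDerivAt (exp : 𝔸 → 𝔸) (1 : 𝔸 →L[ℝ] 𝔸) (f 0) := by
      rw [map_zero]; exact hasStrictFDerivAt_exp_zero
    exact h0.comp (0 : W × R × I) f.hasStrictFDerivAt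
  have hΘ : HasStrictFDerivAt Θ Θ' 0 := by
    have h1 := hexp (W.subtypeL.comp (ContinuousLinearMap.fst ℝ W (R × I)))
    have h2 := hexp (R.subtypeL.comp ((ContinuousLinearMap.fst ℝ R I).comp
      (ContinuousLinearMap.snd ℝ W (R × I))))
    have h3 := hexp (I.subtypeL.comp ((ContinuousLinearMap.snd ℝ R I).comp
      (ContinuousLinearMap.snd ℝ W (R × I))))
    have := h1.mul' (h2.mul' h3)
    refine this.congr_fderiv ?_
    ext x <;> simp [Θ']
  have hsurj : Θ'.range = ⊤ := by
    rw [eq_top_iff]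
    intro x _
    have hx : x ∈ hS.lieSubspace ⊔ W := by rw [hW.sup_eq_top]; trivial
    obtain ⟨y, hy, w, hw, rfl⟩ := Submodule.mem_sup.1 hx
    obtain ⟨b, hb, c, hc, rfl⟩ := Submodule.mem_sup.1 (hIR hy)
    refine ⟨(⟨w, hw⟩, ⟨b, hb⟩, ⟨c, hc⟩), ?_⟩
    simp [Θ']
    abel
  by_contra hcon
  have hfreq : ∃ᶠ g in 𝓝 (1 : 𝔸), g ∈ S ∧ ¬ ∃ b ∈ R, ∃ c ∈ I, g = exp b * exp c := by
    rw [Filter.not_eventually] at hcon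
    exact hcon.mono fun g hg => by push Not at hg ⊢; exact hg
  have hmap : map Θ (𝓝 0) = 𝓝 (1 : 𝔸) := by
    have := hΘ.map_nhds_eq_of_surj hsurj
    simpa [Θ] using this
  rw [← hmap, frequently_map] at hfreq
  obtain ⟨x, hx, hxS⟩ := Filter.exists_seq_forall_of_frequently hfreq
  have hx1 : Tendsto (fun k => ((x k).1 : 𝔸)) atTop (𝓝 0) := by
    have : Continuous fun z : W × R × I => (z.1 : 𝔸) := by fun_prop
    simpa [Function.comp_def] using (this.tendsto 0).comp hx
  -- The other two factors lie in the group, so they can be divided out.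
  have hmem : ∀ k, exp ((x k).1 : 𝔸) ∈ S := by
    intro k
    have hb := hR (x k).2.1.2 1
    have hc := hI (x k).2.2.2 1
    have hb' := hR (x k).2.1.2 (-1)
    have hc' := hI (x k).2.2.2 (-1)
    have e : exp ((x k).1 : 𝔸) = Θ (x k) * (exp ((-1 : ℝ) • ((x k).2.2 : 𝔸)) *
        exp ((-1 : ℝ) • ((x k).2.1 : 𝔸))) := by
      have h1 := exp_smul_mul_exp_neg_smul ((x k).2.2 : 𝔸) 1
      have h2 := exp_smul_mul_exp_neg_smul ((x k).2.1 : 𝔸) 1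
      rw [one_smul] at h1 h2
      calc exp ((x k).1 : 𝔸) = exp ((x k).1 : 𝔸) * (exp ((x k).2.1 : 𝔸) *
            (exp ((x k).2.2 : 𝔸) * exp ((-1 : ℝ) • ((x k).2.2 : 𝔸))) *
              exp ((-1 : ℝ) • ((x k).2.1 : 𝔸))) := by rw [h1, mul_one, h2, mul_one]
        _ = _ := by simp only [Θ, mul_assoc]
    rw [e]
    exact hS.mul_mem _ (hxS k).1 _ (hS.mul_mem _ hc' _ hb')
  have hne : ∀ k, ((x k).1 : 𝔸) ≠ 0 := by
    intro k h0
    apply (hxS k).2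
    refine ⟨_, (x k).2.1.2, _, (x k).2.2.2, ?_⟩
    simp [Θ, h0]
  have hpos : ∀ k, 0 < ‖((x k).1 : 𝔸)‖ := fun k => norm_pos_iff.2 (hne k)
  have hsph : ∀ k, ‖((x k).1 : 𝔸)‖⁻¹ • ((x k).1 : 𝔸) ∈ Metric.sphere (0 : 𝔸) 1 := by
    intro k
    rw [mem_sphere_zero_iff_norm, norm_smul, norm_inv, norm_norm, inv_mul_cancel₀ (hpos k).ne']
  have : ProperSpace 𝔸 := FiniteDimensional.proper ℝ 𝔸
  -- A limit of the normalised `W`-components is a unit vector of `W` that is also a limiting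
  -- direction of the group, hence in the Lie algebra. This contradicts complementarity.
  obtain ⟨Y, hY, φ, hφ, hlim⟩ := (isCompact_sphere (0 : 𝔸) 1).tendsto_subseq hsph
  have hYW : Y ∈ W := by
    refine (Submodule.closed_of_finiteDimensional W).mem_of_tendsto hlim
      (Eventually.of_forall fun k => W.smul_mem _ (x (φ k)).1.2)
  have hYL : Y ∈ hS.lieSubspace := by
    refine hS.exp_mem_of_tendsto (u := fun k => exp ((x (φ k)).1 : 𝔸))
      (h := fun k => ‖((x (φ k)).1 : 𝔸)‖) (fun k => hpos _) ?_ (fun k => hmem _) ?_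
    · simpa using (hx1.comp hφ.tendsto_atTop).norm
    · have hd : HasFDerivAt (exp : 𝔸 → 𝔸) (1 : 𝔸 →L[ℝ] 𝔸) 0 := hasFDerivAt_exp_zero
      have ho := hd.isLittleO.comp_tendsto (hx1.comp hφ.tendsto_atTop)
      have ho2 : Tendsto (fun k => ‖((x (φ k)).1 : 𝔸)‖⁻¹ •
          (exp ((x (φ k)).1 : 𝔸) - 1 - ((x (φ k)).1 : 𝔸))) atTop (𝓝 0) := by
        have := ho.norm_right.tendsto_inv_smul_nhds_zero
        simpa [Function.comp_def] using this
      have := ho2.add hlim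
      rw [zero_add] at this
      refine this.congr fun k => ?_
      simp only [Function.comp_apply]
      rw [← smul_add, sub_add_cancel]
  have : Y = 0 := by
    have := hW.disjoint.le_bot ⟨hYL, hYW⟩
    simpa using this
  rw [this] at hY
  simp at hY

end IsClosedUnitGroup

end ClosedGroup

end AffineTube

open scoped ContDiff Topology Pointwise


namespace AffineTube

/-! ### Affine automorphism groups: from transitivity to infinitesimal transitivity. -/

section AffineGroup

variable {E : Type*} [NormedAddCommGroup E] [NormedSpace ℝ E] [FiniteDimensional ℝ E]

theorem hasDerivAt_exp_smul_apply (Y : E →L[ℝ] E) (z : E) (t : ℝ) :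
    HasDerivAt (fun s : ℝ => exp (s • Y) z) (exp (t • Y) (Y z)) t := by
  have h := hasDerivAt_exp_smul_const (𝕂 := ℝ) Y t
  simpa using h.clm_apply (hasDerivAt_const t z)

theorem exp_smul_apply_of_apply_eq_zero {Y : E →L[ℝ] E} {z : E} (hz : Y z = 0) (t : ℝ) :
    exp (t • Y) z = z := by
  have h := is_const_of_deriv_eq_zero (f := fun s : ℝ => exp (s • Y) z)
    (fun s => (hasDerivAt_exp_smul_apply Y z s).differentiableAt)
    (fun s => by rw [(hasDerivAt_exp_smul_apply Y z s).deriv, hz, map_zero]) t 0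
  simpa using h

/-- The affine automorphisms of `Ω`, as linear automorphisms of `E × ℝ`. -/
def affineLifts (Ω : Set E) : Set ((E × ℝ) →L[ℝ] (E × ℝ)) :=
  {g | IsUnit g ∧ (∀ z, (g z).2 = z.2) ∧ ∀ x, (g (x, 1)).1 ∈ Ω ↔ x ∈ Ω}

theorem apply_mk_one_of_mem_affineLifts {Ω : Set E} {g : (E × ℝ) →L[ℝ] (E × ℝ)}
    (hg : g ∈ affineLifts Ω) (x : E) : g (x, 1) = ((g (x, 1)).1, 1) :=
  Prod.ext rfl (hg.2.1 (x, 1))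

theorem mem_affineLifts_of_mul_eq_one {Ω : Set E} {g b : (E × ℝ) →L[ℝ] (E × ℝ)}
    (hg : g ∈ affineLifts Ω) (h1 : g * b = 1) (h2 : b * g = 1) : b ∈ affineLifts Ω := by
  have hgb : ∀ z, g (b z) = z := fun z => by
    have := DFunLike.congr_fun h1 z
    simpa using this
  have hb2 : ∀ z, (b z).2 = z.2 := fun z => by rw [← hg.2.1 (b z), hgb]
  refine ⟨⟨⟨b, g, h2, h1⟩, rfl⟩, hb2, fun x => ?_⟩
  have h3 : b (x, 1) = ((b (x, 1)).1, 1) := Prod.ext rfl (hb2 _)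
  rw [← hg.2.2 (b (x, 1)).1, ← h3, hgb]

/-- Closedness uses openness of Ω: if the limit sends `x` into Ω, then so does some term of the
sequence, hence `x ∈ Ω`. The converse is the same argument for the inverses, which converge because
the limit is invertible. -/
theorem isClosedUnitGroup_affineLifts {Ω : Set E} (hΩ : IsOpen Ω) :
    IsClosedUnitGroup (affineLifts Ω) where
  one_mem := ⟨isUnit_one, fun _ => rfl, fun _ => Iff.rfl⟩
  mul_mem a ha b hb := by
    refine ⟨ha.1.mul hb.1, fun z => ?_, fun x => ?_⟩
    · rw [mul_apply_eq_comp, ha.2.1, hb.2.1]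
    · rw [mul_apply_eq_comp, apply_mk_one_of_mem_affineLifts hb, ha.2.2, hb.2.2]
  exists_inv a ha := by
    obtain ⟨u, rfl⟩ := ha.1
    exact ⟨_, mem_affineLifts_of_mul_eq_one ha u.mul_inv u.inv_mul, u.inv_mul⟩
  of_tendsto u a hu ha hlim := by
    have happ : ∀ {w : ℕ → (E × ℝ) →L[ℝ] (E × ℝ)} {b} (_ : Tendsto w atTop (𝓝 b)) (z : E × ℝ),
        Tendsto (fun k => w k z) atTop (𝓝 (b z)) := fun h z =>
      ((ContinuousLinearMap.apply ℝ (E × ℝ) z).continuous.tendsto _).comp h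
    have h2 : ∀ z, (a z).2 = z.2 := fun z => by
      have := (continuous_snd.tendsto _).comp (happ hlim z)
      refine tendsto_nhds_unique this ?_
      refine tendsto_const_nhds.congr fun k => ?_
      exact ((hu k).2.1 z).symm
    refine ⟨ha, h2, fun x => ⟨fun hx => ?_, fun hx => ?_⟩⟩
    · have h1 := (continuous_fst.tendsto _).comp (happ hlim (x, 1))
      obtain ⟨k, hk⟩ := (h1.eventually (hΩ.mem_nhds hx)).exists
      exact ((hu k).2.2 x).1 hk
    · obtain ⟨a, rfl⟩ := ha
      have hinv : Tendsto (fun k => Ring.inverse (u k)) atTop (𝓝 ((a⁻¹ : Units _) : _)) := by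
        have := (NormedRing.inverse_continuousAt a).tendsto.comp hlim
        rwa [Ring.inverse_unit] at this
      set y := ((a : (E × ℝ) →L[ℝ] (E × ℝ)) (x, 1)).1 with hy
      have hay : ((a⁻¹ : Units _) : (E × ℝ) →L[ℝ] (E × ℝ)) (y, 1) = (x, 1) := by
        have e : (a : (E × ℝ) →L[ℝ] (E × ℝ)) (x, 1) = (y, 1) := Prod.ext rfl (h2 _)
        rw [← e, ← mul_apply_eq_comp, Units.inv_mul]
        rfl
      have h1 := (continuous_fst.tendsto _).comp (happ hinv (y, 1))
      rw [hay] at h1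
      obtain ⟨k, hk⟩ := (h1.eventually (hΩ.mem_nhds hx)).exists
      have hm := mem_affineLifts_of_mul_eq_one (hu k) (Ring.mul_inverse_cancel _ (hu k).1)
        (Ring.inverse_mul_cancel _ (hu k).1)
      exact (hm.2.2 y).1 hk

/-- The group of affine automorphisms of `Ω`. -/
def affineGroup (Ω : Set E) : Subgroup ((E × ℝ) →L[ℝ] (E × ℝ))ˣ where
  carrier := {u | (u : (E × ℝ) →L[ℝ] (E × ℝ)) ∈ affineLifts Ω}
  one_mem' := ⟨isUnit_one, fun _ => rfl, fun _ => Iff.rfl⟩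
  mul_mem' {a b} ha hb := by
    refine ⟨ha.1.mul hb.1, fun z => ?_, fun x => ?_⟩
    · rw [Units.val_mul, mul_apply_eq_comp, ha.2.1, hb.2.1]
    · rw [Units.val_mul, mul_apply_eq_comp, apply_mk_one_of_mem_affineLifts hb,
        ha.2.2, hb.2.2]
  inv_mem' {a} ha := mem_affineLifts_of_mul_eq_one ha a.mul_inv a.inv_mul

theorem isClosed_affineGroup {Ω : Set E} (hΩ : IsOpen Ω) :
    IsClosed (affineGroup Ω : Set ((E × ℝ) →L[ℝ] (E × ℝ))ˣ) := by
  have : SecondCountableTopology ((E × ℝ) →L[ℝ] (E × ℝ)) :=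
    let _ := FiniteDimensional.proper ℝ ((E × ℝ) →L[ℝ] (E × ℝ))
    inferInstance
  have h2 : SecondCountableTopology ((E × ℝ) →L[ℝ] (E × ℝ))ˣ :=
    Units.isOpenEmbedding_val.isEmbedding.secondCountableTopology
  refine IsSeqClosed.isClosed fun u a hu ha => ?_
  exact (isClosedUnitGroup_affineLifts hΩ).of_tendsto _ _ hu a.isUnit
    ((Units.continuous_val.tendsto _).comp ha)

/-- This is what makes the Baire category argument for openness of orbit maps available. -/
theorem sigmaCompactSpace_affineGroup {Ω : Set E} (hΩ : IsOpen Ω) :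
    SigmaCompactSpace (affineGroup Ω) := by
  have hp : ProperSpace ((E × ℝ) →L[ℝ] (E × ℝ)) := FiniteDimensional.proper ℝ _
  have h2 : SecondCountableTopology ((E × ℝ) →L[ℝ] (E × ℝ))ˣ :=
    Units.isOpenEmbedding_val.isEmbedding.secondCountableTopology
  have h3 : LocallyCompactSpace ((E × ℝ) →L[ℝ] (E × ℝ))ˣ :=
    Units.isOpenEmbedding_val.locallyCompactSpace
  exact (isClosed_affineGroup hΩ).isClosedEmbedding_subtypeVal.sigmaCompactSpace

instance affineGroupAction (Ω : Set E) : MulAction (affineGroup Ω) Ω where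
  smul g x := ⟨((g.1 : (E × ℝ) →L[ℝ] (E × ℝ)) (x.1, 1)).1, (g.2.2.2 x.1).2 x.2⟩
  one_smul x := rfl
  mul_smul g h x := by
    apply Subtype.ext
    change (((g.1 * h.1 : Units _) : (E × ℝ) →L[ℝ] (E × ℝ)) (x.1, 1)).1 =
      ((g.1 : (E × ℝ) →L[ℝ] (E × ℝ)) (((h.1 : (E × ℝ) →L[ℝ] (E × ℝ)) (x.1, 1)).1, 1)).1
    rw [← apply_mk_one_of_mem_affineLifts h.2]
    rfl

theorem affineGroup_smul_coe {Ω : Set E} (g : affineGroup Ω) (x : Ω) :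
    ((g • x : Ω) : E) = ((g.1 : (E × ℝ) →L[ℝ] (E × ℝ)) (x.1, 1)).1 := rfl

instance affineGroup_continuousSMul (Ω : Set E) : ContinuousSMul (affineGroup Ω) Ω where
  continuous_smul := by
    refine Continuous.subtype_mk ?_ _
    have h1 : Continuous fun z : affineGroup Ω × Ω => (z.1.1 : (E × ℝ) →L[ℝ] (E × ℝ)) :=
      Units.continuous_val.comp (continuous_subtype_val.comp continuous_fst)
    fun_prop

/-- The linear map of `E × ℝ` induced by an affine map of `E`. -/
noncomputable def liftAffine (g : E →ᵃ[ℝ] E) : (E × ℝ) →L[ℝ] (E × ℝ) :=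
  LinearMap.toContinuousLinearMap
    ((g.linear.coprod (LinearMap.toSpanSingleton ℝ E (g 0))).prod (LinearMap.snd ℝ E ℝ))

theorem liftAffine_apply (g : E →ᵃ[ℝ] E) (z : E × ℝ) :
    liftAffine g z = (g.linear z.1 + z.2 • g 0, z.2) := rfl

theorem liftAffine_apply_one (g : E →ᵃ[ℝ] E) (x : E) : liftAffine g (x, 1) = (g x, 1) := by
  have h := g.map_vadd 0 x
  simp only [vadd_eq_add, add_zero] at h
  rw [liftAffine_apply, h, one_smul]

theorem liftAffine_mul_symm (g : E ≃ᵃ[ℝ] E) :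
    liftAffine (g : E →ᵃ[ℝ] E) * liftAffine (g.symm : E →ᵃ[ℝ] E) = 1 := by
  refine ContinuousLinearMap.ext fun z => ?_
  rw [mul_apply_eq_comp, liftAffine_apply, liftAffine_apply]
  have h := g.toAffineMap.map_vadd 0 (g.symm 0)
  simp only [vadd_eq_add, add_zero, AffineEquiv.coe_toAffineMap, AffineEquiv.apply_symm_apply,
    AffineEquiv.linear_toAffineMap] at h
  refine Prod.ext ?_ rfl
  simp only [map_add, map_smul, AffineEquiv.linear_toAffineMap, AffineEquiv.coe_toAffineMap,
    one_apply_eq_self]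
  have h2 : g.linear (g.symm.linear z.1) = z.1 := g.linear.apply_symm_apply z.1
  change g.linear (g.symm.linear z.1) + z.2 • g.linear (g.symm 0) + z.2 • g 0 = z.1
  rw [h2, add_assoc, ← smul_add]
  change 0 = g.linear (g.symm 0) + g 0 at h
  rw [← h, smul_zero, add_zero]

theorem liftAffine_mem {Ω : Set E} (g : E ≃ᵃ[ℝ] E) (hg : g '' Ω = Ω) :
    liftAffine (g : E →ᵃ[ℝ] E) ∈ affineLifts Ω := by
  refine ⟨⟨⟨_, _, liftAffine_mul_symm g, liftAffine_mul_symm g.symm⟩, rfl⟩, fun z => rfl,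
    fun x => ?_⟩
  rw [liftAffine_apply_one]
  constructor
  · intro hx
    change g x ∈ Ω at hx
    rw [← hg] at hx
    exact (g.injective.mem_set_image).1 hx
  · intro hx
    exact hg ▸ Set.mem_image_of_mem g hx

theorem snd_apply_of_mem_lieSubspace {Ω : Set E} (hΩ : IsOpen Ω) {Y : (E × ℝ) →L[ℝ] (E × ℝ)}
    (hY : Y ∈ (isClosedUnitGroup_affineLifts hΩ).lieSubspace) (z : E × ℝ) : (Y z).2 = 0 := by
  have h1 := hasDerivAt_exp_smul_apply Y z 0
  have h2 : HasDerivAt (fun s : ℝ => (exp (s • Y) z).2) (Y z).2 0 := by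
    have := (ContinuousLinearMap.snd ℝ E ℝ).hasFDerivAt.comp_hasDerivAt (0 : ℝ) h1
    simpa [Function.comp_def] using this
  have h3 : (fun s : ℝ => (exp (s • Y) z).2) = fun _ => z.2 := funext fun s => (hY s).2.1 z
  rw [h3] at h2
  exact h2.unique (hasDerivAt_const _ _)

/-- The one-parameter groups of affine automorphisms of an affinely homogeneous open set act
infinitesimally transitively on it. -/
theorem exists_mem_lieSubspace_apply_eq {Ω : Set E} (hΩ : IsOpen Ω)
    (htr : ∀ p ∈ Ω, ∀ q ∈ Ω, ∃ g : E ≃ᵃ[ℝ] E, g '' Ω = Ω ∧ g p = q) {p : E} (hp : p ∈ Ω) (v : E) :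
    ∃ Y ∈ (isClosedUnitGroup_affineLifts hΩ).lieSubspace, Y (p, 1) = (v, 0) := by
  set hS := isClosedUnitGroup_affineLifts hΩ
  set L := hS.lieSubspace with hL
  let ev : ((E × ℝ) →L[ℝ] (E × ℝ)) →ₗ[ℝ] E :=
    LinearMap.fst ℝ E ℝ ∘ₗ (ContinuousLinearMap.apply ℝ (E × ℝ) ((p, 1) : E × ℝ)).toLinearMap
  have hev : ∀ Y, ev Y = (Y (p, 1)).1 := fun Y => rfl
  by_contra hcon
  have hne : L.map ev ≠ ⊤ := by
    intro h
    have hv : v ∈ L.map ev := h ▸ trivial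
    obtain ⟨Y, hY, hYv⟩ := hv
    exact hcon ⟨Y, hY, Prod.ext hYv (snd_apply_of_mem_lieSubspace hΩ hY _)⟩
  -- `R = R' ⊓ L` complements the stabilizer algebra inside `L`. Evaluation is injective on it but
  -- not onto `E`, so `dim R < dim E`.
  obtain ⟨R', hR'⟩ := Submodule.exists_isCompl (L ⊓ LinearMap.ker ev)
  have hcover := hS.eventually_eq_exp_mul_exp (L ⊓ LinearMap.ker ev) (R' ⊓ L) inf_le_left
    inf_le_right (by
      intro x hx
      have : x ∈ (L ⊓ LinearMap.ker ev) ⊔ R' := by rw [hR'.sup_eq_top]; trivial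
      obtain ⟨i, hi, r, hr, rfl⟩ := Submodule.mem_sup.1 this
      have hrL : r ∈ L := by simpa using L.sub_mem hx hi.1
      exact Submodule.mem_sup.2 ⟨r, ⟨hr, hrL⟩, i, hi, add_comm _ _⟩)
  set R := R' ⊓ L
  have hinj : Function.Injective (ev.domRestrict R) := by
    rw [← LinearMap.ker_eq_bot, LinearMap.ker_eq_bot']
    intro x hx
    have h1 : (x : (E × ℝ) →L[ℝ] (E × ℝ)) ∈ (L ⊓ LinearMap.ker ev) ⊓ R' :=
      ⟨⟨x.2.2, hx⟩, x.2.1⟩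
    rw [hR'.inf_eq_bot] at h1
    exact Subtype.ext h1
  have hrank : Module.finrank ℝ R < Module.finrank ℝ E := by
    rw [← LinearMap.finrank_range_of_inj hinj]
    refine Submodule.finrank_lt (lt_of_le_of_lt ?_ (lt_top_iff_ne_top.2 hne)).ne
    rintro _ ⟨x, rfl⟩
    exact ⟨x, x.2.2, rfl⟩
  let f : R → E := fun b => (exp (b : (E × ℝ) →L[ℝ] (E × ℝ)) (p, 1)).1
  have hf : ContDiff ℝ 1 f := by
    have h1 : ContDiff ℝ 1 (exp : ((E × ℝ) →L[ℝ] (E × ℝ)) → _) :=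
      contDiff_iff_contDiffAt.2 fun x => (exp_analytic (𝕂 := ℝ) x).contDiffAt
    have h2 : ContDiff ℝ 1 fun b : R => exp (b : (E × ℝ) →L[ℝ] (E × ℝ)) :=
      h1.comp R.subtypeL.contDiff
    exact contDiff_fst.comp (h2.clm_apply contDiff_const)
  -- A `C¹` image of a space of smaller dimension has dense complement.
  have hdense := hf.dense_compl_range_of_finrank_lt_finrank hrank
  have : SigmaCompactSpace (affineGroup Ω) := sigmaCompactSpace_affineGroup hΩ
  have : LocallyCompactSpace Ω :=
    let _ := FiniteDimensional.proper ℝ E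
    hΩ.locallyCompactSpace
  have : MulAction.IsPretransitive (affineGroup Ω) Ω := by
    refine ⟨fun x y => ?_⟩
    obtain ⟨g, hg, hgx⟩ := htr x x.2 y y.2
    have hm := liftAffine_mem g hg
    refine ⟨⟨hm.1.unit, hm⟩, Subtype.ext ?_⟩
    rw [affineGroup_smul_coe]
    change (liftAffine (g : E →ᵃ[ℝ] E) (x.1, 1)).1 = y
    rw [liftAffine_apply_one]
    exact hgx
  let U : Set (affineGroup Ω) := {u | ∃ b ∈ R, ∃ c ∈ L ⊓ LinearMap.ker ev,
    (u.1 : (E × ℝ) →L[ℝ] (E × ℝ)) = exp b * exp c}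
  have hU : U ∈ 𝓝 (1 : affineGroup Ω) := by
    have hc : Continuous fun u : affineGroup Ω => (u.1 : (E × ℝ) →L[ℝ] (E × ℝ)) :=
      Units.continuous_val.comp continuous_subtype_val
    have := (hc.tendsto 1).eventually hcover
    filter_upwards [this] with u hu using hu u.2
  -- Orbit maps of a transitive σ-compact group are open, so the orbit of `p` under `U` is a
  -- neighbourhood. But `exp b * exp c` moves `p` to `exp b p`, so this orbit lies in the range of
  -- `f`.
  have hnhds := smul_singleton_mem_nhds_of_sigmaCompact hU (⟨p, hp⟩ : Ω)
  have himg : Subtype.val '' (U • ({⟨p, hp⟩} : Set Ω)) ∈ 𝓝 p := by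
    have := hΩ.isOpenEmbedding_subtypeVal.map_nhds_eq (⟨p, hp⟩ : Ω)
    rw [← this]
    exact image_mem_map hnhds
  obtain ⟨y, hy, hyR⟩ := hdense.inter_nhds_nonempty himg
  apply hy
  obtain ⟨_, hz, rfl⟩ := hyR
  rw [Set.smul_singleton] at hz
  obtain ⟨u, ⟨b, hb, c, hc, huv⟩, rfl⟩ := hz
  refine ⟨⟨b, hb⟩, ?_⟩
  have hcp : c (p, 1) = 0 := Prod.ext hc.2 (snd_apply_of_mem_lieSubspace hΩ hc.1 _)
  have h1 := exp_smul_apply_of_apply_eq_zero hcp 1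
  rw [one_smul] at h1
  simp only [f]
  rw [affineGroup_smul_coe, huv, mul_apply_eq_comp, h1]

end AffineGroup

end AffineTube

namespace AffineTube

/-! ### Straightening a regular level set. -/

section FlatParametrization

variable {E : Type*} [NormedAddCommGroup E] [NormedSpace ℝ E] [FiniteDimensional ℝ E]

/-- Near a regular point a function becomes linear in suitable coordinates. -/
theorem exists_flat_parametrization {F : E → ℝ} {q : E} (hF : ContDiffAt ℝ 1 F q) (hq : F q = 0)
    {η : E} (hη : fderiv ℝ F q η = 1) {N : Set E} (hN : N ∈ 𝓝 q) :
    ∃ (ψ : E → E) (r : ℝ), 0 < r ∧ ψ 0 = q ∧ ContDiffOn ℝ 1 ψ (Metric.ball 0 r) ∧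
      (∀ z ∈ Metric.ball (0 : E) r, ψ z ∈ N) ∧
      (∀ z ∈ Metric.ball (0 : E) r, F (ψ z) = fderiv ℝ F q z) ∧
      ∀ B ∈ 𝓝 (0 : E), ψ '' B ∈ 𝓝 q := by
  set φ := fderiv ℝ F q with hφ
  -- A correction along η alone achieves `φ ∘ Φ = F`, because `φ η = 1`. Its derivative at `q` is
  -- the identity, and ψ is the local inverse.
  let Φ : E → E := fun x => (x - q) + (F x - φ (x - q)) • η
  have hΦ : ContDiffAt ℝ 1 Φ q := by
    have h1 : ContDiffAt ℝ 1 (fun x : E => x - q) q := contDiffAt_id.sub contDiffAt_const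
    exact h1.add ((hF.sub (φ.contDiff.contDiffAt.comp q h1)).smul contDiffAt_const)
  have hΦ' : HasFDerivAt Φ ((ContinuousLinearEquiv.refl ℝ E : E ≃L[ℝ] E) : E →L[ℝ] E) q := by
    have h1 : HasFDerivAt (fun x : E => x - q) (ContinuousLinearMap.id ℝ E) q :=
      (hasFDerivAt_id q).sub_const q
    have h2 : HasFDerivAt F φ q := (hF.differentiableAt one_ne_zero).hasFDerivAt
    have h3 : HasFDerivAt (fun x : E => φ (x - q)) φ q := by
      have := φ.hasFDerivAt.comp q h1
      simpa [Function.comp_def] using this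
    have h4 := h1.add ((h2.sub h3).smul_const η)
    refine h4.congr_fderiv ?_
    ext v
    simp
  have hΦq : Φ q = 0 := by simp [Φ, hq]
  have hφΦ : ∀ x, φ (Φ x) = F x := fun x => by simp [Φ, hη]
  set e := hΦ.toOpenPartialHomeomorph Φ hΦ' one_ne_zero with he
  have hes : q ∈ e.source := hΦ.mem_toOpenPartialHomeomorph_source hΦ' one_ne_zero
  have heq : e q = 0 := hΦq
  have het : (0 : E) ∈ e.target := by
    rw [← heq]; exact e.map_source hes
  have hsymm0 : e.symm 0 = q := by rw [← heq]; exact e.left_inv hes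
  have hcd : ContDiffAt ℝ 1 e.symm 0 := by
    refine e.contDiffAt_symm het (f₀' := ContinuousLinearEquiv.refl ℝ E) ?_ ?_
    · rw [hsymm0]; exact hΦ'
    · rw [hsymm0]; exact hΦ
  have hcont : Tendsto e.symm (𝓝 0) (𝓝 q) := by
    have := hcd.continuousAt.tendsto
    rwa [hsymm0] at this
  have hev : ∀ᶠ z in 𝓝 (0 : E), ContDiffAt ℝ 1 e.symm z ∧ e.symm z ∈ N ∧ z ∈ e.target :=
    (hcd.eventually (by simp)).and ((hcont.eventually hN).and (e.open_target.mem_nhds het))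
  obtain ⟨r, hr, hball⟩ := Metric.eventually_nhds_iff_ball.1 hev
  refine ⟨e.symm, r, hr, hsymm0, fun z hz => (hball z hz).1.contDiffWithinAt,
    fun z hz => (hball z hz).2.1, fun z hz => ?_, fun B hB => ?_⟩
  · rw [← hφΦ (e.symm z)]
    exact congrArg φ (e.right_inv (hball z hz).2.2)
  · have h1 : e ⁻¹' B ∩ e.source ∈ 𝓝 q := by
      refine inter_mem ?_ (e.open_source.mem_nhds hes)
      refine (e.continuousAt hes).preimage_mem_nhds ?_
      rw [heq]
      exact hB
    refine mem_of_superset h1 ?_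
    rintro x ⟨hx1, hx2⟩
    exact ⟨e x, hx1, e.left_inv hx2⟩

/-- A function vanishing on a regular level set has there a differential proportional to that
of the defining function. -/
theorem exists_fderiv_eq_smul {F G : E → ℝ} {q : E} (hF : ContDiffAt ℝ 1 F q) (hq : F q = 0)
    (hdF : fderiv ℝ F q ≠ 0) (hG : ContDiffAt ℝ 1 G q)
    (hGF : ∀ᶠ x in 𝓝 q, F x = 0 → G x = 0) : ∃ c : ℝ, fderiv ℝ G q = c • fderiv ℝ F q := by
  have hG0 : G q = 0 := hGF.self_of_nhds hq
  -- `G` is constant on the level set, so `q` is trivially a constrained extremum and Lagrange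
  -- multipliers apply.
  have hext : IsLocalExtrOn G {x | F x = F q} q := by
    refine Or.inl ?_
    have : ∀ᶠ x in 𝓝[{x | F x = F q}] q, G q ≤ G x := by
      filter_upwards [self_mem_nhdsWithin, mem_nhdsWithin_of_mem_nhds hGF] with x hx hx2
      rw [hG0, hx2 (by rw [← hq]; exact hx)]
    exact this
  obtain ⟨a, b, hab, h⟩ := hext.exists_multipliers_of_hasStrictFDerivAt_1d
    (hF.hasStrictFDerivAt one_ne_zero) (hG.hasStrictFDerivAt one_ne_zero)
  have hb : b ≠ 0 := by
    rintro rfl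
    rw [zero_smul, add_zero, smul_eq_zero] at h
    rcases h with h | h
    · exact hab (by rw [h]; rfl)
    · exact hdF h
  refine ⟨-(b⁻¹ * a), ?_⟩
  have h2 : b • fderiv ℝ G q = -(a • fderiv ℝ F q) := by
    rw [eq_neg_iff_add_eq_zero, add_comm]; exact h
  calc fderiv ℝ G q = b⁻¹ • (b • fderiv ℝ G q) := by rw [smul_smul, inv_mul_cancel₀ hb, one_smul]
    _ = _ := by rw [h2, smul_neg, smul_smul, neg_smul]

end FlatParametrization

/-! ### Symmetry algebra of a hypersurface and its relation to the domain. -/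

section Hypersurface

theorem two_le_infty : (2 : ℕ∞ω) ≤ ∞ := by exact WithTop.coe_le_coe.2 (le_top : (2 : ℕ∞) ≤ ⊤)

variable {m : ℕ} {Γ U : Set (Fin m → ℝ)} {F : (Fin m → ℝ) → ℝ} {q : Fin m → ℝ}

namespace IsDefiningFunction

theorem contDiffAt (hF : IsDefiningFunction Γ U F) (hq : q ∈ U) : ContDiffAt ℝ ∞ F q :=
  hF.contDiffOn.contDiffAt (hF.isOpen.mem_nhds hq)

theorem exists_fderiv_eq (hF : IsDefiningFunction Γ U F) (hqU : q ∈ U) (hq : q ∈ Γ)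
    {G : (Fin m → ℝ) → ℝ} (hG : ContDiffAt ℝ 1 G q) (hGΓ : ∀ᶠ x in 𝓝 q, x ∈ Γ → G x = 0) :
    ∃ c : ℝ, fderiv ℝ G q = c • fderiv ℝ F q := by
  refine exists_fderiv_eq_smul ((hF.contDiffAt hqU).of_le (by simp))
    ((hF.mem_iff q hqU).1 hq) (hF.fderiv_ne_zero q hqU) hG ?_
  filter_upwards [hGΓ, hF.isOpen.mem_nhds hqU] with x hx hxU hFx
  exact hx ((hF.mem_iff x hxU).2 hFx)

/-- One defining function suffices to test tangency, since the differentials of all of them are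
proportional along Γ. -/
theorem mem_tangentSpace_iff (hF : IsDefiningFunction Γ U F) (hqU : q ∈ U) (hq : q ∈ Γ)
    {v : Fin m → ℝ} : v ∈ tangentSpace Γ q ↔ fderiv ℝ F q v = 0 := by
  refine ⟨fun h => h U F hqU hF, fun h U' F' hqU' hF' => ?_⟩
  obtain ⟨c, hc⟩ := hF.exists_fderiv_eq hqU hq
    ((hF'.contDiffAt hqU').of_le (by simp)) (G := F') (by
      filter_upwards [hF'.isOpen.mem_nhds hqU'] with x hx hxΓ using (hF'.mem_iff x hx).1 hxΓ)
  rw [hc]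
  simp [h]

theorem fderiv_apply_symmetry (hF : IsDefiningFunction Γ U F) (hqU : q ∈ U) (hq : q ∈ Γ)
    {X : (Fin m → ℝ) →ᵃ[ℝ] (Fin m → ℝ)} (hX : X ∈ symmetryAlgebra Γ) :
    fderiv ℝ F q (X q) = 0 :=
  (hF.mem_tangentSpace_iff hqU hq).1 (hX q hq)

end IsDefiningFunction

theorem mem_tangentSpace_of_hasDerivAt {c : ℝ → Fin m → ℝ} {v : Fin m → ℝ}
    (hc : HasDerivAt c v 0) (hΓ : ∀ᶠ t in 𝓝 0, c t ∈ Γ) : v ∈ tangentSpace Γ (c 0) := by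
  intro U F hU hF
  have h0 := hΓ.self_of_nhds
  have h1 : HasDerivAt (fun t => F (c t)) (fderiv ℝ F (c 0) v) 0 := by
    have := ((hF.contDiffAt hU).differentiableAt (by simp)).hasFDerivAt.comp_hasDerivAt (0 : ℝ) hc
    simpa [Function.comp_def] using this
  have h2 : (fun t => F (c t)) =ᶠ[𝓝 0] fun _ => (0 : ℝ) := by
    filter_upwards [hΓ, hc.continuousAt.preimage_mem_nhds (hF.isOpen.mem_nhds hU)] with t ht htU
    exact (hF.mem_iff _ htU).1 ht
  exact h1.unique ((hasDerivAt_const (0 : ℝ) (0 : ℝ)).congr_of_eventuallyEq h2)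

/-- The affine vector field `x ↦ X'(Y x) - Y'(X x)`. -/
noncomputable def affineBracket (X Y : (Fin m → ℝ) →ᵃ[ℝ] (Fin m → ℝ)) :
    (Fin m → ℝ) →ᵃ[ℝ] (Fin m → ℝ) :=
  X.linear.toAffineMap.comp Y - Y.linear.toAffineMap.comp X

theorem affineBracket_apply (X Y : (Fin m → ℝ) →ᵃ[ℝ] (Fin m → ℝ)) (x : Fin m → ℝ) :
    affineBracket X Y x = X.linear (Y x) - Y.linear (X x) := rfl

theorem hasFDerivAt_affineMap (X : (Fin m → ℝ) →ᵃ[ℝ] (Fin m → ℝ)) (x : Fin m → ℝ) :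
    HasFDerivAt X (LinearMap.toContinuousLinearMap X.linear) x := by
  have h : (X : (Fin m → ℝ) → (Fin m → ℝ)) =
      fun y => LinearMap.toContinuousLinearMap X.linear y + X 0 := by
    funext y
    have := X.map_vadd 0 y
    simpa using this
  rw [h]
  exact (ContinuousLinearMap.hasFDerivAt _).add_const _

theorem contDiff_affineMap (X : (Fin m → ℝ) →ᵃ[ℝ] (Fin m → ℝ)) {k : ℕ∞ω} : ContDiff ℝ k X := by
  have h : (X : (Fin m → ℝ) → (Fin m → ℝ)) =
      fun y => LinearMap.toContinuousLinearMap X.linear y + X 0 := by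
    funext y
    have := X.map_vadd 0 y
    simpa using this
  rw [h]
  exact (ContinuousLinearMap.contDiff _).add contDiff_const

/-- The derivative of a function along an affine vector field. -/
noncomputable def derivAlong (F : (Fin m → ℝ) → ℝ) (X : (Fin m → ℝ) →ᵃ[ℝ] (Fin m → ℝ))
    (x : Fin m → ℝ) : ℝ := fderiv ℝ F x (X x)

theorem hasFDerivAt_derivAlong {x : Fin m → ℝ} (hF : ContDiffAt ℝ 2 F x)
    (X : (Fin m → ℝ) →ᵃ[ℝ] (Fin m → ℝ)) :
    HasFDerivAt (derivAlong F X) ((fderiv ℝ F x).comp (LinearMap.toContinuousLinearMap X.linear) +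
      (fderiv ℝ (fderiv ℝ F) x).flip (X x)) x := by
  have h1 : HasFDerivAt (fderiv ℝ F) (fderiv ℝ (fderiv ℝ F) x) x :=
    ((hF.fderiv_right (m := 1) (by norm_num)).differentiableAt one_ne_zero).hasFDerivAt
  exact h1.clm_apply (hasFDerivAt_affineMap X x)

theorem IsDefiningFunction.contDiffAt_derivAlong (hF : IsDefiningFunction Γ U F) (hqU : q ∈ U)
    (X : (Fin m → ℝ) →ᵃ[ℝ] (Fin m → ℝ)) : ContDiffAt ℝ ∞ (derivAlong F X) q :=
  ((hF.contDiffAt hqU).fderiv_right (m := ∞) (by simp)).clm_apply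
    (contDiff_affineMap X).contDiffAt

theorem IsDefiningFunction.eventually_derivAlong_eq_zero (hF : IsDefiningFunction Γ U F)
    (hqU : q ∈ U) {X : (Fin m → ℝ) →ᵃ[ℝ] (Fin m → ℝ)} (hX : X ∈ symmetryAlgebra Γ) :
    ∀ᶠ x in 𝓝 q, x ∈ Γ → derivAlong F X x = 0 := by
  filter_upwards [hF.isOpen.mem_nhds hqU] with x hx hxΓ using hF.fderiv_apply_symmetry hx hxΓ hX

theorem IsDefiningFunction.isSymm_fderiv_fderiv (hF : IsDefiningFunction Γ U F) (hqU : q ∈ U)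
    (u v : Fin m → ℝ) : fderiv ℝ (fderiv ℝ F) q u v = fderiv ℝ (fderiv ℝ F) q v u :=
  ((hF.contDiffAt hqU).isSymmSndFDerivAt (by simpa using two_le_infty)) u v

/-- Differentiating `dF(X) = 0` along Γ in the direction `Y` gives `dF(X'Y) + d²F(Y, X) = 0`.
Antisymmetrising removes the Hessian. -/
theorem affineBracket_mem_symmetryAlgebra (hΓ : IsSmoothHypersurface Γ)
    {X Y : (Fin m → ℝ) →ᵃ[ℝ] (Fin m → ℝ)} (hX : X ∈ symmetryAlgebra Γ)
    (hY : Y ∈ symmetryAlgebra Γ) : affineBracket X Y ∈ symmetryAlgebra Γ := by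
  intro p hp
  obtain ⟨U, F, hpU, hF⟩ := hΓ p hp
  rw [hF.mem_tangentSpace_iff hpU hp]
  have key : ∀ {X Y : (Fin m → ℝ) →ᵃ[ℝ] (Fin m → ℝ)}, X ∈ symmetryAlgebra Γ →
      Y ∈ symmetryAlgebra Γ →
      fderiv ℝ F p (X.linear (Y p)) + fderiv ℝ (fderiv ℝ F) p (Y p) (X p) = 0 := by
    intro X Y hX hY
    obtain ⟨c, hc⟩ := hF.exists_fderiv_eq hpU hp
      ((hF.contDiffAt_derivAlong hpU X).of_le (by simp)) (hF.eventually_derivAlong_eq_zero hpU hX)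
    rw [(hasFDerivAt_derivAlong ((hF.contDiffAt hpU).of_le two_le_infty) X).fderiv] at hc
    have := DFunLike.congr_fun hc (Y p)
    simpa [hF.fderiv_apply_symmetry hpU hp hY] using this
  have h1 := key hX hY
  have h2 := key hY hX
  rw [hF.isSymm_fderiv_fderiv hpU] at h2
  rw [affineBracket_apply, map_sub]
  linarith

theorem mem_frontier_of_mapsTo {E : Type*} [TopologicalSpace E] {Ω : Set E} (hΩ : IsOpen Ω)
    {f : E → E} (hf : Continuous f) (h : ∀ x, f x ∈ Ω ↔ x ∈ Ω) {x : E} (hx : x ∈ frontier Ω) :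
    f x ∈ frontier Ω := by
  rw [hΩ.frontier_eq] at hx ⊢
  exact ⟨map_mem_closure hf hx.1 fun y hy => (h y).2 hy, fun h2 => hx.2 ((h x).1 h2)⟩

/-- The generator of a flow preserving a domain is tangent to the smooth part of its boundary. -/
theorem mem_symmetryAlgebra_of_flow {Ω : Set (Fin m → ℝ)} (hΩ : IsOpen Ω)
    (hΓ : IsBoundaryPart Γ Ω) {X : (Fin m → ℝ) →ᵃ[ℝ] (Fin m → ℝ)}
    {f : ℝ → (Fin m → ℝ) → (Fin m → ℝ)} (hf : ∀ t, Continuous (f t)) (h0 : ∀ x, f 0 x = x)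
    (hfΩ : ∀ t x, f t x ∈ Ω ↔ x ∈ Ω) (hfX : ∀ x, HasDerivAt (fun t => f t x) (X x) 0) :
    X ∈ symmetryAlgebra Γ := by
  intro p hp
  obtain ⟨W, hW, rfl⟩ := hΓ
  have h := mem_tangentSpace_of_hasDerivAt (Γ := W ∩ frontier Ω) (hfX p) (by
    have : ∀ᶠ t in 𝓝 (0 : ℝ), f t p ∈ W :=
      (hfX p).continuousAt.eventually (by simpa [h0] using hW.mem_nhds hp.1)
    filter_upwards [this] with t ht
    exact ⟨ht, mem_frontier_of_mapsTo hΩ (hf t) (hfΩ t) hp.2⟩)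
  rwa [h0] at h

/-- The symmetries of the boundary piece are transitive also off Γ, at interior points of the
domain. This produces the grading element later. -/
theorem exists_symmetry_apply_eq {Ω : Set (Fin m → ℝ)} (hΩ : IsAffinelyHomogeneousDomain Ω)
    (hΓ : IsBoundaryPart Γ Ω) {p : Fin m → ℝ} (hp : p ∈ Ω) (v : Fin m → ℝ) :
    ∃ X ∈ symmetryAlgebra Γ, X p = v := by
  obtain ⟨Y, hY, hYv⟩ := exists_mem_lieSubspace_apply_eq hΩ.isOpen hΩ.transitive hp v
  let X : (Fin m → ℝ) →ᵃ[ℝ] (Fin m → ℝ) :=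
    ((LinearMap.fst ℝ _ ℝ ∘ₗ Y.toLinearMap ∘ₗ LinearMap.inl ℝ (Fin m → ℝ) ℝ).toAffineMap) +
      AffineMap.const ℝ _ (Y (0, 1)).1
  have hX : ∀ x, X x = (Y (x, 1)).1 := by
    intro x
    have : ((x, 1) : (Fin m → ℝ) × ℝ) = (x, 0) + (0, 1) := by simp
    rw [this, map_add]
    rfl
  refine ⟨X, ?_, by rw [hX, hYv]⟩
  refine mem_symmetryAlgebra_of_flow hΩ.isOpen hΓ (f := fun t x => (exp (t • Y) (x, 1)).1) ?_ ?_
    ?_ ?_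
  · intro t; fun_prop
  · intro x; simp
  · intro t x; exact (hY t).2.2 x
  · intro x
    have h1 := hasDerivAt_exp_smul_apply Y (x, 1) 0
    have h2 := (ContinuousLinearMap.fst ℝ (Fin m → ℝ) ℝ).hasFDerivAt.comp_hasDerivAt (0 : ℝ) h1
    rw [hX]
    simpa [Function.comp_def] using h2

/-- The affine vector field `x ↦ A (x - p)`. -/
noncomputable def fieldVanishingAt (p : Fin m → ℝ) :
    ((Fin m → ℝ) →L[ℝ] (Fin m → ℝ)) →ₗ[ℝ] ((Fin m → ℝ) →ᵃ[ℝ] (Fin m → ℝ)) where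
  toFun A := A.toLinearMap.toAffineMap - AffineMap.const ℝ _ (A p)
  map_add' A B := by ext x : 1; simp; abel
  map_smul' c A := by ext x : 1; simp [smul_sub]

theorem fieldVanishingAt_apply (p : Fin m → ℝ) (A : (Fin m → ℝ) →L[ℝ] (Fin m → ℝ))
    (x : Fin m → ℝ) : fieldVanishingAt p A x = A (x - p) := by
  simp [fieldVanishingAt]

theorem fieldVanishingAt_mem {Ω : Set (Fin m → ℝ)} (hΩ : IsOpen Ω) (hΓ : IsBoundaryPart Γ Ω)
    (p : Fin m → ℝ) {A : (Fin m → ℝ) →L[ℝ] (Fin m → ℝ)} (hA : A ∈ isotropyAlgebra Ω p) :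
    fieldVanishingAt p A ∈ symmetryAlgebra Γ := by
  suffices h : isotropyAlgebra Ω p ≤ (symmetryAlgebra Γ).comap (fieldVanishingAt p) from h hA
  refine Submodule.span_le.2 fun A hA => ?_
  refine mem_symmetryAlgebra_of_flow hΩ hΓ (f := fun t x => p + exp (t • A) (x - p)) ?_ ?_ ?_ ?_
  · intro t; fun_prop
  · intro x; simp
  · intro t x
    have hinj : Function.Injective fun x => p + exp (t • A) (x - p) := by
      intro x y hxy
      have h1 : exp (t • A) (x - p) = exp (t • A) (y - p) := add_left_cancel hxy
      have h2 := congrArg (exp (-t • A) : (Fin m → ℝ) →L[ℝ] (Fin m → ℝ)) h1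
      have h3 : ∀ z, (exp (-t • A) : (Fin m → ℝ) →L[ℝ] (Fin m → ℝ)) (exp (t • A) z) = z :=
        fun z => DFunLike.congr_fun (exp_neg_smul_mul_exp_smul A t) z
      rw [h3, h3] at h2
      exact sub_left_injective h2
    have h := hA t
    constructor
    · intro hx
      rw [← h] at hx
      exact (hinj.mem_set_image).1 hx
    · intro hx
      have := Set.mem_image_of_mem (fun x => p + exp (t • A) (x - p)) hx
      rwa [h] at this
  · intro x
    rw [fieldVanishingAt_apply]
    simpa using (hasDerivAt_exp_smul_apply A (x - p) 0).const_add p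

/-- Near a smooth boundary point, a domain contains points on every transversal line. -/
theorem IsDefiningFunction.exists_mem_domain {Ω : Set (Fin m → ℝ)} (hΩ : IsOpen Ω)
    (hΓ : IsBoundaryPart Γ Ω) (hF : IsDefiningFunction Γ U F) (hqU : q ∈ U) (hq : q ∈ Γ)
    {ξ : Fin m → ℝ} (hξ : fderiv ℝ F q ξ ≠ 0) : ∃ t : ℝ, t ≠ 0 ∧ q + t • ξ ∈ Ω := by
  obtain ⟨W, hW, rfl⟩ := hΓ
  have hη : fderiv ℝ F q ((fderiv ℝ F q ξ)⁻¹ • ξ) = 1 := by simp [hξ]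
  obtain ⟨ψ, r, hr, hψ0, hψc, hψN, hψF, hψn⟩ := exists_flat_parametrization
    ((hF.contDiffAt hqU).of_le (by simp)) ((hF.mem_iff q hqU).1 hq) hη
    (inter_mem (hF.isOpen.mem_nhds hqU) (hW.mem_nhds hq.1))
  have hqc : q ∈ closure Ω := frontier_subset_closure hq.2
  obtain ⟨x, hxψ, hxΩ⟩ := mem_closure_iff_nhds.1 hqc _ (hψn _ (Metric.ball_mem_nhds 0 hr))
  obtain ⟨z, hz, rfl⟩ := hxψ
  -- In flat coordinates each open half-ball is connected and misses the frontier, so the half-ball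
  -- containing one point of Ω lies entirely in Ω.
  have hside : ∀ c : ℝ, 0 < c * fderiv ℝ F q z → ∀ w ∈ Metric.ball (0 : Fin m → ℝ) r,
      0 < c * fderiv ℝ F q w → ψ w ∈ Ω := by
    intro c hcz w hw hcw
    set S := Metric.ball (0 : Fin m → ℝ) r ∩ {y | 0 < c * fderiv ℝ F q y} with hS
    have hSc : Convex ℝ S := by
      refine (convex_ball _ _).inter ?_
      exact convex_halfSpace_gt ((c • (fderiv ℝ F q).toLinearMap).isLinear) 0
    have hpre : IsPreconnected (ψ '' S) :=
      hSc.isPreconnected.image _ (hψc.continuousOn.mono Set.inter_subset_left)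
    have hsub : ψ '' S ⊆ Ω := hpre.subset_left_of_subset_union hΩ
      (isClosed_closure (s := Ω)).isOpen_compl
      (Set.disjoint_left.2 fun y hy hy2 => hy2 (subset_closure hy)) (by
        rintro _ ⟨y, hy, rfl⟩
        by_contra hcon
        simp only [Set.mem_union, Set.mem_compl_iff, not_or, not_not] at hcon
        have hfr : ψ y ∈ frontier Ω := by
          rw [hΩ.frontier_eq]; exact ⟨hcon.2, hcon.1⟩
        have h0 := (hF.mem_iff _ (hψN y hy.1).1).1 ⟨(hψN y hy.1).2, hfr⟩
        rw [hψF y hy.1] at h0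
        have := hy.2
        simp [h0] at this) ⟨ψ z, ⟨z, ⟨hz, hcz⟩, rfl⟩, hxΩ⟩
    exact hsub ⟨w, ⟨hw, hcw⟩, rfl⟩
  have hz0 : fderiv ℝ F q z ≠ 0 := by
    intro h0
    rw [← hψF z hz] at h0
    have := ((hF.mem_iff _ (hψN z hz).1).2 h0).2
    rw [hΩ.frontier_eq] at this
    exact this.2 hxΩ
  set c := fderiv ℝ F q z
  have hcc : 0 < c * c := mul_self_pos.2 hz0
  -- move along the transversal direction on which `F` has the sign of `c`
  set b := c * fderiv ℝ F q ξ with hb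
  have hb0 : b ≠ 0 := mul_ne_zero hz0 hξ
  have hd : HasDerivAt (fun t : ℝ => c * F (q + (t * b) • ξ)) (b * b) 0 := by
    have h1 : HasDerivAt (fun t : ℝ => q + (t * b) • ξ) (b • ξ) 0 := by
      simpa using (((hasDerivAt_id (0 : ℝ)).mul_const b).smul_const ξ).const_add q
    have h2 : HasFDerivAt F (fderiv ℝ F q) (q + ((0 : ℝ) * b) • ξ) := by
      simpa using ((hF.contDiffAt hqU).differentiableAt (by simp)).hasFDerivAt
    have h3 := (h2.comp_hasDerivAt (0 : ℝ) h1).const_mul c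
    refine h3.congr_deriv ?_
    simp [hb]; ring
  have hpos : ∀ᶠ t in 𝓝[>] (0 : ℝ), 0 < c * F (q + (t * b) • ξ) := by
    have h1 := hd.tendsto_slope_zero_right
    have h2 := h1.eventually (lt_mem_nhds (mul_self_pos.2 hb0))
    filter_upwards [h2, self_mem_nhdsWithin] with t ht ht0
    have hF0 := (hF.mem_iff q hqU).1 hq
    simp only [zero_add, zero_mul, zero_smul, add_zero, hF0, mul_zero, sub_zero, smul_eq_mul] at ht
    exact (mul_pos_iff_of_pos_left (inv_pos.2 ht0)).1 ht
  have hnear : ∀ᶠ t in 𝓝[>] (0 : ℝ), q + (t * b) • ξ ∈ ψ '' Metric.ball 0 r := by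
    have hc : Continuous fun t : ℝ => q + (t * b) • ξ := by fun_prop
    have h1 : Tendsto (fun t : ℝ => q + (t * b) • ξ) (𝓝 0) (𝓝 q) := by
      simpa using hc.tendsto 0
    exact (h1.eventually (hψn _ (Metric.ball_mem_nhds 0 hr))).filter_mono nhdsWithin_le_nhds
  obtain ⟨t, ⟨ht, ⟨w, hw, hwt⟩⟩, ht0⟩ := ((hpos.and hnear).and self_mem_nhdsWithin).exists
  refine ⟨t * b, mul_ne_zero (ne_of_gt ht0) hb0, ?_⟩
  rw [← hwt]
  refine hside c hcc w hw ?_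
  rwa [← hψF w hw, hwt]

end Hypersurface

end AffineTube

namespace AffineTube

/-! ### Relative invariants: propagation of zeros along Γ and recovery of Γ from them. -/

section RelativeInvariants

variable {m : ℕ} {Γ U : Set (Fin m → ℝ)} {F : (Fin m → ℝ) → ℝ} {q : Fin m → ℝ}

/-- A relative invariant of the symmetry algebra: a function that every symmetry multiplies by
a continuous function. -/
structure IsRelativeInvariant (Γ : Set (Fin m → ℝ)) (u : (Fin m → ℝ) → ℝ) : Prop where
  contDiff : ContDiff ℝ 1 u
  exists_multiplier : ∀ X ∈ symmetryAlgebra Γ, ∃ μ : (Fin m → ℝ) → ℝ, Continuous μ ∧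
    ∀ x, fderiv ℝ u x (X x) = μ x * u x

/-- Symmetries whose values form a basis of the tangent space at `q`, together with a transversal ξ,
remain a frame nearby. Tangent vectors are thus combinations of symmetries with controlled
coefficients, and the multipliers bound the derivative. The constant must be uniform near `q` for
the Gronwall argument. -/
theorem IsRelativeInvariant.eventually_bound {u : (Fin m → ℝ) → ℝ}
    (hu : IsRelativeInvariant Γ u) (hhom : IsAffinelyHomogeneousHypersurface Γ)
    (hF : IsDefiningFunction Γ U F) (hqU : q ∈ U) (hq : q ∈ Γ) :
    ∃ K : ℝ, ∀ᶠ y in 𝓝 q, y ∈ Γ → ∀ v, fderiv ℝ F y v = 0 →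
      |fderiv ℝ u y v| ≤ K * ‖v‖ * |u y| := by
  set φ := fderiv ℝ F q with hφ
  obtain ⟨ξ, hξ⟩ : ∃ ξ, φ ξ ≠ 0 := by
    by_contra h
    push Not at h
    exact hF.fderiv_ne_zero q hqU (ContinuousLinearMap.ext h)
  let T := LinearMap.ker φ.toLinearMap
  let bs := Module.finBasis ℝ T
  have hX : ∀ i, ∃ X ∈ symmetryAlgebra Γ, X q = bs i := fun i =>
    hhom q hq _ ((hF.mem_tangentSpace_iff hqU hq).2 (bs i).2)
  choose X hXg hXq using hX
  choose μ hμc hμ using fun i => hu.exists_multiplier (X i) (hXg i)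
  let ι := Fin (Module.finrank ℝ T)
  let M : (Fin m → ℝ) → ((ι → ℝ) × ℝ →L[ℝ] (Fin m → ℝ)) := fun y =>
    (∑ i : ι, (((ContinuousLinearMap.proj i : (ι → ℝ) →L[ℝ] ℝ).comp
      (ContinuousLinearMap.fst ℝ (ι → ℝ) ℝ)).smulRight (X i y))) +
      (ContinuousLinearMap.snd ℝ (ι → ℝ) ℝ).smulRight ξ
  have hM : ∀ y c, M y c = (∑ i, c.1 i • X i y) + c.2 • ξ := by
    intro y c
    simp [M]
  have hMc : Continuous M := by
    have : ∀ i, Continuous fun y => X i y := fun i => (contDiff_affineMap (X i) (k := 0)).continuous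
    have h2 : ∀ (f : (ι → ℝ) × ℝ →L[ℝ] ℝ), Continuous fun v : Fin m → ℝ => f.smulRight v := by
      intro f
      exact (ContinuousLinearMap.smulRightL ℝ ((ι → ℝ) × ℝ) (Fin m → ℝ) f).continuous
    refine Continuous.add ?_ continuous_const
    exact continuous_finsetSum _ fun i _ => (h2 _).comp (this i)
  have hker : LinearMap.ker (M q).toLinearMap = ⊥ := by
    rw [LinearMap.ker_eq_bot']
    intro c hc
    have hc' : (∑ i, c.1 i • (bs i : Fin m → ℝ)) + c.2 • ξ = 0 := by
      have := hM q c
      simp only [hXq] at this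
      rw [← this]; exact hc
    have hT : φ (∑ i, c.1 i • (bs i : Fin m → ℝ)) = 0 := by
      rw [map_sum]
      refine Finset.sum_eq_zero fun i _ => ?_
      rw [map_smul]
      have : φ (bs i) = 0 := (bs i).2
      rw [this, smul_zero]
    have hc2 : c.2 = 0 := by
      have := congrArg φ hc'
      rw [map_add, hT, map_smul, map_zero, zero_add, smul_eq_mul] at this
      exact (mul_eq_zero.1 this).resolve_right hξ
    rw [hc2, zero_smul, add_zero] at hc'
    have h1 : ∑ i, c.1 i • bs i = 0 := by
      apply Subtype.ext
      simpa using hc'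
    have h2 := Fintype.linearIndependent_iff.1 bs.linearIndependent c.1 h1
    exact Prod.ext (funext h2) hc2
  have hrange : LinearMap.range (M q).toLinearMap = ⊤ := by
    rw [eq_top_iff]
    intro v _
    have hvT : v - (φ v / φ ξ) • ξ ∈ T := by
      change φ _ = 0
      rw [map_sub, map_smul, smul_eq_mul, div_mul_cancel₀ _ hξ, sub_self]
    refine ⟨(bs.repr ⟨_, hvT⟩, φ v / φ ξ), ?_⟩
    have h1 := bs.sum_repr ⟨_, hvT⟩
    have h2 := congrArg Subtype.val h1
    change M q _ = v
    rw [hM]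
    simp only [hXq]
    have h3 : ∑ i, (bs.repr ⟨_, hvT⟩) i • (bs i : Fin m → ℝ) = v - (φ v / φ ξ) • ξ := by
      rw [← Submodule.coe_subtype T, map_sum] at h2
      exact h2
    rw [h3, sub_add_cancel]
  let e := ContinuousLinearEquiv.ofBijective (M q) hker hrange
  have hinv : ContinuousAt (fun y => ContinuousLinearMap.inverse (M y)) q := by
    have h1 : ContinuousAt ContinuousLinearMap.inverse (M q) := by
      have := (contDiffAt_map_inverse (𝕜 := ℝ) (n := 0) e).continuousAt
      exact this
    exact h1.comp hMc.continuousAt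
  have hunit : ∀ᶠ y in 𝓝 q, ∃ e' : ((ι → ℝ) × ℝ) ≃L[ℝ] (Fin m → ℝ),
      (e' : (ι → ℝ) × ℝ →L[ℝ] (Fin m → ℝ)) = M y :=
    hMc.continuousAt.eventually (ContinuousLinearEquiv.nhds e)
  have hbd : ∀ᶠ y in 𝓝 q, ‖ContinuousLinearMap.inverse (M y)‖ <
      ‖ContinuousLinearMap.inverse (M q)‖ + 1 := hinv.norm.eventually_lt_const (lt_add_one _)
  set K₁ := ‖ContinuousLinearMap.inverse (M q)‖ + 1
  have hμbd : ∀ᶠ y in 𝓝 q, ∑ i, |μ i y| < ∑ i, |μ i q| + 1 := by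
    have : Continuous fun y => ∑ i, |μ i y| := continuous_finsetSum _ fun i _ => (hμc i).abs
    exact this.continuousAt.eventually_lt_const (lt_add_one _)
  set K₂ := ∑ i, |μ i q| + 1
  have hξ' : ∀ᶠ y in 𝓝 q, fderiv ℝ F y ξ ≠ 0 := by
    have h1 : ContinuousAt (fun y => fderiv ℝ F y ξ) q := by
      have := ((hF.contDiffAt hqU).fderiv_right (m := 0) (by simp)).continuousAt
      exact this.clm_apply continuousAt_const
    exact h1.eventually_ne hξ
  refine ⟨K₁ * K₂, ?_⟩
  filter_upwards [hunit, hbd, hμbd, hξ', hF.isOpen.mem_nhds hqU] with y hy1 hy2 hy3 hy4 hyU hyΓ v hv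
  obtain ⟨e', he'⟩ := hy1
  set c := ContinuousLinearMap.inverse (M y) v with hc
  have hMc' : M y c = v := by
    rw [hc, ← he', ContinuousLinearMap.inverse_equiv]
    simp
  have hcn : ‖c‖ ≤ K₁ * ‖v‖ := (ContinuousLinearMap.le_opNorm _ _).trans (by gcongr)
  rw [hM] at hMc'
  -- The symmetries are tangent at points of Γ and ξ is not, so a tangent vector has no
  -- ξ-coefficient.
  have hc2 : c.2 = 0 := by
    have h1 := congrArg (fderiv ℝ F y) hMc'
    rw [map_add, map_sum, hv, map_smul, smul_eq_mul, Finset.sum_eq_zero, zero_add] at h1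
    · exact (mul_eq_zero.1 h1).resolve_right hy4
    · intro i _
      rw [map_smul, hF.fderiv_apply_symmetry hyU hyΓ (hXg i), smul_zero]
  rw [hc2, zero_smul, add_zero] at hMc'
  rw [← hMc', map_sum]
  have h1 : ∀ i, fderiv ℝ u y (c.1 i • X i y) = c.1 i * μ i y * u y := by
    intro i
    rw [map_smul, hμ, smul_eq_mul, mul_assoc]
  simp only [h1]
  rw [← Finset.sum_mul, abs_mul, hMc']
  gcongr
  calc |∑ i, c.1 i * μ i y| ≤ ∑ i, |c.1 i * μ i y| := Finset.abs_sum_le_sum_abs _ _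
    _ ≤ ∑ i, ‖c‖ * |μ i y| := by
        refine Finset.sum_le_sum fun i _ => ?_
        rw [abs_mul]
        gcongr
        exact (norm_le_pi_norm c.1 i).trans (norm_fst_le c)
    _ = ‖c‖ * ∑ i, |μ i y| := by rw [Finset.mul_sum]
    _ ≤ (K₁ * ‖v‖) * K₂ := by gcongr
    _ = K₁ * K₂ * ‖v‖ := by ring

/-- In flat coordinates Γ is star-shaped about `q`. Along each segment `u` satisfies `|u'| ≤ const ·
|u|` with `u = 0` initially, so Gronwall gives `u = 0`. -/
theorem IsRelativeInvariant.eventually_eq_zero {u : (Fin m → ℝ) → ℝ}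
    (hu : IsRelativeInvariant Γ u) (hhom : IsAffinelyHomogeneousHypersurface Γ)
    (hF : IsDefiningFunction Γ U F) (hqU : q ∈ U) (hq : q ∈ Γ) (huq : u q = 0) :
    ∀ᶠ y in 𝓝 q, y ∈ Γ → u y = 0 := by
  obtain ⟨K, hK⟩ := hu.eventually_bound hhom hF hqU hq
  obtain ⟨ξ, hξ⟩ : ∃ ξ, fderiv ℝ F q ξ ≠ 0 := by
    by_contra h
    push Not at h
    exact hF.fderiv_ne_zero q hqU (ContinuousLinearMap.ext h)
  have hη : fderiv ℝ F q ((fderiv ℝ F q ξ)⁻¹ • ξ) = 1 := by simp [hξ]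
  obtain ⟨ψ, r, hr, hψ0, hψc, hψN, hψF, hψn⟩ := exists_flat_parametrization
    ((hF.contDiffAt hqU).of_le (by simp)) ((hF.mem_iff q hqU).1 hq) hη
    (inter_mem (hF.isOpen.mem_nhds hqU) hK)
  filter_upwards [hψn _ (Metric.ball_mem_nhds 0 hr), hF.isOpen.mem_nhds hqU] with y hyψ hyU hyΓ
  obtain ⟨z, hz, rfl⟩ := hyψ
  have hφz : fderiv ℝ F q z = 0 := by rw [← hψF z hz]; exact (hF.mem_iff _ hyU).1 hyΓ
  have hsz : ∀ s ∈ Set.Icc (0 : ℝ) 1, s • z ∈ Metric.ball (0 : Fin m → ℝ) r := by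
    intro s hs
    rw [mem_ball_zero_iff] at hz ⊢
    rw [norm_smul, Real.norm_of_nonneg hs.1]
    exact (mul_le_of_le_one_left (norm_nonneg _) hs.2).trans_lt hz
  have hFs : ∀ s ∈ Set.Icc (0 : ℝ) 1, F (ψ (s • z)) = 0 := by
    intro s hs
    rw [hψF _ (hsz s hs), map_smul, hφz, smul_zero]
  have hψd : ∀ s ∈ Set.Icc (0 : ℝ) 1,
      HasDerivAt (fun s : ℝ => ψ (s • z)) (fderiv ℝ ψ (s • z) z) s := by
    intro s hs
    have h1 : HasFDerivAt ψ (fderiv ℝ ψ (s • z)) (s • z) :=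
      ((hψc.contDiffAt (Metric.isOpen_ball.mem_nhds (hsz s hs))).differentiableAt
        one_ne_zero).hasFDerivAt
    have h2 : HasDerivAt (fun s : ℝ => s • z) z s := by
      simpa using (hasDerivAt_id s).smul_const z
    exact h1.comp_hasDerivAt s h2
  have hcont : ContinuousOn (fun s : ℝ => fderiv ℝ ψ (s • z) z) (Set.Icc 0 1) := by
    have h1 : ContinuousOn (fderiv ℝ ψ) (Metric.ball 0 r) :=
      hψc.continuousOn_fderiv_of_isOpen Metric.isOpen_ball le_rfl
    have h2 : ContinuousOn (fun s : ℝ => fderiv ℝ ψ (s • z)) (Set.Icc 0 1) :=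
      h1.comp (by fun_prop) hsz
    exact h2.clm_apply continuousOn_const
  obtain ⟨B, hB⟩ := isCompact_Icc.exists_bound_of_continuousOn hcont
  have hgd : ∀ s ∈ Set.Icc (0 : ℝ) 1, HasDerivAt (fun s : ℝ => u (ψ (s • z)))
      (fderiv ℝ u (ψ (s • z)) (fderiv ℝ ψ (s • z) z)) s := fun s hs =>
    ((hu.contDiff.differentiable one_ne_zero) _).hasFDerivAt.comp_hasDerivAt s (hψd s hs)
  have hfin := eq_zero_of_abs_deriv_le_mul_abs_self_of_eq_zero_right
    (f := fun s : ℝ => u (ψ (s • z)))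
    (f' := fun s : ℝ => fderiv ℝ u (ψ (s • z)) (fderiv ℝ ψ (s • z) z)) (K := |K| * B)
    (a := 0) (b := 1)
    (fun s hs => (hgd s hs).continuousAt.continuousWithinAt)
    (fun s hs => (hgd s (Set.Ico_subset_Icc_self hs)).hasDerivWithinAt)
    (by simp [hψ0, huq]) (by
      intro s hs
      have hs' := Set.Ico_subset_Icc_self hs
      have hN := hψN _ (hsz s hs')
      have htan : fderiv ℝ F (ψ (s • z)) (fderiv ℝ ψ (s • z) z) = 0 := by
        have h1 := (((hF.contDiffAt hN.1).differentiableAt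
          (by simp)).hasFDerivAt.comp_hasDerivAt s (hψd s hs')).hasDerivWithinAt (s := Set.Ici s)
        -- `F ∘ ψ` is known to vanish only for `s ∈ [0, 1]`; the right derivative is enough and also
        -- covers `s = 0`.
        have h2 : HasDerivWithinAt (F ∘ fun s : ℝ => ψ (s • z)) 0 (Set.Ici s) s := by
          refine (hasDerivWithinAt_const s (Set.Ici s) (0 : ℝ)).congr_of_eventuallyEq ?_
            (hFs s hs')
          have : Set.Icc s 1 ∈ 𝓝[Set.Ici s] s := Icc_mem_nhdsGE hs.2
          filter_upwards [this] with s' hs2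
          exact hFs s' ⟨hs.1.trans hs2.1, hs2.2⟩
        exact (uniqueDiffWithinAt_Ici s).eq_deriv _ h1 h2
      have h3 := hN.2 ((hF.mem_iff _ hN.1).2 (hFs s hs')) _ htan
      rw [Real.norm_eq_abs, Real.norm_eq_abs]
      refine h3.trans ?_
      gcongr
      · exact le_abs_self K
      · exact hB s hs')
  simpa using hfin 1 (by simp)

/-- A relative invariant vanishing at a point of a connected homogeneous hypersurface vanishes
on all of it. -/
theorem IsRelativeInvariant.eq_zero {u : (Fin m → ℝ) → ℝ} (hu : IsRelativeInvariant Γ u)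
    (hhom : IsAffinelyHomogeneousHypersurface Γ) (hΓ : IsSmoothHypersurface Γ)
    (hconn : IsConnected Γ) (hq : q ∈ Γ) (huq : u q = 0) : ∀ y ∈ Γ, u y = 0 := by
  have : PreconnectedSpace Γ := isPreconnected_iff_preconnectedSpace.1 hconn.isPreconnected
  -- Closed by continuity, open by the local statement.
  have hclopen : IsClopen {y : Γ | u y = 0} := by
    refine ⟨isClosed_eq (hu.contDiff.continuous.comp continuous_subtype_val) continuous_const, ?_⟩
    rw [isOpen_iff_mem_nhds]
    intro y hy
    obtain ⟨U, F, hyU, hF⟩ := hΓ y y.2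
    have h := hu.eventually_eq_zero hhom hF hyU y.2 hy
    have h2 := continuous_subtype_val.continuousAt.eventually h
    filter_upwards [h2] with x hx using hx x.2
  have huniv := hclopen.eq_univ ⟨⟨q, hq⟩, huq⟩
  intro y hy
  have : (⟨y, hy⟩ : Γ) ∈ {y : Γ | u y = 0} := huniv ▸ trivial
  exact this

/-- A smooth function vanishing on a hypersurface defines it near the points where its
differential does not vanish. -/
theorem exists_inter_eq_zeroSet (hΓ : IsSmoothHypersurface Γ) (hq : q ∈ Γ) {P : (Fin m → ℝ) → ℝ}
    (hP : ContDiff ℝ 1 P) (hPΓ : ∀ y ∈ Γ, P y = 0) (hdP : fderiv ℝ P q ≠ 0) :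
    ∃ V : Set (Fin m → ℝ), IsOpen V ∧ q ∈ V ∧ Γ ∩ V = {x | P x = 0} ∩ V := by
  obtain ⟨U, F, hqU, hF⟩ := hΓ q hq
  obtain ⟨c, hc⟩ := hF.exists_fderiv_eq hqU hq hP.contDiffAt
    (Eventually.of_forall fun x hx => hPΓ x hx)
  obtain ⟨ξ, hξ⟩ : ∃ ξ, fderiv ℝ F q ξ ≠ 0 := by
    by_contra h
    push Not at h
    exact hF.fderiv_ne_zero q hqU (ContinuousLinearMap.ext h)
  have hc0 : c ≠ 0 := by
    rintro rfl
    rw [zero_smul] at hc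
    exact hdP hc
  have hη : fderiv ℝ F q ((fderiv ℝ F q ξ)⁻¹ • ξ) = 1 := by simp [hξ]
  set η := (fderiv ℝ F q ξ)⁻¹ • ξ
  obtain ⟨ψ, r, hr, hψ0, hψc, hψN, hψF, hψn⟩ := exists_flat_parametrization
    ((hF.contDiffAt hqU).of_le (by simp)) ((hF.mem_iff q hqU).1 hq) hη
    (hF.isOpen.mem_nhds hqU)
  set φ := fderiv ℝ F q with hφ
  have hψs : HasStrictFDerivAt ψ (fderiv ℝ ψ 0) 0 :=
    (hψc.contDiffAt (Metric.ball_mem_nhds 0 hr)).hasStrictFDerivAt one_ne_zero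
  have hPs : HasStrictFDerivAt P (c • φ) (ψ 0) := by
    rw [hψ0, ← hc]
    exact hP.contDiffAt.hasStrictFDerivAt one_ne_zero
  have hg := hPs.comp (0 : Fin m → ℝ) hψs
  have hgη : ((c • φ).comp (fderiv ℝ ψ 0)) η = c := by
    have h1 : HasFDerivAt F φ (ψ 0) := by
      rw [hψ0]; exact ((hF.contDiffAt hqU).differentiableAt (by simp)).hasFDerivAt
    have h2 := h1.comp (0 : Fin m → ℝ) hψs.hasFDerivAt
    have h3 : HasFDerivAt (F ∘ ψ) φ 0 := by
      refine φ.hasFDerivAt.congr_of_eventuallyEq ?_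
      filter_upwards [Metric.ball_mem_nhds (0 : Fin m → ℝ) hr] with z hz using hψF z hz
    have h4 := DFunLike.congr_fun (h2.unique h3) η
    simp only [ContinuousLinearMap.comp_apply] at h4
    simp [h4, hη]
  -- Chosen so that the error of strict differentiability is at most half of the main term `|φ z| *
  -- |c|`.
  have hε : 0 < |c| / (2 * (‖η‖ + 1)) := by positivity
  have hlim : Tendsto (fun z : Fin m → ℝ => (z, z - φ z • η)) (𝓝 0) (𝓝 ((0, 0) : _ × _)) := by
    have : Continuous fun z : Fin m → ℝ => (z, z - φ z • η) := by fun_prop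
    simpa using this.tendsto 0
  have hbound := (hg.isLittleO.comp_tendsto hlim).def hε
  have hz0 : ∀ᶠ z in 𝓝 (0 : Fin m → ℝ), z - φ z • η ∈ Metric.ball (0 : Fin m → ℝ) r := by
    have : Continuous fun z : Fin m → ℝ => z - φ z • η := by fun_prop
    exact this.continuousAt.eventually (show Metric.ball (0 : Fin m → ℝ) r ∈
      𝓝 ((0 : Fin m → ℝ) - φ 0 • η) by
        rw [map_zero, zero_smul, sub_zero]; exact Metric.ball_mem_nhds 0 hr)
  -- Compare `z` with its projection `z - φ z • η`, where `P ∘ ψ` vanishes. The difference of values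
  -- is `c * φ z` up to the small error, so a zero of `P ∘ ψ` has `φ z = 0`.
  have hgood : ∀ᶠ z in 𝓝 (0 : Fin m → ℝ), P (ψ z) = 0 → ψ z ∈ Γ := by
    filter_upwards [hbound, hz0, Metric.ball_mem_nhds (0 : Fin m → ℝ) hr] with z h1 h2 h3 hPz
    have h4 : P (ψ (z - φ z • η)) = 0 := by
      refine hPΓ _ ((hF.mem_iff _ (hψN _ h2)).2 ?_)
      rw [hψF _ h2]; simp [hη]
    simp only [Function.comp_apply, hPz, h4, sub_sub_cancel, map_smul, hgη, sub_self, zero_sub,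
      norm_neg, norm_smul, smul_eq_mul, norm_mul, Real.norm_eq_abs] at h1
    have h5 : φ z = 0 := by
      by_contra hne
      have h6 : 0 < |φ z| := abs_pos.2 hne
      have h7 : 0 < |c| := abs_pos.2 hc0
      have h8 : |c| / (2 * (‖η‖ + 1)) * (|φ z| * ‖η‖) ≤ |φ z| * |c| / 2 := by
        rw [div_mul_eq_mul_div, div_le_div_iff₀ (by positivity) (by positivity)]
        have : 0 ≤ |c| * |φ z| := by positivity
        nlinarith [norm_nonneg η]
      nlinarith [mul_pos h6 h7]
    rw [hF.mem_iff _ (hψN z h3), hψF z h3, h5]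
  obtain ⟨V, hVsub, hVo, hqV⟩ := mem_nhds_iff.1 (hψn _ hgood)
  refine ⟨V, hVo, hqV, Set.ext fun x => ⟨fun hx => ⟨hPΓ x hx.1, hx.2⟩, fun hx => ⟨?_, hx.2⟩⟩⟩
  obtain ⟨z, hz, rfl⟩ := hVsub hx.2
  exact hz hx.1

/-- A hypersurface on which a relative invariant `P` vanishes is locally its zero set, if the
differential of `P` can vanish only together with another relative invariant. -/
theorem locallyAffinelyEquivalentAt_of_isRelativeInvariant (hΓ : IsSmoothHypersurface Γ)
    (hhom : IsAffinelyHomogeneousHypersurface Γ) (hconn : IsConnected Γ) (hq : q ∈ Γ)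
    {P t : (Fin m → ℝ) → ℝ} (hP : IsRelativeInvariant Γ P) (ht : IsRelativeInvariant Γ t)
    (hPq : P q = 0) (htq : t q ≠ 0) (hdP : ∀ x, t x ≠ 0 → fderiv ℝ P x ≠ 0)
    {M : Set (Fin m → ℝ)} (g : (Fin m → ℝ) ≃ᵃ[ℝ] (Fin m → ℝ)) (hM : ∀ x, g x ∈ M ↔ P x = 0) :
    ∀ y ∈ Γ, LocallyAffinelyEquivalentAt Γ M y := by
  intro y hy
  -- A zero of `t` at `y` would propagate along Γ back to `q`.
  have hty : t y ≠ 0 := fun h => htq (ht.eq_zero hhom hΓ hconn hy h q hq)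
  obtain ⟨V, hV, hyV, h⟩ := exists_inter_eq_zeroSet hΓ hy hP.contDiff
    (hP.eq_zero hhom hΓ hconn hq hPq) (hdP y hty)
  refine ⟨g, V, hV, hyV, ?_⟩
  rw [h]
  ext z
  constructor
  · rintro ⟨x, hx, rfl⟩
    exact ⟨(hM x).2 hx.1, Set.mem_image_of_mem _ hx.2⟩
  · rintro ⟨hz, ⟨x, hx, rfl⟩⟩
    exact ⟨x, ⟨(hM x).1 hz, hx⟩, rfl⟩


end RelativeInvariants

end AffineTube

namespace AffineTube

/-! ### Trace-free cubic forms and the algebraic model of the symmetries at a point. -/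

section BilinearForm

variable {T : Type*} [AddCommGroup T] [Module ℝ T] [FiniteDimensional ℝ T]

/-- The isomorphism with the dual space given by a nondegenerate bilinear form. -/
noncomputable def dualEquiv (Q : T →ₗ[ℝ] T →ₗ[ℝ] ℝ) (hQ : ∀ u, (∀ v, Q u v = 0) → u = 0) :
    T ≃ₗ[ℝ] Module.Dual ℝ T :=
  LinearEquiv.ofInjectiveOfFinrankEq Q
    ((injective_iff_map_eq_zero Q).2 fun u hu => hQ u fun v => DFunLike.congr_fun hu v)
    (Subspace.dual_finrank_eq).symm

theorem dualEquiv_symm_apply (Q : T →ₗ[ℝ] T →ₗ[ℝ] ℝ) (hQ : ∀ u, (∀ v, Q u v = 0) → u = 0)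
    (l : Module.Dual ℝ T) (v : T) : Q ((dualEquiv Q hQ).symm l) v = l v := by
  have h : dualEquiv Q hQ ((dualEquiv Q hQ).symm l) = l := LinearEquiv.apply_symm_apply _ l
  exact DFunLike.congr_fun h v

/-- The adjoint is the transpose carried over by `Q`; transposition and conjugation both preserve
the trace. -/
theorem exists_adjoint (Q : T →ₗ[ℝ] T →ₗ[ℝ] ℝ) (hQ : ∀ u, (∀ v, Q u v = 0) → u = 0)
    (A : T →ₗ[ℝ] T) : ∃ B : T →ₗ[ℝ] T, (∀ u v, Q (B u) v = Q u (A v)) ∧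
      LinearMap.trace ℝ T B = LinearMap.trace ℝ T A := by
  refine ⟨(dualEquiv Q hQ).symm.conj (Module.Dual.transpose A), fun u v => ?_, ?_⟩
  · rw [LinearEquiv.conj_apply_apply, dualEquiv_symm_apply]
    rfl
  · rw [LinearMap.trace_conj', LinearMap.trace_transpose']

/-- A symmetric cubic form becomes trace-free after adding the product of the quadratic form and
a linear form. -/
theorem exists_traceless (Q : T →ₗ[ℝ] T →ₗ[ℝ] ℝ) (hQ : ∀ u, (∀ v, Q u v = 0) → u = 0)
    (hs : ∀ u v, Q u v = Q v u) (C : T →ₗ[ℝ] T →ₗ[ℝ] T →ₗ[ℝ] ℝ) :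
    ∃ t : T, ∀ (b : T) (N : T →ₗ[ℝ] T), (∀ u v, Q (N u) v =
      C b u v + Q u b * Q v t + Q v b * Q u t + Q u v * Q b t) → LinearMap.trace ℝ T N = 0 := by
  let e := dualEquiv Q hQ
  let l : T →ₗ[ℝ] ℝ := LinearMap.trace ℝ T ∘ₗ (LinearMap.llcomp ℝ T (Module.Dual ℝ T) T
    e.symm.toLinearMap) ∘ₗ C
  have hl : ∀ b, l b = LinearMap.trace ℝ T (e.symm.toLinearMap ∘ₗ C b) := fun b => rfl
  -- The correction terms have trace `(dim T + 2) Q(b, t)`: one `Q(b, t)` from each rank-one term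
  -- and `dim T` of them from the scalar term.
  set c : ℝ := (Module.finrank ℝ T : ℝ) + 2 with hc
  have hc0 : c ≠ 0 := by positivity
  refine ⟨-(c⁻¹ • e.symm l), fun b N hN => ?_⟩
  set t := -(c⁻¹ • e.symm l) with ht
  have hQt : ∀ v, Q t v = -(c⁻¹ * l v) := by
    intro v
    rw [ht, map_neg, map_smul, LinearMap.neg_apply, LinearMap.smul_apply, dualEquiv_symm_apply,
      smul_eq_mul]
  have hNeq : N = e.symm.toLinearMap ∘ₗ C b + (Q b).smulRight t + (Q t).smulRight b +
      (Q b t) • LinearMap.id := by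
    refine LinearMap.ext fun u => ?_
    rw [← sub_eq_zero]
    refine hQ _ fun v => ?_
    rw [map_sub, LinearMap.sub_apply, sub_eq_zero, hN]
    simp only [LinearMap.add_apply, map_add, LinearMap.comp_apply, LinearEquiv.coe_coe,
      LinearMap.smulRight_apply, map_smul, LinearMap.smul_apply, LinearMap.id_apply, smul_eq_mul]
    rw [dualEquiv_symm_apply, hs b u, hs v t, hs v b, hs u t]
    ring
  rw [hNeq]
  simp only [map_add, map_smul, LinearMap.trace_smulRight, LinearMap.trace_id, smul_eq_mul]
  rw [← hl, hs b t, hQt]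
  field_simp
  rw [hc]
  ring

end BilinearForm

/-- The infinitesimal affine symmetries `X` of a hypersurface near a base point, written in terms
of the decomposition of the space into the tangent space `T` and the affine normal:
`b X` is the value at the base point, `A X`, `w X`, `a X` are components of the linear part;
`Q` is the second fundamental form and `C` the trace-free cubic form. -/
structure SymmetryModel (𝔤 T : Type*) [AddCommGroup 𝔤] [Module ℝ 𝔤] [AddCommGroup T]
    [Module ℝ T] where
  Q : T →ₗ[ℝ] T →ₗ[ℝ] ℝ
  C : T →ₗ[ℝ] T →ₗ[ℝ] T →ₗ[ℝ] ℝ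
  b : 𝔤 →ₗ[ℝ] T
  A : 𝔤 →ₗ[ℝ] T →ₗ[ℝ] T
  w : 𝔤 →ₗ[ℝ] T
  a : 𝔤 →ₗ[ℝ] ℝ
  bracket : 𝔤 → 𝔤 → 𝔤
  Q_symm : ∀ u v, Q u v = Q v u
  Q_nondegenerate : ∀ u, (∀ v, Q u v = 0) → u = 0
  C_swap_left : ∀ u v x, C u v x = C v u x
  C_swap_right : ∀ u v x, C u v x = C u x v
  C_traceless : ∀ (v : T) (N : T →ₗ[ℝ] T), (∀ u x, Q (N u) x = C v u x) →
    LinearMap.trace ℝ T N = 0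
  compat : ∀ X u v, Q u (A X v) + Q v (A X u) + C (b X) u v = a X * Q u v
  b_bracket : ∀ X Y, b (bracket X Y) = A X (b Y) - A Y (b X)
  A_bracket : ∀ X Y u, A (bracket X Y) u =
    A X (A Y u) - A Y (A X u) + Q (b Y) u • w X - Q (b X) u • w Y
  w_bracket : ∀ X Y, w (bracket X Y) = A X (w Y) + a Y • w X - (A Y (w X) + a X • w Y)
  a_bracket : ∀ X Y, a (bracket X Y) = Q (b X) (w Y) - Q (b Y) (w X)
  b_surjective : Function.Surjective b
  ext_zero : ∀ X, b X = 0 → A X = 0 → w X = 0 → a X = 0 → X = 0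

namespace SymmetryModel

variable {𝔤 T : Type*} [AddCommGroup 𝔤] [Module ℝ 𝔤] [AddCommGroup T] [Module ℝ T]
  [FiniteDimensional ℝ T] (S : SymmetryModel 𝔤 T)

/-- By `compat`, `a X • id - B - A X`, with `B` the adjoint of `A X`, represents `C (b X)` and is
therefore trace-free. -/
theorem two_mul_trace (X : 𝔤) :
    2 * LinearMap.trace ℝ T (S.A X) = Module.finrank ℝ T * S.a X := by
  obtain ⟨B, hB, htr⟩ := exists_adjoint S.Q S.Q_nondegenerate (S.A X)
  have h := S.C_traceless (S.b X) (S.a X • LinearMap.id - B - S.A X) (fun u x => by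
    have h1 := S.compat X u x
    simp only [LinearMap.sub_apply, LinearMap.smul_apply, LinearMap.id_apply, map_sub, map_smul,
      smul_eq_mul, hB]
    rw [S.Q_symm (S.A X u) x]
    linarith)
  simp only [map_sub, map_smul, LinearMap.trace_id, smul_eq_mul, htr] at h
  linarith

/-- The commutator has no trace; only the two rank-one terms contribute. The result is `-a [X, Y]`.
-/
theorem trace_bracket (X Y : 𝔤) : LinearMap.trace ℝ T (S.A (S.bracket X Y)) =
    S.Q (S.b Y) (S.w X) - S.Q (S.b X) (S.w Y) := by
  have h : S.A (S.bracket X Y) = S.A X * S.A Y - S.A Y * S.A X +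
      (S.Q (S.b Y)).smulRight (S.w X) - (S.Q (S.b X)).smulRight (S.w Y) := by
    refine LinearMap.ext fun u => ?_
    rw [S.A_bracket]
    rfl
  rw [h, map_sub, map_add, map_sub, LinearMap.trace_mul_comm, LinearMap.trace_smulRight,
    LinearMap.trace_smulRight]
  ring

/-- The two trace formulas give `(dim T + 2) a [X, Y] = 0`. Equivalently, the affine shape operator
is symmetric. -/
theorem a_bracket_eq_zero (X Y : 𝔤) : S.a (S.bracket X Y) = 0 := by
  have h1 := S.two_mul_trace (S.bracket X Y)
  rw [S.trace_bracket, S.a_bracket] at h1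
  rw [S.a_bracket]
  have h2 : (0 : ℝ) < (Module.finrank ℝ T : ℝ) + 2 := by positivity
  have h3 : ((Module.finrank ℝ T : ℝ) + 2) * (S.Q (S.b X) (S.w Y) - S.Q (S.b Y) (S.w X)) = 0 := by
    linarith
  exact (mul_eq_zero.1 h3).resolve_left h2.ne'

/-- With `b X = 0`, vanishing of `a [X, Y]` says that `w X` is orthogonal to every `b Y`, hence to
all of `T`. -/
theorem w_eq_zero {X : 𝔤} (hX : S.b X = 0) : S.w X = 0 := by
  refine S.Q_nondegenerate _ fun v => ?_
  obtain ⟨Y, rfl⟩ := S.b_surjective v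
  have h := S.a_bracket_eq_zero X Y
  rw [S.a_bracket, hX, map_zero, LinearMap.zero_apply, zero_sub, neg_eq_zero] at h
  rw [S.Q_symm]
  exact h

end SymmetryModel

end AffineTube

namespace AffineTube

/-! ### Jets of the symmetries at a point of Γ and construction of the model. -/

section Jets

variable {m : ℕ} {Γ U : Set (Fin m → ℝ)} {F : (Fin m → ℝ) → ℝ} {q : Fin m → ℝ}

theorem hasFDerivAt_fderiv {E G : Type*} [NormedAddCommGroup E] [NormedSpace ℝ E]
    [NormedAddCommGroup G] [NormedSpace ℝ G] {f : E → G} {x : E} (hf : ContDiffAt ℝ ∞ f x) :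
    HasFDerivAt (fderiv ℝ f) (fderiv ℝ (fderiv ℝ f) x) x :=
  ((hf.fderiv_right (m := ∞) (by simp)).differentiableAt (by simp)).hasFDerivAt

/-- If a function vanishes on a hypersurface, its second differential at a point is on the tangent
space the same multiple of the second fundamental form as its differential is of the conormal. -/
theorem IsDefiningFunction.exists_fderiv_fderiv_eq (hF : IsDefiningFunction Γ U F) (hqU : q ∈ U)
    (hq : q ∈ Γ) {G : (Fin m → ℝ) → ℝ} (hG : ContDiffAt ℝ ∞ G q)
    (hGΓ : ∀ᶠ x in 𝓝 q, x ∈ Γ → G x = 0) :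
    ∃ c : ℝ, fderiv ℝ G q = c • fderiv ℝ F q ∧ ∀ u v, fderiv ℝ F q u = 0 → fderiv ℝ F q v = 0 →
      fderiv ℝ (fderiv ℝ G) q v u = c * fderiv ℝ (fderiv ℝ F) q v u := by
  obtain ⟨c, hc⟩ := hF.exists_fderiv_eq hqU hq (hG.of_le (by simp)) hGΓ
  refine ⟨c, hc, fun u v hu hv => ?_⟩
  obtain ⟨ξ, hξ⟩ : ∃ ξ, fderiv ℝ F q ξ ≠ 0 := by
    by_contra h
    push Not at h
    exact hF.fderiv_ne_zero q hqU (ContinuousLinearMap.ext h)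
  -- `dG` is proportional to `dF` along Γ, so this minor vanishes on Γ. Differentiating it in a
  -- tangent direction compares the two Hessians.
  let H : (Fin m → ℝ) → ℝ := fun x =>
    fderiv ℝ G x u * fderiv ℝ F x ξ - fderiv ℝ G x ξ * fderiv ℝ F x u
  have hFq := hF.contDiffAt hqU
  have hev : ∀ {f : (Fin m → ℝ) → ℝ} (_ : ContDiffAt ℝ ∞ f q) (z : Fin m → ℝ),
      ContDiffAt ℝ ∞ (fun x => fderiv ℝ f x z) q := fun hf z =>
    (hf.fderiv_right (m := ∞) (by simp)).clm_apply contDiffAt_const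
  have hHc : ContDiffAt ℝ ∞ H q :=
    ((hev hG u).mul (hev hFq ξ)).sub ((hev hG ξ).mul (hev hFq u))
  have hHΓ : ∀ᶠ x in 𝓝 q, x ∈ Γ → H x = 0 := by
    filter_upwards [hGΓ.eventually_nhds, hF.isOpen.mem_nhds hqU,
      (hG.of_le (m := 1) (by simp)).eventually (by simp)] with x hx hxU hxG hxΓ
    obtain ⟨d, hd⟩ := hF.exists_fderiv_eq hxU hxΓ hxG hx
    simp only [H, hd, smul_apply, smul_eq_mul]
    ring
  obtain ⟨d, hd⟩ := hF.exists_fderiv_eq hqU hq (hHc.of_le (by simp)) hHΓ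
  have hev2 : ∀ {f : (Fin m → ℝ) → ℝ} (_ : ContDiffAt ℝ ∞ f q) (z : Fin m → ℝ),
      HasFDerivAt (fun x => fderiv ℝ f x z) ((fderiv ℝ (fderiv ℝ f) q).flip z) q := fun hf z => by
    have := (hasFDerivAt_fderiv hf).clm_apply (hasFDerivAt_const z q)
    refine this.congr_fderiv ?_
    ext y
    simp
  have hHd := ((hev2 hG u).mul (hev2 hFq ξ)).sub ((hev2 hG ξ).mul (hev2 hFq u))
  have h1 := hHd.fderiv.symm.trans hd
  have h2 := DFunLike.congr_fun h1 v
  simp only [sub_apply, add_apply,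
    smul_apply, ContinuousLinearMap.flip_apply, smul_eq_mul, hc, hu, hv,
    mul_zero, zero_mul, zero_add] at h2
  have h3 : fderiv ℝ F q ξ * (fderiv ℝ (fderiv ℝ G) q v u -
      c * fderiv ℝ (fderiv ℝ F) q v u) = 0 := by linarith
  exact sub_eq_zero.1 ((mul_eq_zero.1 h3).resolve_left hξ)

theorem IsDefiningFunction.third_swap_left (hF : IsDefiningFunction Γ U F) (hqU : q ∈ U)
    (u v x : Fin m → ℝ) : fderiv ℝ (fderiv ℝ (fderiv ℝ F)) q u v x =
      fderiv ℝ (fderiv ℝ (fderiv ℝ F)) q v u x := by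
  have h := ((hF.contDiffAt hqU).fderiv_right (m := ∞) (by simp)).isSymmSndFDerivAt
    (by simpa using two_le_infty) u v
  exact DFunLike.congr_fun h x

theorem IsDefiningFunction.hasFDerivAt_second (hF : IsDefiningFunction Γ U F) (hqU : q ∈ U)
    (u v : Fin m → ℝ) : HasFDerivAt (fun y => fderiv ℝ (fderiv ℝ F) y u v)
      (((fderiv ℝ (fderiv ℝ (fderiv ℝ F)) q).flip u).flip v) q := by
  have h := hasFDerivAt_fderiv ((hF.contDiffAt hqU).fderiv_right (m := ∞) (by simp))
  have := (h.clm_apply (hasFDerivAt_const u q)).clm_apply (hasFDerivAt_const v q)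
  refine this.congr_fderiv ?_
  ext y
  simp

theorem IsDefiningFunction.third_swap_right (hF : IsDefiningFunction Γ U F) (hqU : q ∈ U)
    (u v x : Fin m → ℝ) : fderiv ℝ (fderiv ℝ (fderiv ℝ F)) q u v x =
      fderiv ℝ (fderiv ℝ (fderiv ℝ F)) q u x v := by
  have h1 := hF.hasFDerivAt_second hqU v x
  have h2 := (hF.hasFDerivAt_second hqU x v).congr_of_eventuallyEq
    (f₁ := fun y => fderiv ℝ (fderiv ℝ F) y v x) (by
      filter_upwards [hF.isOpen.mem_nhds hqU] with y hy using hF.isSymm_fderiv_fderiv hy v x)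
  exact DFunLike.congr_fun (h1.unique h2) u

theorem IsDefiningFunction.fderiv_fderiv_derivAlong (hF : IsDefiningFunction Γ U F) (hqU : q ∈ U)
    (X : (Fin m → ℝ) →ᵃ[ℝ] (Fin m → ℝ)) (u v : Fin m → ℝ) :
    fderiv ℝ (fderiv ℝ (derivAlong F X)) q v u = fderiv ℝ (fderiv ℝ (fderiv ℝ F)) q v u (X q) +
      fderiv ℝ (fderiv ℝ F) q u (X.linear v) + fderiv ℝ (fderiv ℝ F) q v (X.linear u) := by
  have h1 : HasFDerivAt (fun x => fderiv ℝ (derivAlong F X) x u)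
      ((fderiv ℝ (fderiv ℝ (derivAlong F X)) q).flip u) q := by
    have := (hasFDerivAt_fderiv (hF.contDiffAt_derivAlong hqU X)).clm_apply
      (hasFDerivAt_const u q)
    refine this.congr_fderiv ?_
    ext y
    simp
  have h2 : (fun x => fderiv ℝ (derivAlong F X) x u) =ᶠ[𝓝 q] fun x =>
      fderiv ℝ F x (X.linear u) + fderiv ℝ (fderiv ℝ F) x u (X x) := by
    filter_upwards [hF.isOpen.mem_nhds hqU] with x hx
    rw [(hasFDerivAt_derivAlong ((hF.contDiffAt hx).of_le two_le_infty) X).fderiv]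
    simp
  have hF1 := hasFDerivAt_fderiv (hF.contDiffAt hqU)
  have hF2 := hasFDerivAt_fderiv ((hF.contDiffAt hqU).fderiv_right (m := ∞) (by simp))
  have h3 := (hF1.clm_apply (hasFDerivAt_const (X.linear u) q)).add
    ((hF2.clm_apply (hasFDerivAt_const u q)).clm_apply (hasFDerivAt_affineMap X q))
  have h4 := DFunLike.congr_fun ((h1.congr_of_eventuallyEq h2.symm).unique h3) v
  simp only [ContinuousLinearMap.flip_apply, add_apply,
    ContinuousLinearMap.comp_apply, zero_apply, map_zero, zero_add,
    LinearMap.coe_toContinuousLinearMap'] at h4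
  rw [h4]
  ring

/-- The tangent space at `q` of the level set of `F`. -/
noncomputable abbrev tangentKer (F : (Fin m → ℝ) → ℝ) (q : Fin m → ℝ) : Submodule ℝ (Fin m → ℝ) :=
  LinearMap.ker (fderiv ℝ F q).toLinearMap

/-- The second fundamental form as a bilinear map. -/
noncomputable def secondForm (F : (Fin m → ℝ) → ℝ) (q : Fin m → ℝ) :
    tangentKer F q →ₗ[ℝ] tangentKer F q →ₗ[ℝ] ℝ :=
  LinearMap.mk₂ ℝ (fun u v => fderiv ℝ (fderiv ℝ F) q u v) (by simp) (by simp) (by simp) (by simp)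

theorem secondForm_apply (u v : tangentKer F q) :
    secondForm F q u v = fderiv ℝ (fderiv ℝ F) q u v := rfl

/-- The cubic form of a level set relative to the transversal vector `ξ`. -/
noncomputable def cubicForm (F : (Fin m → ℝ) → ℝ) (q ξ : Fin m → ℝ) :
    tangentKer F q →ₗ[ℝ] tangentKer F q →ₗ[ℝ] tangentKer F q →ₗ[ℝ] ℝ :=
  LinearMap.mk₂ ℝ (fun u v => (fderiv ℝ (fderiv ℝ (fderiv ℝ F)) q u v).toLinearMap ∘ₗ
      (tangentKer F q).subtype + fderiv ℝ (fderiv ℝ F) q v ξ • secondForm F q u +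
      fderiv ℝ (fderiv ℝ F) q u ξ • secondForm F q v +
      secondForm F q u v • (fderiv ℝ (fderiv ℝ F) q ξ).toLinearMap ∘ₗ (tangentKer F q).subtype)
    (by intro u u' v; ext x; simp; ring) (by intro c u v; ext x; simp; ring)
    (by intro u v v'; ext x; simp; ring) (by intro c u v; ext x; simp; ring)

theorem cubicForm_apply (ξ : Fin m → ℝ) (u v x : tangentKer F q) :
    cubicForm F q ξ u v x = fderiv ℝ (fderiv ℝ (fderiv ℝ F)) q u v x +
      fderiv ℝ (fderiv ℝ F) q v ξ * secondForm F q u x +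
      fderiv ℝ (fderiv ℝ F) q u ξ * secondForm F q v x +
      secondForm F q u v * fderiv ℝ (fderiv ℝ F) q ξ x := rfl

/-- The projection onto the tangent space along `ξ`. -/
noncomputable def tangentProj (F : (Fin m → ℝ) → ℝ) (q ξ : Fin m → ℝ)
    (hξ : fderiv ℝ F q ξ = -1) : (Fin m → ℝ) →ₗ[ℝ] tangentKer F q :=
  (LinearMap.id + (fderiv ℝ F q).toLinearMap.smulRight ξ).codRestrict _ (fun v => by
    simp [hξ])

theorem tangentProj_coe {ξ : Fin m → ℝ} (hξ : fderiv ℝ F q ξ = -1) (v : Fin m → ℝ) :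
    (tangentProj F q ξ hξ v : Fin m → ℝ) = v + fderiv ℝ F q v • ξ := rfl

theorem tangentProj_of_mem {ξ : Fin m → ℝ} (hξ : fderiv ℝ F q ξ = -1) (v : tangentKer F q) :
    tangentProj F q ξ hξ v = v := by
  apply Subtype.ext
  rw [tangentProj_coe]
  have : fderiv ℝ F q v = 0 := v.2
  rw [this, zero_smul, add_zero]

theorem coe_tangentProj_sub {ξ : Fin m → ℝ} (hξ : fderiv ℝ F q ξ = -1) (v : Fin m → ℝ) :
    v = (tangentProj F q ξ hξ v : Fin m → ℝ) - fderiv ℝ F q v • ξ := by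
  rw [tangentProj_coe, add_sub_cancel_right]

/-- Evaluation of affine vector fields at a point. -/
noncomputable def evalField (q : Fin m → ℝ) :
    ((Fin m → ℝ) →ᵃ[ℝ] (Fin m → ℝ)) →ₗ[ℝ] (Fin m → ℝ) where
  toFun X := X q
  map_add' _ _ := rfl
  map_smul' _ _ := rfl

/-- The linear part of an affine vector field. -/
noncomputable def linearPart :
    ((Fin m → ℝ) →ᵃ[ℝ] (Fin m → ℝ)) →ₗ[ℝ] (Fin m → ℝ) →ₗ[ℝ] (Fin m → ℝ) where
  toFun X := X.linear
  map_add' _ _ := rfl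
  map_smul' _ _ := rfl

/-- `dF(X)` vanishes on Γ, so its first two derivatives at `q` are one and the same multiple of
those of `F`, the second only on tangent vectors. These are the relations behind `compat`. -/
theorem IsDefiningFunction.symmetry_jet (hF : IsDefiningFunction Γ U F) (hqU : q ∈ U)
    (hq : q ∈ Γ) {X : (Fin m → ℝ) →ᵃ[ℝ] (Fin m → ℝ)}
    (hX : X ∈ symmetryAlgebra Γ) : ∃ c : ℝ,
    (∀ u, fderiv ℝ F q (X.linear u) + fderiv ℝ (fderiv ℝ F) q u (X q) = c * fderiv ℝ F q u) ∧
    ∀ u v : tangentKer F q, fderiv ℝ (fderiv ℝ (fderiv ℝ F)) q v u (X q) +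
      fderiv ℝ (fderiv ℝ F) q u (X.linear v) + fderiv ℝ (fderiv ℝ F) q v (X.linear u) =
        c * secondForm F q u v := by
  obtain ⟨c, hc, hc2⟩ := hF.exists_fderiv_fderiv_eq hqU hq (hF.contDiffAt_derivAlong hqU X)
    (hF.eventually_derivAlong_eq_zero hqU hX)
  refine ⟨c, fun u => ?_, fun u v => ?_⟩
  · rw [(hasFDerivAt_derivAlong ((hF.contDiffAt hqU).of_le two_le_infty) X).fderiv] at hc
    exact DFunLike.congr_fun hc u
  · rw [← hF.fderiv_fderiv_derivAlong hqU, hc2 u v u.2 v.2, secondForm_apply,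
      hF.isSymm_fderiv_fderiv hqU]

/-- The symmetry model of a homogeneous hypersurface at a point, relative to the affine normal. -/
noncomputable def jetModel (hF : IsDefiningFunction Γ U F) (hqU : q ∈ U) (hq : q ∈ Γ)
    (hΓ : IsSmoothHypersurface Γ)
    (hhom : IsAffinelyHomogeneousHypersurface Γ) {ξ : Fin m → ℝ} (hξ : fderiv ℝ F q ξ = -1)
    (hnd : ∀ u, (∀ v, secondForm F q u v = 0) → u = 0)
    (htr : ∀ (v : tangentKer F q) (N : tangentKer F q →ₗ[ℝ] tangentKer F q),
      (∀ u x, secondForm F q (N u) x = cubicForm F q ξ v u x) → LinearMap.trace ℝ _ N = 0) :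
    SymmetryModel (symmetryAlgebra Γ) (tangentKer F q) :=
  have hbT : ∀ X : symmetryAlgebra Γ, fderiv ℝ F q (X.1 q) = 0 := fun X =>
    hF.fderiv_apply_symmetry hqU hq X.2
  have hLT : ∀ (X : symmetryAlgebra Γ) (u : tangentKer F q), fderiv ℝ F q (X.1.linear u) =
      -fderiv ℝ (fderiv ℝ F) q u (X.1 q) := fun X u => by
    obtain ⟨c, hc, -⟩ := hF.symmetry_jet hqU hq X.2
    have h1 := hc u
    have h2 : fderiv ℝ F q u = 0 := u.2
    rw [h2, mul_zero] at h1
    linarith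
  have hb : ∀ X : symmetryAlgebra Γ, (tangentProj F q ξ hξ (X.1 q) : Fin m → ℝ) = X.1 q :=
    fun X => congrArg Subtype.val (tangentProj_of_mem hξ ⟨X.1 q, hbT X⟩)
  { Q := secondForm F q
    C := cubicForm F q ξ
    b := tangentProj F q ξ hξ ∘ₗ evalField q ∘ₗ (symmetryAlgebra Γ).subtype
    A := (LinearMap.llcomp ℝ _ _ _ (tangentProj F q ξ hξ)) ∘ₗ
      (LinearMap.lcomp ℝ (Fin m → ℝ) (tangentKer F q).subtype) ∘ₗ linearPart ∘ₗ
        (symmetryAlgebra Γ).subtype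
    w := tangentProj F q ξ hξ ∘ₗ LinearMap.applyₗ ξ ∘ₗ linearPart ∘ₗ (symmetryAlgebra Γ).subtype
    a := -((fderiv ℝ F q).toLinearMap ∘ₗ LinearMap.applyₗ ξ ∘ₗ linearPart ∘ₗ
      (symmetryAlgebra Γ).subtype)
    bracket := fun X Y => ⟨affineBracket X.1 Y.1, affineBracket_mem_symmetryAlgebra hΓ X.2 Y.2⟩
    Q_symm := fun u v => hF.isSymm_fderiv_fderiv hqU u v
    Q_nondegenerate := hnd
    C_swap_left := fun u v x => by
      rw [cubicForm_apply, cubicForm_apply, hF.third_swap_left hqU, secondForm_apply,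
        secondForm_apply, secondForm_apply, secondForm_apply,
        hF.isSymm_fderiv_fderiv hqU u v]
      ring
    C_swap_right := fun u v x => by
      rw [cubicForm_apply, cubicForm_apply, hF.third_swap_right hqU, secondForm_apply,
        secondForm_apply, secondForm_apply, secondForm_apply,
        hF.isSymm_fderiv_fderiv hqU ξ x, hF.isSymm_fderiv_fderiv hqU ξ v,
        hF.isSymm_fderiv_fderiv hqU v x]
      ring
    C_traceless := htr
    compat := fun X u v => by
      obtain ⟨c, hc1, hc2⟩ := hF.symmetry_jet hqU hq X.2
      have h1 := hc1 ξ
      have h2 := hc2 u v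
      change fderiv ℝ (fderiv ℝ F) q u (X.1.linear v + fderiv ℝ F q (X.1.linear v) • ξ) +
        fderiv ℝ (fderiv ℝ F) q v (X.1.linear u + fderiv ℝ F q (X.1.linear u) • ξ) +
        cubicForm F q ξ (tangentProj F q ξ hξ (X.1 q)) u v =
          -(fderiv ℝ F q (X.1.linear ξ)) * secondForm F q u v
      rw [cubicForm_apply, map_add, map_add, map_smul, map_smul, hLT, hLT]
      simp only [secondForm_apply, hb]
      rw [hF.third_swap_left hqU, hF.third_swap_right hqU]
      rw [hξ] at h1
      rw [hF.third_swap_left hqU, secondForm_apply] at h2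
      rw [hF.isSymm_fderiv_fderiv hqU (X.1 q) u, hF.isSymm_fderiv_fderiv hqU (X.1 q) v,
        hF.isSymm_fderiv_fderiv hqU (X.1 q) ξ, hF.isSymm_fderiv_fderiv hqU ξ v]
      -- Evaluating the first-order relation on ξ identifies the unknown multiplier.
      have h3 : c = -fderiv ℝ F q (X.1.linear ξ) - fderiv ℝ (fderiv ℝ F) q ξ (X.1 q) := by
        linarith
      rw [h3] at h2
      simp only [smul_eq_mul]
      linear_combination h2
    b_bracket := fun X Y => by
      apply Subtype.ext
      change (tangentProj F q ξ hξ (X.1.linear (Y.1 q) - Y.1.linear (X.1 q)) : Fin m → ℝ) =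
        (tangentProj F q ξ hξ (X.1.linear (tangentProj F q ξ hξ (Y.1 q))) : Fin m → ℝ) -
        (tangentProj F q ξ hξ (Y.1.linear (tangentProj F q ξ hξ (X.1 q))) : Fin m → ℝ)
      rw [hb, hb, map_sub]
      rfl
    A_bracket := fun X Y u => by
      have hdec : ∀ (X : symmetryAlgebra Γ) (u : tangentKer F q), X.1.linear u =
          (tangentProj F q ξ hξ (X.1.linear u) : Fin m → ℝ) +
            fderiv ℝ (fderiv ℝ F) q u (X.1 q) • ξ := fun X u => by
        rw [tangentProj_coe, hLT]; simp
      change tangentProj F q ξ hξ (X.1.linear (Y.1.linear u) - Y.1.linear (X.1.linear u)) =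
        tangentProj F q ξ hξ (X.1.linear (tangentProj F q ξ hξ (Y.1.linear u))) -
        tangentProj F q ξ hξ (Y.1.linear (tangentProj F q ξ hξ (X.1.linear u))) +
        fderiv ℝ (fderiv ℝ F) q (tangentProj F q ξ hξ (Y.1 q)) u •
          tangentProj F q ξ hξ (X.1.linear ξ) -
        fderiv ℝ (fderiv ℝ F) q (tangentProj F q ξ hξ (X.1 q)) u •
          tangentProj F q ξ hξ (Y.1.linear ξ)
      rw [hb, hb, hF.isSymm_fderiv_fderiv hqU (Y.1 q), hF.isSymm_fderiv_fderiv hqU (X.1 q)]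
      conv_lhs => rw [hdec X u, hdec Y u]
      simp only [map_add, map_sub, map_smul]
      abel
    w_bracket := fun X Y => by
      have hdec : ∀ X : symmetryAlgebra Γ, X.1.linear ξ =
          (tangentProj F q ξ hξ (X.1.linear ξ) : Fin m → ℝ) -
            fderiv ℝ F q (X.1.linear ξ) • ξ := fun X => coe_tangentProj_sub hξ _
      change tangentProj F q ξ hξ (X.1.linear (Y.1.linear ξ) - Y.1.linear (X.1.linear ξ)) =
        tangentProj F q ξ hξ (X.1.linear (tangentProj F q ξ hξ (Y.1.linear ξ))) +
        (-fderiv ℝ F q (Y.1.linear ξ)) • tangentProj F q ξ hξ (X.1.linear ξ) -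
        (tangentProj F q ξ hξ (Y.1.linear (tangentProj F q ξ hξ (X.1.linear ξ))) +
        (-fderiv ℝ F q (X.1.linear ξ)) • tangentProj F q ξ hξ (Y.1.linear ξ))
      conv_lhs =>
        rw [map_sub]
        congr
        · rw [hdec Y]
        · rw [hdec X]
      simp only [map_sub, map_smul]
      module
    a_bracket := fun X Y => by
      have hdec : ∀ X : symmetryAlgebra Γ, X.1.linear ξ =
          (tangentProj F q ξ hξ (X.1.linear ξ) : Fin m → ℝ) -
            fderiv ℝ F q (X.1.linear ξ) • ξ := fun X => coe_tangentProj_sub hξ _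
      change -(fderiv ℝ F q (X.1.linear (Y.1.linear ξ) - Y.1.linear (X.1.linear ξ))) =
        fderiv ℝ (fderiv ℝ F) q (tangentProj F q ξ hξ (X.1 q))
          (tangentProj F q ξ hξ (Y.1.linear ξ)) -
        fderiv ℝ (fderiv ℝ F) q (tangentProj F q ξ hξ (Y.1 q))
          (tangentProj F q ξ hξ (X.1.linear ξ))
      rw [hb, hb, hF.isSymm_fderiv_fderiv hqU (Y.1 q), hF.isSymm_fderiv_fderiv hqU (X.1 q)]
      conv_lhs =>
        rw [map_sub]
        congr
        congr
        · rw [hdec Y]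
        · rw [hdec X]
      simp only [map_sub, map_smul, hLT, smul_eq_mul]
      ring
    b_surjective := fun v => by
      obtain ⟨X, hX, hXq⟩ := hhom q hq v ((hF.mem_tangentSpace_iff hqU hq).2 v.2)
      refine ⟨⟨X, hX⟩, ?_⟩
      change tangentProj F q ξ hξ (X q) = v
      rw [hXq, tangentProj_of_mem]
    ext_zero := fun X h1 h2 h3 h4 => by
      have hq0 : X.1 q = 0 := by rw [← hb X]; exact congrArg Subtype.val h1
      have hL : X.1.linear = 0 := by
        have hT : ∀ u : tangentKer F q, X.1.linear u = 0 := fun u => by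
          rw [coe_tangentProj_sub hξ (X.1.linear u), hLT, hq0, map_zero, neg_zero, zero_smul,
            sub_zero]
          exact congrArg Subtype.val (DFunLike.congr_fun h2 u)
        have hN : X.1.linear ξ = 0 := by
          have h5 : fderiv ℝ F q (X.1.linear ξ) = 0 := neg_eq_zero.1 h4
          rw [coe_tangentProj_sub hξ (X.1.linear ξ), h5, zero_smul, sub_zero]
          exact congrArg Subtype.val h3
        refine LinearMap.ext fun v => ?_
        rw [coe_tangentProj_sub hξ v, map_sub, map_smul, hT, hN, smul_zero, sub_zero]
        rfl
      apply Subtype.ext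
      refine AffineMap.ext fun x => ?_
      have h6 := X.1.map_vadd q (x - q)
      simp only [vadd_eq_add, sub_add_cancel] at h6
      rw [h6, hL, hq0]
      simp }

end Jets

end AffineTube

namespace AffineTube

/-! ### Passing from the domain to the model: the grading element and the isotropy dimension. -/

namespace SymmetryModel

variable {𝔤 T : Type*} [AddCommGroup 𝔤] [Module ℝ 𝔤] [AddCommGroup T] [Module ℝ T]
  (S : SymmetryModel 𝔤 T)

/-- The affine vector field on `T × ℝ` described by a symmetry model. -/
def field (X : 𝔤) (x : T × ℝ) : T × ℝ :=
  (S.b X + S.A X x.1 + x.2 • S.w X, S.Q (S.b X) x.1 + x.2 * S.a X)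

/-- The elements with vanishing `b` and `a`. -/
def isotropy : Submodule ℝ 𝔤 := LinearMap.ker S.b ⊓ LinearMap.ker S.a

theorem mem_isotropy {X : 𝔤} : X ∈ S.isotropy ↔ S.b X = 0 ∧ S.a X = 0 := Iff.rfl

/-- The second fundamental form is the Minkowski form in some basis. -/
def IsLorentzian (n : ℕ) : Prop :=
  ∃ B : Module.Basis (Fin n) ℝ T, ∀ i j : Fin n, S.Q (B i) (B j) =
    if i = j then (if (i : ℕ) = 0 then -1 else 1) else 0

end SymmetryModel

theorem finrank_ker_inf_ker_ge {E : Type*} [AddCommGroup E] [Module ℝ E] [FiniteDimensional ℝ E]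
    (K : Submodule ℝ E) (a : E →ₗ[ℝ] ℝ) :
    Module.finrank ℝ K ≤ Module.finrank ℝ (K ⊓ LinearMap.ker a : Submodule ℝ E) + 1 := by
  have h1 := Submodule.finrank_sup_add_finrank_inf_eq K (LinearMap.ker a)
  have h2 := LinearMap.finrank_range_add_finrank_ker a
  have h3 : Module.finrank ℝ (LinearMap.range a) ≤ 1 := by
    simpa using Submodule.finrank_le (LinearMap.range a)
  have h4 := Submodule.finrank_le (K ⊔ LinearMap.ker a)
  omega

section

variable {n : ℕ} {Γ Ω : Set (Fin (n + 1) → ℝ)}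

/-- The coordinates of the ambient space relative to the tangent space and a transversal. -/
noncomputable def tangentProdEquiv (F : (Fin (n + 1) → ℝ) → ℝ) (q ξ : Fin (n + 1) → ℝ)
    (hξ : fderiv ℝ F q ξ = -1) : (tangentKer F q × ℝ) ≃L[ℝ] (Fin (n + 1) → ℝ) :=
  LinearEquiv.toContinuousLinearEquiv
    { toFun := fun x => (x.1 : Fin (n + 1) → ℝ) + x.2 • ξ
      invFun := fun v => (tangentProj F q ξ hξ v, -(fderiv ℝ F q v))
      map_add' := fun x y => by
        simp only [Prod.fst_add, Prod.snd_add, Submodule.coe_add]; module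
      map_smul' := fun c x => by
        simp only [Prod.smul_fst, Prod.smul_snd, SetLike.val_smul, RingHom.id_apply, smul_eq_mul]
        module
      left_inv := fun x => by
        have h : fderiv ℝ F q x.1 = 0 := x.1.2
        refine Prod.ext (Subtype.ext ?_) ?_
        · change ((tangentProj F q ξ hξ ((x.1 : Fin (n + 1) → ℝ) + x.2 • ξ) : _) :
            Fin (n + 1) → ℝ) = x.1
          rw [tangentProj_coe, map_add, map_smul, hξ, h]
          simp
        · change -(fderiv ℝ F q ((x.1 : Fin (n + 1) → ℝ) + x.2 • ξ)) = x.2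
          rw [map_add, map_smul, hξ, h]
          simp
      right_inv := fun v => by
        change ((tangentProj F q ξ hξ v : _) : Fin (n + 1) → ℝ) + (-(fderiv ℝ F q v)) • ξ = v
        rw [tangentProj_coe]
        simp }

theorem tangentProdEquiv_apply (F : (Fin (n + 1) → ℝ) → ℝ) (q ξ : Fin (n + 1) → ℝ)
    (hξ : fderiv ℝ F q ξ = -1) (x : tangentKer F q × ℝ) :
    tangentProdEquiv F q ξ hξ x = (x.1 : Fin (n + 1) → ℝ) + x.2 • ξ := rfl

/-- Evaluation at `p` is onto `ℝ^{n+1}`, and the isotropy algebra embeds into its kernel. -/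
theorem finrank_isotropyAlgebra_add_le (hΩ : IsAffinelyHomogeneousDomain Ω)
    (hΓ : IsBoundaryPart Γ Ω) {p : Fin (n + 1) → ℝ} (hp : p ∈ Ω) :
    Module.finrank ℝ (isotropyAlgebra Ω p) + (n + 1) ≤ Module.finrank ℝ (symmetryAlgebra Γ) := by
  let ev : symmetryAlgebra Γ →ₗ[ℝ] (Fin (n + 1) → ℝ) := evalField p ∘ₗ (symmetryAlgebra Γ).subtype
  have hsurj : LinearMap.range ev = ⊤ := by
    refine LinearMap.range_eq_top.2 fun v => ?_
    obtain ⟨X, hX, hXp⟩ := exists_symmetry_apply_eq hΩ hΓ hp v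
    exact ⟨⟨X, hX⟩, hXp⟩
  have h1 := LinearMap.finrank_range_add_finrank_ker ev
  rw [hsurj, finrank_top, Module.finrank_fin_fun] at h1
  let i : isotropyAlgebra Ω p →ₗ[ℝ] symmetryAlgebra Γ :=
    (fieldVanishingAt p ∘ₗ (isotropyAlgebra Ω p).subtype).codRestrict _
      (fun A => fieldVanishingAt_mem hΩ.isOpen hΓ p A.2)
  let j : isotropyAlgebra Ω p →ₗ[ℝ] LinearMap.ker ev := i.codRestrict _ (fun A => by
    change fieldVanishingAt p A.1 p = 0
    rw [fieldVanishingAt_apply, sub_self, map_zero])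
  have hj : Function.Injective j := by
    intro A A' hA
    have h2 : fieldVanishingAt p A.1 = fieldVanishingAt p A'.1 := congrArg (fun x => x.1.1) hA
    apply Subtype.ext
    ext1 v
    have h3 := congrArg (fun X : (Fin (n + 1) → ℝ) →ᵃ[ℝ] (Fin (n + 1) → ℝ) => X (p + v)) h2
    simpa only [fieldVanishingAt_apply, add_sub_cancel_left] using h3
  have h4 := LinearMap.finrank_le_finrank_of_injective hj
  omega

/-- The only place where the domain enters. It supplies the element `D`, and it bounds below the
isotropy of the model: passing from `ker b` to `ker b ⊓ ker a` loses at most the one dimension by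
which `ker b` exceeds the isotropy of a point of Ω. -/
theorem exists_symmetryModel (hΩ : IsAffinelyHomogeneousDomain Ω) (hΓ : IsBoundaryPart Γ Ω)
    (hsm : IsSmoothHypersurface Γ) (hhom : IsAffinelyHomogeneousHypersurface Γ)
    {q p : Fin (n + 1) → ℝ} (hq : q ∈ Γ) (hlor : HasLorentzianSecondFundamentalForm Γ q)
    (hp : p ∈ Ω) : ∃ (T : Submodule ℝ (Fin (n + 1) → ℝ))
      (S : SymmetryModel (symmetryAlgebra Γ) T) (Φ : (T × ℝ) ≃L[ℝ] (Fin (n + 1) → ℝ)),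
      (∀ (X : symmetryAlgebra Γ) x, X.1 (q + Φ x) = Φ (S.field X x)) ∧ S.IsLorentzian n ∧
      (∃ D, S.b D = 0 ∧ S.a D = 2) ∧
      Module.finrank ℝ (isotropyAlgebra Ω p) ≤ Module.finrank ℝ S.isotropy := by
  obtain ⟨U, F, hqU, hF, B, hB⟩ := hlor
  have hB' : ∀ i j, secondForm F q (B i) (B j) =
    if i = j then (if (i : ℕ) = 0 then -1 else 1) else 0 := hB
  have hnd : ∀ u, (∀ v, secondForm F q u v = 0) → u = 0 := by
    intro u hu
    refine B.ext_elem fun i => ?_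
    have h := hu (B i)
    rw [← B.sum_repr u, map_sum, LinearMap.sum_apply] at h
    simp only [map_smul, LinearMap.smul_apply, hB', smul_eq_mul] at h
    simp only [mul_ite, mul_zero, Finset.sum_ite_eq', Finset.mem_univ, if_true] at h
    split_ifs at h <;> simpa using h
  obtain ⟨v, hv⟩ : ∃ v, fderiv ℝ F q v ≠ 0 := by
    by_contra hcon
    push Not at hcon
    exact hF.fderiv_ne_zero q hqU (ContinuousLinearMap.ext hcon)
  -- The value -1 matches graphs `F = f - xₙ₊₁`, for which `secondForm` and `cubicForm` are the
  -- second and third derivatives of `f`.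
  set ξ₀ : Fin (n + 1) → ℝ := -((fderiv ℝ F q v)⁻¹ • v) with hξ₀
  have hξ₀1 : fderiv ℝ F q ξ₀ = -1 := by
    rw [hξ₀, map_neg, map_smul, smul_eq_mul, inv_mul_cancel₀ hv]
  -- Replacing `ξ₀` by `ξ₀ + t` with `t` tangent changes the cubic form by the symmetrised product
  -- of `Q` and `Q t`, so `t` can be chosen to remove the trace.
  obtain ⟨t, ht⟩ := exists_traceless (secondForm F q) hnd
    (fun u v => hF.isSymm_fderiv_fderiv hqU u v) (cubicForm F q ξ₀)
  set ξ : Fin (n + 1) → ℝ := ξ₀ + t with hξdef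
  have hξ : fderiv ℝ F q ξ = -1 := by
    have h : fderiv ℝ F q t = 0 := t.2
    rw [hξdef, map_add, h, hξ₀1, add_zero]
  have htr : ∀ (v : tangentKer F q) (N : tangentKer F q →ₗ[ℝ] tangentKer F q),
      (∀ u x, secondForm F q (N u) x = cubicForm F q ξ v u x) → LinearMap.trace ℝ _ N = 0 := by
    intro v N hN
    refine ht v N fun u x => ?_
    rw [hN, cubicForm_apply, cubicForm_apply, hξdef]
    simp only [map_add, add_apply, secondForm_apply]
    rw [hF.isSymm_fderiv_fderiv hqU t x, hF.isSymm_fderiv_fderiv hqU u v,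
      hF.isSymm_fderiv_fderiv hqU x v]
    ring
  let S := jetModel hF hqU hq hsm hhom hξ hnd htr
  have hSb : ∀ X : symmetryAlgebra Γ, S.b X = tangentProj F q ξ hξ (X.1 q) := fun _ => rfl
  have hbT : ∀ X : symmetryAlgebra Γ, fderiv ℝ F q (X.1 q) = 0 := fun X =>
    hF.fderiv_apply_symmetry hqU hq X.2
  have hb : ∀ X : symmetryAlgebra Γ, (S.b X : Fin (n + 1) → ℝ) = X.1 q :=
    fun X => congrArg Subtype.val (tangentProj_of_mem hξ ⟨X.1 q, hbT X⟩)
  have hfield : ∀ (X : symmetryAlgebra Γ) x, X.1 (q + tangentProdEquiv F q ξ hξ x) =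
      tangentProdEquiv F q ξ hξ (S.field X x) := by
    intro X x
    have h6 := X.1.map_vadd q (tangentProdEquiv F q ξ hξ x)
    simp only [vadd_eq_add] at h6
    rw [add_comm q, h6, tangentProdEquiv_apply, tangentProdEquiv_apply, map_add, map_smul]
    have hL1 : X.1.linear x.1 = (S.A X x.1 : Fin (n + 1) → ℝ) + S.Q (S.b X) x.1 • ξ := by
      have h7 : S.Q (S.b X) x.1 = -fderiv ℝ F q (X.1.linear x.1) := by
        obtain ⟨c, hc, -⟩ := hF.symmetry_jet hqU hq X.2
        have h1 := hc x.1
        have h2 : fderiv ℝ F q x.1 = 0 := x.1.2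
        rw [h2, mul_zero] at h1
        have h8 : S.Q (S.b X) x.1 = fderiv ℝ (fderiv ℝ F) q (X.1 q) x.1 := by
          rw [← hb X]; rfl
        rw [h8, hF.isSymm_fderiv_fderiv hqU]
        linarith
      rw [h7, neg_smul, ← sub_eq_add_neg]
      exact coe_tangentProj_sub hξ _
    have hL2 : X.1.linear ξ = (S.w X : Fin (n + 1) → ℝ) + S.a X • ξ := by
      have h7 : S.a X = -fderiv ℝ F q (X.1.linear ξ) := rfl
      rw [h7, neg_smul, ← sub_eq_add_neg]
      exact coe_tangentProj_sub hξ _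
    rw [hL1, hL2, SymmetryModel.field]
    simp only [Submodule.coe_add, SetLike.val_smul]
    rw [hb]
    module
  have hfT : Module.finrank ℝ (tangentKer F q) = n := by
    rw [Module.finrank_eq_card_basis B, Fintype.card_fin]
  have hrb := LinearMap.finrank_range_add_finrank_ker S.b
  rw [LinearMap.range_eq_top.2 S.b_surjective, finrank_top, hfT] at hrb
  have hdim := finrank_isotropyAlgebra_add_le hΩ hΓ hp
  refine ⟨tangentKer F q, S, tangentProdEquiv F q ξ hξ, hfield, ⟨B, hB'⟩, ?_, ?_⟩
  · by_contra hcon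
    -- Otherwise every symmetry vanishing at `q`, having also `w = 0`, vanishes on the whole normal
    -- line. At the point `q + s • ξ` of Ω this is impossible: the symmetries vanishing there form a
    -- space of dimension one less than those vanishing at `q`.
    have ha : ∀ X, S.b X = 0 → S.a X = 0 := by
      intro X hX
      by_contra haX
      refine hcon ⟨(2 / S.a X) • X, ?_, ?_⟩
      · rw [map_smul, hX, smul_zero]
      · rw [map_smul, smul_eq_mul, div_mul_cancel₀ _ haX]
    obtain ⟨s, -, hs⟩ := hF.exists_mem_domain hΩ.isOpen hΓ hqU hq (ξ := ξ) (by rw [hξ]; norm_num)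
    let ev : symmetryAlgebra Γ →ₗ[ℝ] (Fin (n + 1) → ℝ) :=
      evalField (q + s • ξ) ∘ₗ (symmetryAlgebra Γ).subtype
    have hsurj : LinearMap.range ev = ⊤ := by
      refine LinearMap.range_eq_top.2 fun v => ?_
      obtain ⟨X, hX, hXp⟩ := exists_symmetry_apply_eq hΩ hΓ hs v
      exact ⟨⟨X, hX⟩, hXp⟩
    have h1 := LinearMap.finrank_range_add_finrank_ker ev
    rw [hsurj, finrank_top, Module.finrank_fin_fun] at h1
    have hle : LinearMap.ker S.b ≤ LinearMap.ker ev := by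
      intro X hX
      have hX' : S.b X = 0 := hX
      have h2 := hfield X (0, s)
      have h3 : S.field X (0, s) = 0 := by
        rw [SymmetryModel.field, hX', ha X hX', S.w_eq_zero hX']
        simp
      rw [h3, map_zero, tangentProdEquiv_apply] at h2
      simp only [Submodule.coe_zero, zero_add] at h2
      exact h2
    have h4 := Submodule.finrank_mono hle
    omega
  · have h5 := finrank_ker_inf_ker_ge (LinearMap.ker S.b) S.a
    change _ ≤ Module.finrank ℝ (LinearMap.ker S.b ⊓ LinearMap.ker S.a : Submodule ℝ _)
    omega

end

end AffineTube

namespace AffineTube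

/-! ### Derivative of the cubic form, the Codazzi equation and weights under the grading element. -/

namespace SymmetryModel

variable {𝔤 T : Type*} [AddCommGroup 𝔤] [Module ℝ 𝔤] [AddCommGroup T] [Module ℝ T]
  [FiniteDimensional ℝ T] (S : SymmetryModel 𝔤 T)

theorem skew {X : 𝔤} (hX : S.b X = 0) (u v : T) :
    S.Q u (S.A X v) + S.Q v (S.A X u) = S.a X * S.Q u v := by
  have h := S.compat X u v
  rwa [hX, map_zero, LinearMap.zero_apply, LinearMap.zero_apply, add_zero] at h

/-- The derivative of the cubic form by a symmetry. -/
def cubicDeriv : 𝔤 →ₗ[ℝ] T →ₗ[ℝ] T →ₗ[ℝ] T →ₗ[ℝ] ℝ :=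
  LinearMap.mk₂ ℝ (fun X x => S.C (S.A X x) + (LinearMap.lcomp ℝ _ (S.A X)) ∘ₗ (S.C x) +
    (S.C x) ∘ₗ (S.A X))
    (by intro X Y x; ext y z; simp; ring) (by intro c X x; ext y z; simp)
    (by intro X x y; ext y z; simp; ring) (by intro c X x; ext y z; simp)

theorem cubicDeriv_apply (X : 𝔤) (x y z : T) : S.cubicDeriv X x y z =
    S.C (S.A X x) y z + S.C x (S.A X y) z + S.C x y (S.A X z) := by
  simp only [cubicDeriv, LinearMap.mk₂_apply, LinearMap.add_apply, LinearMap.comp_apply,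
    LinearMap.lcomp_apply]
  ring

theorem cubicDeriv_swap_left (X : 𝔤) (x y z : T) :
    S.cubicDeriv X x y z = S.cubicDeriv X y x z := by
  rw [cubicDeriv_apply, cubicDeriv_apply, S.C_swap_left (S.A X x), S.C_swap_left x (S.A X y),
    S.C_swap_left x y]
  ring

theorem cubicDeriv_swap_right (X : 𝔤) (x y z : T) :
    S.cubicDeriv X x y z = S.cubicDeriv X x z y := by
  rw [cubicDeriv_apply, cubicDeriv_apply, S.C_swap_right (S.A X x), S.C_swap_right x (S.A X y),
    S.C_swap_right x y]
  ring

/-- This is `compat` for the bracket of `X` with a `Y` such that `b Y = x`: there `a` vanishes and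
the `w`-terms drop out, so the action of `A X` on `C` remains. -/
theorem cubicDeriv_eq {X : 𝔤} (hX : S.b X = 0) (x y z : T) :
    S.cubicDeriv X x y z = S.a X * S.C x y z := by
  obtain ⟨Y, rfl⟩ := S.b_surjective x
  have h := S.compat (S.bracket X Y) y z
  have hw := S.w_eq_zero hX
  simp only [S.a_bracket_eq_zero, S.A_bracket, S.b_bracket, hX, hw, map_zero, sub_zero, smul_zero,
    add_zero, zero_smul, LinearMap.zero_apply, map_sub, zero_mul] at h
  have h1 := S.skew hX y (S.A Y z)
  have h2 := S.skew hX z (S.A Y y)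
  have h3 := S.compat Y y (S.A X z)
  have h4 := S.compat Y z (S.A X y)
  have h5 := S.compat Y y z
  have h6 := S.skew hX y z
  rw [cubicDeriv_apply]
  rw [S.C_swap_right (S.b Y) z, S.Q_symm z (S.A X y)] at h4
  rw [S.Q_symm (S.A Y z) (S.A X y)] at h1
  rw [S.Q_symm (S.A Y y) (S.A X z)] at h2
  rw [S.Q_symm z (S.A X y)] at h6
  linear_combination h - h1 - h2 + h3 + h4 - S.a X * h5 + S.a Y * h6

/-- Again `compat` for a bracket; the shape operator enters through the rank-one terms of
`A_bracket`. -/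
theorem codazzi {X Y : 𝔤} (hX : S.a X = 0) (hY : S.a Y = 0) (u v : T) :
    S.cubicDeriv X (S.b Y) u v - S.cubicDeriv Y (S.b X) u v +
      (S.Q u (S.w X) * S.Q (S.b Y) v + S.Q v (S.w X) * S.Q (S.b Y) u) -
      (S.Q u (S.w Y) * S.Q (S.b X) v + S.Q v (S.w Y) * S.Q (S.b X) u) = 0 := by
  have h := S.compat (S.bracket X Y) u v
  simp only [S.a_bracket_eq_zero, S.A_bracket, S.b_bracket, map_sub, map_add, map_smul,
    LinearMap.sub_apply, smul_eq_mul, zero_mul] at h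
  have h1 := S.compat X u (S.A Y v)
  have h2 := S.compat X v (S.A Y u)
  have h3 := S.compat Y u (S.A X v)
  have h4 := S.compat Y v (S.A X u)
  rw [hX] at h1 h2
  rw [hY] at h3 h4
  rw [cubicDeriv_apply, cubicDeriv_apply]
  rw [S.C_swap_right (S.b X) v, S.Q_symm (S.A Y u)] at h2
  rw [S.C_swap_right (S.b Y) v] at h4
  rw [S.Q_symm (S.A Y v)] at h1
  linear_combination h - h1 - h2 + h3 + h4

variable {D : 𝔤}

/-- Subtracting a multiple of `D` normalises `a` to zero without changing `b`. -/
theorem exists_section (hDb : S.b D = 0) (hDa : S.a D = 2) :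
    ∃ σ : T →ₗ[ℝ] 𝔤, (∀ v, S.b (σ v) = v) ∧ ∀ v, S.a (σ v) = 0 := by
  obtain ⟨σ₀, hσ₀⟩ := S.b.exists_rightInverse_of_surjective
    (LinearMap.range_eq_top.2 S.b_surjective)
  have hσ₀' : ∀ v, S.b (σ₀ v) = v := fun v => DFunLike.congr_fun hσ₀ v
  refine ⟨σ₀ - (S.a ∘ₗ σ₀).smulRight ((2 : ℝ)⁻¹ • D), fun v => ?_, fun v => ?_⟩
  · simp [hσ₀', hDb]
  · simp [hDa]

/-- The skew part of the grading element. -/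
def skewPart (D : 𝔤) : T →ₗ[ℝ] T := S.A D - LinearMap.id

theorem A_eq_add_skewPart (D : 𝔤) (x : T) : S.A D x = x + S.skewPart D x := by
  simp [skewPart]

/-- The value `a D = 2` is normalised for this: `A D` is conformal with factor 2, so subtracting the
identity leaves a skew map. -/
theorem skewPart_skew (hDb : S.b D = 0) (hDa : S.a D = 2) (u v : T) :
    S.Q (S.skewPart D u) v + S.Q u (S.skewPart D v) = 0 := by
  have h := S.skew hDb u v
  rw [S.A_eq_add_skewPart, S.A_eq_add_skewPart, map_add, map_add, hDa, S.Q_symm v u,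
    S.Q_symm v (S.skewPart D u)] at h
  linarith

theorem C_weight (hDb : S.b D = 0) (hDa : S.a D = 2) (x y z : T) :
    S.C (S.skewPart D x) y z + S.C x (S.skewPart D y) z + S.C x y (S.skewPart D z) =
      -S.C x y z := by
  have h := S.cubicDeriv_eq hDb x y z
  simp only [cubicDeriv_apply, S.A_eq_add_skewPart, map_add, LinearMap.add_apply, hDa] at h
  linarith

/-- The derivative of `C`, corrected by `a`, depends only on the value at the base point; its values
on a section with `a = 0` therefore form a tensor. -/
theorem cubicDeriv_of_b_eq {X Y : 𝔤} (h : S.b X = S.b Y) (x y z : T) :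
    S.cubicDeriv X x y z - S.a X * S.C x y z = S.cubicDeriv Y x y z - S.a Y * S.C x y z := by
  have h1 := S.cubicDeriv_eq (X := X - Y) (by rw [map_sub, h, sub_self]) x y z
  simp only [cubicDeriv_apply, map_sub, LinearMap.sub_apply] at h1 ⊢
  linarith

theorem w_of_b_eq {X Y : 𝔤} (h : S.b X = S.b Y) : S.w X = S.w Y := by
  have h1 := S.w_eq_zero (X := X - Y) (by rw [map_sub, h, sub_self])
  rwa [map_sub, sub_eq_zero] at h1

section Weights

variable {σ : T →ₗ[ℝ] 𝔤}

theorem b_bracket_section (v : T) (hDb : S.b D = 0) (hσb : ∀ v, S.b (σ v) = v) :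
    S.b (S.bracket D (σ v)) = S.b (σ (v + S.skewPart D v)) := by
  rw [S.b_bracket, hσb, hσb, hDb, map_zero, sub_zero, S.A_eq_add_skewPart]

/-- Since `w` depends only on `b`, it can be evaluated on `[D, σ u]` in two ways. -/
theorem w_weight (hDb : S.b D = 0) (hDa : S.a D = 2) (hσb : ∀ v, S.b (σ v) = v) (u v : T) :
    S.Q (S.w (σ (S.skewPart D u))) v + S.Q (S.w (σ u)) (S.skewPart D v) =
      -2 * S.Q (S.w (σ u)) v := by
  have h := S.w_of_b_eq (S.b_bracket_section u hDb hσb)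
  rw [S.w_bracket, S.w_eq_zero hDb, hDa, S.A_eq_add_skewPart] at h
  simp only [map_add, map_zero, smul_zero, zero_add, add_zero] at h
  have h1 := congrArg (fun x => S.Q x v) h
  simp only [map_add, map_sub, map_smul, LinearMap.add_apply, LinearMap.sub_apply,
    LinearMap.smul_apply, smul_eq_mul] at h1
  have h2 := S.skewPart_skew hDb hDa (S.w (σ u)) v
  linarith

/-- One weight -1 comes from `C` itself and another from the bracket of `D` with the section. -/
theorem cubicDeriv_weight (hDb : S.b D = 0) (hDa : S.a D = 2) (hσb : ∀ v, S.b (σ v) = v)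
    (hσa : ∀ v, S.a (σ v) = 0) (v x y z : T) :
    S.cubicDeriv (σ (S.skewPart D v)) x y z + S.cubicDeriv (σ v) (S.skewPart D x) y z +
      S.cubicDeriv (σ v) x (S.skewPart D y) z + S.cubicDeriv (σ v) x y (S.skewPart D z) =
      -2 * S.cubicDeriv (σ v) x y z := by
  have h := S.cubicDeriv_of_b_eq (S.b_bracket_section v hDb hσb) x y z
  rw [S.a_bracket_eq_zero, hσa, zero_mul, sub_zero, sub_zero] at h
  have hA : ∀ x, S.A (S.bracket D (σ v)) x =
      S.skewPart D (S.A (σ v) x) - S.A (σ v) (S.skewPart D x) := fun x => by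
    rw [S.A_bracket, hDb, S.w_eq_zero hDb, S.A_eq_add_skewPart D, S.A_eq_add_skewPart D]
    simp
  rw [map_add, map_add] at h
  simp only [LinearMap.add_apply] at h
  rw [cubicDeriv_apply] at h
  simp only [hA, map_sub, LinearMap.sub_apply] at h
  have h1 := S.C_weight hDb hDa (S.A (σ v) x) y z
  have h2 := S.C_weight hDb hDa x (S.A (σ v) y) z
  have h3 := S.C_weight hDb hDa x y (S.A (σ v) z)
  simp only [cubicDeriv_apply S (σ v)] at h ⊢
  linear_combination -h + h1 + h2 + h3

end Weights

end SymmetryModel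

/-- The components of a weight tensor vanish unless the weight matches. -/
theorem weight_tensor_eq_zero {ι κ : Type*} [Fintype ι] [DecidableEq ι] [Fintype κ]
    [DecidableEq κ] (t : (κ → ι) → ℝ) (w : ι → ℝ) (R : ι → ι → ℝ) (c : ℝ)
    (hR : ∀ i j, R i j = -R j i) (hw : ∀ i j, R i j ≠ 0 → w i = w j)
    (ht : ∀ i, ∑ k, (w (i k) * t i + ∑ j, R j (i k) * t (Function.update i k j)) = c * t i)
    (i : κ → ι) : (c - ∑ k, w (i k)) * t i = 0 := by
  set W : (κ → ι) → ℝ := fun i => ∑ k, w (i k) with hW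
  -- The right-hand side is the infinitesimal rotation of the tensor. It preserves total weight and
  -- is antisymmetric for the Euclidean product of the component arrays, so pairing with `(c - W) t`
  -- gives zero.
  have hrel : ∀ i, (c - W i) * t i = ∑ k, ∑ j, R j (i k) * t (Function.update i k j) := by
    intro i
    have h := ht i
    rw [Finset.sum_add_distrib, ← Finset.sum_mul] at h
    rw [sub_mul, ← h]
    ring
  have hWu : ∀ i k j, R j (i k) ≠ 0 → W (Function.update i k j) = W i := by
    intro i k j h
    refine Finset.sum_congr rfl fun l _ => ?_
    by_cases hl : l = k
    · subst hl; rw [Function.update_self]; exact hw _ _ h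
    · rw [Function.update_of_ne hl]
  have hzero : ∑ i, ((c - W i) * t i) ^ 2 = 0 := by
    have h1 : ∀ k, ∑ x : (κ → ι) × ι, (c - W x.1) * t x.1 *
        (R x.2 (x.1 k) * t (Function.update x.1 k x.2)) = 0 := by
      intro k
      -- Exchanging the old and the new value of the `k`-th index reverses the sign of each summand.
      let φ : (κ → ι) × ι ≃ (κ → ι) × ι := Function.Involutive.toPerm
        (fun x => (Function.update x.1 k x.2, x.1 k)) (by
          intro x
          simp)
      have h2 := Equiv.sum_comp φ (fun x : (κ → ι) × ι => (c - W x.1) * t x.1 *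
        (R x.2 (x.1 k) * t (Function.update x.1 k x.2)))
      have h3 : ∀ x : (κ → ι) × ι, (c - W (φ x).1) * t (φ x).1 *
          (R (φ x).2 ((φ x).1 k) * t (Function.update (φ x).1 k (φ x).2)) =
          -((c - W x.1) * t x.1 * (R x.2 (x.1 k) * t (Function.update x.1 k x.2))) := by
        intro x
        change (c - W (Function.update x.1 k x.2)) * t (Function.update x.1 k x.2) *
          (R (x.1 k) (Function.update x.1 k x.2 k) *
            t (Function.update (Function.update x.1 k x.2) k (x.1 k))) = _
        rw [Function.update_self, Function.update_idem, Function.update_eq_self, hR]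
        by_cases h0 : R x.2 (x.1 k) = 0
        · rw [h0]; ring
        · rw [hWu _ _ _ h0]; ring
      rw [Finset.sum_congr rfl fun x _ => h3 x, Finset.sum_neg_distrib] at h2
      linarith
    calc ∑ i, ((c - W i) * t i) ^ 2
        = ∑ i, ∑ k, ∑ j, (c - W i) * t i * (R j (i k) * t (Function.update i k j)) := by
          refine Finset.sum_congr rfl fun i _ => ?_
          rw [sq]
          nth_rewrite 2 [hrel]
          simp_rw [Finset.mul_sum]
      _ = ∑ k, ∑ x : (κ → ι) × ι, (c - W x.1) * t x.1 *
          (R x.2 (x.1 k) * t (Function.update x.1 k x.2)) := by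
          rw [Finset.sum_comm]
          refine Finset.sum_congr rfl fun k _ => ?_
          rw [Fintype.sum_prod_type]
      _ = 0 := Finset.sum_eq_zero fun k _ => h1 k
  have h4 := (Finset.sum_eq_zero_iff_of_nonneg fun i _ => sq_nonneg _).1 hzero i
    (Finset.mem_univ i)
  exact pow_eq_zero_iff (two_ne_zero) |>.1 h4

end AffineTube

namespace AffineTube

/-! ### Skew endomorphisms in Lorentzian signature: null eigenvectors and Witt bases. -/

theorem exists_eigenvector_of_mapsTo {M : Type*} [AddCommGroup M] [Module ℂ M]
    [FiniteDimensional ℂ M] (E : Submodule ℂ M) (hE : E ≠ ⊥) (L : M →ₗ[ℂ] M)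
    (hL : ∀ v ∈ E, L v ∈ E) : ∃ (c : ℂ) (v : M), v ∈ E ∧ v ≠ 0 ∧ L v = c • v := by
  have : Nontrivial E := (Submodule.nontrivial_iff_ne_bot).2 hE
  obtain ⟨c, hc⟩ := Module.End.exists_eigenvalue (L.restrict hL)
  obtain ⟨v, hv⟩ := hc.exists_hasEigenvector
  refine ⟨c, v, v.2, fun h => hv.2 (Subtype.ext h), ?_⟩
  exact congrArg Subtype.val hv.apply_eq_smul

/-- Three commuting operators have a common eigenvector in an eigenspace of their sum. -/
theorem exists_common_eigenvector {M : Type*} [AddCommGroup M] [Module ℂ M]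
    [FiniteDimensional ℂ M] (L₁ L₂ L₃ : M →ₗ[ℂ] M) (h₁₂ : ∀ v, L₁ (L₂ v) = L₂ (L₁ v))
    (h₁₃ : ∀ v, L₁ (L₃ v) = L₃ (L₁ v)) (h₂₃ : ∀ v, L₂ (L₃ v) = L₃ (L₂ v)) {c : ℂ} {v : M}
    (hv : v ≠ 0) (hc : L₁ v + L₂ v + L₃ v = c • v) :
    ∃ (c₁ c₂ c₃ : ℂ) (v : M), v ≠ 0 ∧ L₁ v = c₁ • v ∧ L₂ v = c₂ • v ∧ L₃ v = c₃ • v ∧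
      c₁ + c₂ + c₃ = c := by
  -- Restrict successively to the eigenspace of the sum, then of `L₁`, then of `L₂`; each is
  -- invariant under the remaining operators.
  let E₀ := LinearMap.ker (L₁ + L₂ + L₃ - c • LinearMap.id)
  have hE₀ : ∀ v, v ∈ E₀ ↔ L₁ v + L₂ v + L₃ v = c • v := fun v => by
    rw [LinearMap.mem_ker, ← sub_eq_zero (a := _ + _)]; rfl
  have key : ∀ (L L' : M →ₗ[ℂ] M) (a : ℂ) (E : Submodule ℂ M), (∀ v, L (L' v) = L' (L v)) →
      (∀ v ∈ E, L' v ∈ E) → ∀ v ∈ E ⊓ LinearMap.ker (L - a • LinearMap.id),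
        L' v ∈ E ⊓ LinearMap.ker (L - a • LinearMap.id) := by
    intro L L' a E hLL hE v hv
    refine ⟨hE v hv.1, ?_⟩
    have h := hv.2
    simp only [LinearMap.mem_ker, LinearMap.sub_apply, LinearMap.smul_apply, LinearMap.id_apply,
      sub_eq_zero, SetLike.mem_coe] at h ⊢
    rw [hLL, h, map_smul]
  obtain ⟨c₁, v₁, hv₁, hv₁0, hc₁⟩ := exists_eigenvector_of_mapsTo E₀
    (fun h => hv ((Submodule.mem_bot ℂ).1 (h ▸ (hE₀ v).2 hc))) L₁ (fun u hu => by
      rw [hE₀] at hu ⊢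
      rw [← h₁₂, ← h₁₃, ← map_add, ← map_add, hu, map_smul])
  have h2 : ∀ u ∈ E₀, L₂ u ∈ E₀ := fun u hu => by
    rw [hE₀] at hu ⊢
    rw [h₁₂, ← h₂₃, ← map_add, ← map_add, hu, map_smul]
  have h3 : ∀ u ∈ E₀, L₃ u ∈ E₀ := fun u hu => by
    rw [hE₀] at hu ⊢
    rw [h₁₃, h₂₃, ← map_add, ← map_add, hu, map_smul]
  have hm₁ : v₁ ∈ E₀ ⊓ LinearMap.ker (L₁ - c₁ • LinearMap.id) := ⟨hv₁, by simp [hc₁]⟩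
  obtain ⟨c₂, v₂, hv₂, hv₂0, hc₂⟩ := exists_eigenvector_of_mapsTo _
    (fun h => hv₁0 ((Submodule.mem_bot ℂ).1 (h ▸ hm₁))) L₂ (key L₁ L₂ c₁ E₀ h₁₂ h2)
  have hm₂ : v₂ ∈ (E₀ ⊓ LinearMap.ker (L₁ - c₁ • LinearMap.id)) ⊓
      LinearMap.ker (L₂ - c₂ • LinearMap.id) := ⟨hv₂, by simp [hc₂]⟩
  obtain ⟨c₃, v₃, hv₃, hv₃0, hc₃⟩ := exists_eigenvector_of_mapsTo _
    (fun h => hv₂0 ((Submodule.mem_bot ℂ).1 (h ▸ hm₂))) L₃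
    (key L₂ L₃ c₂ _ h₂₃ (key L₁ L₃ c₁ E₀ h₁₃ h3))
  have e1 : L₁ v₃ = c₁ • v₃ := by
    have h := hv₃.1.2
    simpa [sub_eq_zero] using h
  have e2 : L₂ v₃ = c₂ • v₃ := by
    have h := hv₃.2
    simpa [sub_eq_zero] using h
  refine ⟨c₁, c₂, c₃, v₃, hv₃0, e1, e2, hc₃, ?_⟩
  have h := (hE₀ v₃).1 hv₃.1.1
  rw [e1, e2, hc₃, ← add_smul, ← add_smul] at h
  exact smul_left_injective ℂ hv₃0 h

section

variable {T : Type*} [AddCommGroup T] [Module ℝ T] [FiniteDimensional ℝ T]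

/-- If a nonzero real trilinear form is an eigenvector of negative weight for a derivation, the
derivation has a complex eigenfunctional with eigenvalue off the imaginary axis. -/
theorem exists_eigenfunctional (s : T →ₗ[ℝ] T) (C : T →ₗ[ℝ] T →ₗ[ℝ] T →ₗ[ℝ] ℝ) (hC : C ≠ 0)
    (hs : ∀ x y z, C (s x) y z + C x (s y) z + C x y (s z) = -C x y z) :
    ∃ (c : ℂ) (f : T →ₗ[ℝ] ℂ), f ≠ 0 ∧ c.re ≠ 0 ∧ ∀ x, f (s x) = c * f x := by
  let M := T →ₗ[ℝ] T →ₗ[ℝ] T →ₗ[ℝ] ℂ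
  have : FiniteDimensional ℝ M := inferInstance
  have : FiniteDimensional ℂ M := Module.Finite.of_restrictScalars_finite ℝ ℂ M
  -- Composition with `s` in each of the three slots gives commuting operators whose sum acts on the
  -- complexified `C` by -1.
  let L₁ : M →ₗ[ℂ] M :=
    { toFun := fun B => B ∘ₗ s
      map_add' := fun _ _ => rfl
      map_smul' := fun _ _ => rfl }
  let L₂ : M →ₗ[ℂ] M :=
    { toFun := fun B => LinearMap.lcomp ℝ _ s ∘ₗ B
      map_add' := fun _ _ => rfl
      map_smul' := fun _ _ => rfl }
  let L₃ : M →ₗ[ℂ] M :=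
    { toFun := fun B => LinearMap.llcomp ℝ T _ _ (LinearMap.lcomp ℝ _ s) ∘ₗ B
      map_add' := fun _ _ => rfl
      map_smul' := fun _ _ => rfl }
  let C' : M := (LinearMap.llcomp ℝ T _ _ (LinearMap.llcomp ℝ T _ _ Complex.ofRealCLM.toLinearMap)) ∘ₗ C
  have hC'a : ∀ x y z, C' x y z = (C x y z : ℂ) := fun _ _ _ => rfl
  have hC' : C' ≠ 0 := by
    intro h
    refine hC (LinearMap.ext fun x => LinearMap.ext fun y => LinearMap.ext fun z => ?_)
    have h1 : C' x y z = 0 := by rw [h]; rfl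
    rw [hC'a] at h1
    exact_mod_cast h1
  have hsum : L₁ C' + L₂ C' + L₃ C' = (-1 : ℂ) • C' := by
    refine LinearMap.ext fun x => LinearMap.ext fun y => LinearMap.ext fun z => ?_
    change (C (s x) y z : ℂ) + C x (s y) z + C x y (s z) = -1 * (C x y z : ℂ)
    rw [neg_one_mul, ← Complex.ofReal_neg, ← hs]
    push_cast
    rfl
  obtain ⟨c₁, c₂, c₃, B, hB, h1, h2, h3, hc⟩ := exists_common_eigenvector (M := M) L₁ L₂ L₃
    (fun _ => rfl) (fun _ => rfl) (fun _ => rfl) (c := -1) (v := C') hC' hsum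
  have h1' : ∀ x y z, B (s x) y z = c₁ * B x y z := fun x y z =>
    congrArg (fun F : M => F x y z) h1
  have h2' : ∀ x y z, B x (s y) z = c₂ * B x y z := fun x y z =>
    congrArg (fun F : M => F x y z) h2
  have h3' : ∀ x y z, B x y (s z) = c₃ * B x y z := fun x y z =>
    congrArg (fun F : M => F x y z) h3
  obtain ⟨x, y, z, hxyz⟩ : ∃ x y z, B x y z ≠ 0 := by
    by_contra hcon
    push Not at hcon
    exact hB (LinearMap.ext fun x => LinearMap.ext fun y => LinearMap.ext fun z => hcon x y z)
  -- Some slot has an eigenvalue with nonzero real part; freezing the other two arguments gives the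
  -- functional.
  have hre : c₁.re + c₂.re + c₃.re = -1 := by
    have := congrArg Complex.re hc
    simpa using this
  by_cases hc1 : c₁.re = 0
  · by_cases hc2 : c₂.re = 0
    · refine ⟨c₃, B x y, fun h => hxyz (by rw [h]; rfl), by intro h; linarith, h3' x y⟩
    · exact ⟨c₂, (B x).flip z, fun h => hxyz (by rw [← LinearMap.flip_apply, h]; rfl), hc2,
        fun y => h2' x y z⟩
  · exact ⟨c₁, (B.flip y).flip z, fun h => hxyz (by
      have := DFunLike.congr_fun h x; simpa using this), hc1, fun x => h1' x y z⟩

variable (Q : T →ₗ[ℝ] T →ₗ[ℝ] ℝ)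

/-- Two orthogonal nonzero vectors which are not spacelike are proportional. -/
def IsHyperbolic : Prop :=
  ∀ x y, Q x x ≤ 0 → Q y y ≤ 0 → Q x y = 0 → x ≠ 0 → ∃ r : ℝ, y = r • x

/-- The combination of `x` and `y` without timelike component has nonpositive square, but `Q` is
positive definite on vectors without that component. -/
theorem isHyperbolic_of_basis (hs : ∀ u v, Q u v = Q v u) {n : ℕ}
    (B : Module.Basis (Fin (n + 1)) ℝ T) (hB : ∀ i j : Fin (n + 1), Q (B i) (B j) =
      if i = j then (if (i : ℕ) = 0 then -1 else 1) else 0) : IsHyperbolic Q := by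
  have hQ : ∀ x, Q x x = -(B.repr x 0) ^ 2 + ∑ i : Fin n, (B.repr x i.succ) ^ 2 := by
    intro x
    have h1 : Q x x = ∑ i : Fin (n + 1), (if (i : ℕ) = 0 then (-1 : ℝ) else 1) * (B.repr x i) ^ 2 := by
      conv_lhs => rw [← B.sum_repr x]
      simp only [map_sum, LinearMap.sum_apply, map_smul, LinearMap.smul_apply, hB, smul_eq_mul]
      refine Finset.sum_congr rfl fun i _ => ?_
      simp only [mul_ite, mul_zero, Finset.sum_ite_eq', Finset.mem_univ, if_true]
      split_ifs <;> ring
    rw [h1, Fin.sum_univ_succ]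
    simp
  have hz : ∀ z, B.repr z 0 = 0 → Q z z ≤ 0 → z = 0 := by
    intro z h0 hzz
    rw [hQ, h0] at hzz
    have h1 : ∑ i : Fin n, (B.repr z i.succ) ^ 2 = 0 :=
      le_antisymm (by linarith) (Finset.sum_nonneg fun i _ => sq_nonneg _)
    rw [Finset.sum_eq_zero_iff_of_nonneg fun i _ => sq_nonneg _] at h1
    refine B.ext_elem fun i => ?_
    rw [map_zero, Finsupp.zero_apply]
    refine Fin.cases h0 (fun j => ?_) i
    exact pow_eq_zero_iff (two_ne_zero) |>.1 (h1 j (Finset.mem_univ j))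
  intro x y hx hy hxy hx0
  have hx0' : B.repr x 0 ≠ 0 := fun h => hx0 (hz x h hx)
  have h1 : B.repr y 0 • x - B.repr x 0 • y = 0 := by
    refine hz _ (by simp [mul_comm]) ?_
    simp only [map_sub, map_smul, LinearMap.sub_apply, LinearMap.smul_apply, smul_eq_mul, hxy,
      hs y x]
    nlinarith [mul_nonneg (sq_nonneg (B.repr y 0)) (neg_nonneg.2 hx),
      mul_nonneg (sq_nonneg (B.repr x 0)) (neg_nonneg.2 hy)]
  refine ⟨(B.repr x 0)⁻¹ * B.repr y 0, ?_⟩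
  rw [sub_eq_zero] at h1
  rw [mul_smul, h1, smul_smul, inv_mul_cancel₀ hx0', one_smul]

variable {Q}

/-- For a skew map the complex bilinear square and the Hermitian square of `x + iy` both vanish once
the eigenvalue has nonzero real part. -/
theorem null_of_complex_eigenvector (hs : ∀ u v, Q u v = Q v u) {s : T →ₗ[ℝ] T}
    (hskew : ∀ u v, Q (s u) v + Q u (s v) = 0) {x y : T} {a b : ℝ} (ha : a ≠ 0)
    (hx : s x = a • x - b • y) (hy : s y = b • x + a • y) :
    Q x x = 0 ∧ Q y y = 0 ∧ Q x y = 0 := by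
  have h1 := hskew x x
  have h2 := hskew y y
  have h3 := hskew x y
  simp only [hx, hy, map_add, map_sub, map_smul, LinearMap.add_apply, LinearMap.sub_apply,
    LinearMap.smul_apply, smul_eq_mul, hs y x] at h1 h2 h3
  have h4 : Q x x = -Q y y := by
    have : a * (Q x x + Q y y) = 0 := by linarith
    have := (mul_eq_zero.1 this).resolve_left ha
    linarith
  have h5 : Q x y = 0 := by
    have : (a ^ 2 + b ^ 2) * Q x y = 0 := by
      linear_combination (a / 2) * h3 + (b / 2) * h2 + (-(a * b) / 2) * h4
    exact (mul_eq_zero.1 this).resolve_left (by positivity)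
  have h6 : Q x x = 0 := by
    rw [h5] at h1
    have : a * Q x x = 0 := by linarith
    exact (mul_eq_zero.1 this).resolve_left ha
  exact ⟨h6, by linarith, h5⟩

/-- The duals of the real and imaginary parts of `f` are null and mutually orthogonal. Lorentzian
signature makes them proportional, so one of them is a real eigenvector. -/
theorem exists_real_eigenvector (hs : ∀ u v, Q u v = Q v u) (hQ : ∀ u, (∀ v, Q u v = 0) → u = 0)
    (hyp : IsHyperbolic Q) {s : T →ₗ[ℝ] T} (hskew : ∀ u v, Q (s u) v + Q u (s v) = 0)
    {c : ℂ} {f : T →ₗ[ℝ] ℂ} (hf : f ≠ 0) (hc : c.re ≠ 0) (hfs : ∀ x, f (s x) = c * f x) :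
    ∃ (σ : ℝ) (e : T), σ ≠ 0 ∧ e ≠ 0 ∧ s e = σ • e := by
  set x := (dualEquiv Q hQ).symm (Complex.reLm ∘ₗ f) with hxd
  set y := (dualEquiv Q hQ).symm (Complex.imLm ∘ₗ f) with hyd
  have hxf : ∀ v, Q x v = (f v).re := fun v => dualEquiv_symm_apply Q hQ _ v
  have hyf : ∀ v, Q y v = (f v).im := fun v => dualEquiv_symm_apply Q hQ _ v
  have hsx : s x = (-c.re) • x - (-c.im) • y := by
    rw [← sub_eq_zero]
    refine hQ _ fun v => ?_
    have h1 := hskew x v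
    rw [hxf (s v), hfs, Complex.mul_re] at h1
    simp only [map_sub, map_smul, LinearMap.sub_apply, LinearMap.smul_apply, smul_eq_mul, hxf, hyf]
    linarith
  have hsy : s y = (-c.im) • x + (-c.re) • y := by
    rw [← sub_eq_zero]
    refine hQ _ fun v => ?_
    have h1 := hskew y v
    rw [hyf (s v), hfs, Complex.mul_im] at h1
    simp only [map_sub, map_add, map_smul, LinearMap.sub_apply, LinearMap.add_apply,
      LinearMap.smul_apply, smul_eq_mul, hxf, hyf]
    linarith
  have ha : -c.re ≠ 0 := neg_ne_zero.2 hc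
  obtain ⟨hxx, hyy, hxy⟩ := null_of_complex_eigenvector hs hskew ha hsx hsy
  by_cases hx0 : x = 0
  · refine ⟨-c.re, y, ha, ?_, ?_⟩
    · intro hy0
      refine hf (LinearMap.ext fun v => Complex.ext ?_ ?_)
      · rw [← hxf, hx0]; simp
      · rw [← hyf, hy0]; simp
    · rw [hsy, hx0]; simp
  · obtain ⟨r, hr⟩ := hyp x y hxx.le hyy.le hxy hx0
    refine ⟨-c.re - -c.im * r, x, ?_, hx0, ?_⟩
    · intro h0
      have h1 : s y = r • s x := by rw [hr, map_smul]
      rw [hsy, hsx, hr] at h1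
      have h2 : (-c.im + (-c.re) * r - r * (-c.re - -c.im * r)) • x = 0 := by
        rw [← sub_eq_zero] at h1
        rw [← h1]
        module
      have h3 := (smul_eq_zero.1 h2).resolve_right hx0
      rw [h0] at h3
      have h4 : c.re * (1 + r ^ 2) = 0 := by linear_combination -h0 - r * h3
      exact (mul_ne_zero hc (by positivity)) h4
    · rw [hsx, hr]; module

/-- A skew endomorphism with a nonzero real eigenvalue has a hyperbolic pair of eigenvectors. -/
theorem exists_hyperbolic_pair (hs : ∀ u v, Q u v = Q v u)
    (hQ : ∀ u, (∀ v, Q u v = 0) → u = 0) (hyp : IsHyperbolic Q) {s : T →ₗ[ℝ] T}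
    (hskew : ∀ u v, Q (s u) v + Q u (s v) = 0) {σ : ℝ} {e : T} (hσ : σ ≠ 0) (he : e ≠ 0)
    (hse : s e = σ • e) : ∃ (σ : ℝ) (e f : T), σ < 0 ∧ Q e e = 0 ∧ Q f f = 0 ∧ Q e f = 1 ∧
      s e = σ • e ∧ s f = -σ • f := by
  have hnull : ∀ (τ : ℝ) (v : T), τ ≠ 0 → s v = τ • v → Q v v = 0 := by
    intro τ v hτ hv
    have h := hskew v v
    rw [hv, map_smul, map_smul, LinearMap.smul_apply, smul_eq_mul] at h
    have : τ * Q v v = 0 := by linarith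
    exact (mul_eq_zero.1 this).resolve_left hτ
  -- If `-σ` were not an eigenvalue, `s + σ` would be onto. By skewness `e` is orthogonal to its
  -- range, hence would be zero.
  obtain ⟨f, hf0, hsf⟩ : ∃ f, f ≠ 0 ∧ s f = -σ • f := by
    by_contra hcon
    push Not at hcon
    have hinj : Function.Injective (s + σ • (LinearMap.id : T →ₗ[ℝ] T)) := by
      refine (injective_iff_map_eq_zero _).2 fun v hv => ?_
      by_contra hv0
      refine hcon v hv0 ?_
      simp only [LinearMap.add_apply, LinearMap.smul_apply, LinearMap.id_apply] at hv
      rw [neg_smul]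
      exact eq_neg_of_add_eq_zero_left hv
    have hsurj := LinearMap.injective_iff_surjective.1 hinj
    refine he (hQ e fun v => ?_)
    obtain ⟨u, rfl⟩ := hsurj v
    have h := hskew e u
    rw [hse, map_smul, LinearMap.smul_apply] at h
    simp only [LinearMap.add_apply, LinearMap.smul_apply, LinearMap.id_apply, map_add, map_smul]
    linarith
  have hee := hnull σ e hσ hse
  have hff := hnull (-σ) f (neg_ne_zero.2 hσ) hsf
  have hef : Q e f ≠ 0 := by
    intro h
    obtain ⟨r, hr⟩ := hyp e f hee.le hff.le h he
    have h1 : s f = r • s e := by rw [hr, map_smul]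
    rw [hsf, hse, hr] at h1
    have h2 : (-(2 * σ * r)) • e = 0 := by
      rw [← sub_eq_zero] at h1
      rw [← h1]
      module
    have h3 := (smul_eq_zero.1 h2).resolve_right he
    have hr0 : r = 0 := by
      rw [neg_eq_zero, mul_eq_zero] at h3
      exact h3.resolve_left (by simpa using hσ)
    exact hf0 (by rw [hr, hr0, zero_smul])
  -- The roles of `e` and `f` are exchanged if necessary, to make the eigenvalue of the first vector
  -- negative.
  rcases lt_or_gt_of_ne hσ with h | h
  · refine ⟨σ, e, (Q e f)⁻¹ • f, h, hee, by simp [hff], ?_, hse, ?_⟩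
    · rw [map_smul, smul_eq_mul, inv_mul_cancel₀ hef]
    · rw [map_smul, hsf, smul_comm]
  · refine ⟨-σ, f, (Q e f)⁻¹ • e, by linarith, hff, by simp [hee], ?_, hsf, ?_⟩
    · rw [map_smul, hs f e, smul_eq_mul, inv_mul_cancel₀ hef]
    · rw [map_smul, hse, smul_comm, neg_neg]

theorem exists_orthonormal_diagonalizing (hs : ∀ u v, Q u v = Q v u)
    (hpos : ∀ u, u ≠ 0 → 0 < Q u u) (q : T →ₗ[ℝ] T →ₗ[ℝ] ℝ) (hq : ∀ u v, q u v = q v u) :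
    ∃ B : Module.Basis (Fin (Module.finrank ℝ T)) ℝ T,
      (∀ i j, Q (B i) (B j) = if i = j then 1 else 0) ∧ ∀ i j, i ≠ j → q (B i) (B j) = 0 := by
  have hQ : ∀ u, (∀ v, Q u v = 0) → u = 0 := by
    intro u hu
    by_contra h
    exact (hpos u h).ne' (hu u)
  let core : InnerProductSpace.Core ℝ T :=
    { inner := fun x y => Q x y
      conj_inner_symm := fun x y => hs y x
      re_inner_nonneg := fun x => by
        by_cases h : x = 0
        · rw [h]; simp
        · exact (hpos x h).le
      add_left := fun x y z => by simp
      smul_left := fun x y r => by simp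
      definite := fun x hx => by
        by_contra h
        exact (hpos x h).ne' hx }
  let _ : NormedAddCommGroup T := core.toNormedAddCommGroup
  let _ : InnerProductSpace ℝ T := InnerProductSpace.ofCore core.toCore
  have hinner : ∀ x y : T, inner ℝ x y = Q x y := fun _ _ => rfl
  let A : T →ₗ[ℝ] T := (dualEquiv Q hQ).symm.toLinearMap ∘ₗ q
  have hA : ∀ x y, Q (A x) y = q x y := fun x y => dualEquiv_symm_apply Q hQ _ y
  have hsym : A.IsSymmetric := by
    intro x y
    rw [hinner, hinner, hA, hs, hA, hq]
  let B := hsym.eigenvectorBasis rfl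
  have hB : ∀ i j, Q (B i) (B j) = if i = j then 1 else 0 := fun i j => by
    rw [← hinner]
    exact orthonormal_iff_ite.1 B.orthonormal i j
  refine ⟨B.toBasis, fun i j => ?_, fun i j hij => ?_⟩
  · rw [OrthonormalBasis.coe_toBasis]; exact hB i j
  · rw [OrthonormalBasis.coe_toBasis, ← hA, hsym.apply_eigenvectorBasis rfl i]
    simp only [map_smul, LinearMap.smul_apply]
    have := hB i j
    rw [if_neg hij] at this
    change _ • Q (B i) (B j) = 0
    rw [this, smul_zero]

/-- A basis consisting of a hyperbolic pair and an orthonormal basis of its complement. -/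
structure WittBasis (Q : T →ₗ[ℝ] T →ₗ[ℝ] ℝ) (d : ℕ) where
  e : T
  f : T
  E : Fin d → T
  ee : Q e e = 0
  ff : Q f f = 0
  ef : Q e f = 1
  eE : ∀ i, Q e (E i) = 0
  fE : ∀ i, Q f (E i) = 0
  EE : ∀ i j, Q (E i) (E j) = if i = j then 1 else 0
  decomp : ∀ x, x = Q x f • e + Q x e • f + ∑ i, Q x (E i) • E i

theorem exists_wittBasis (hs : ∀ u v, Q u v = Q v u) (hyp : IsHyperbolic Q) {d : ℕ}
    (hd : Module.finrank ℝ T = d + 2) (q : T →ₗ[ℝ] T →ₗ[ℝ] ℝ) (hq : ∀ u v, q u v = q v u)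
    {e f : T} (hee : Q e e = 0) (hff : Q f f = 0) (hef : Q e f = 1) :
    ∃ w : WittBasis Q d, w.e = e ∧ w.f = f ∧ ∀ i j, i ≠ j → q (w.E i) (w.E j) = 0 := by
  have he0 : e ≠ 0 := by
    rintro rfl
    simp at hef
  have hfe : Q f e = 1 := by rw [hs, hef]
  let p : T →ₗ[ℝ] ℝ × ℝ := (Q.flip f).prod (Q.flip e)
  have hp : ∀ x, p x = (Q x f, Q x e) := fun _ => rfl
  have hpsurj : LinearMap.range p = ⊤ := by
    refine LinearMap.range_eq_top.2 fun x => ⟨x.1 • e + x.2 • f, ?_⟩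
    rw [hp]
    simp [hee, hff, hef, hfe]
  let W := LinearMap.ker p
  have hW : ∀ x : W, Q x f = 0 ∧ Q x e = 0 := fun x => by
    have h : p x = 0 := x.2
    rw [hp, Prod.mk_eq_zero] at h
    exact h
  have hrn := LinearMap.finrank_range_add_finrank_ker p
  rw [hpsurj, finrank_top, Module.finrank_prod, Module.finrank_self, hd] at hrn
  have hfW : Module.finrank ℝ W = d := by
    change Module.finrank ℝ (LinearMap.ker p) = d
    omega
  let QW : W →ₗ[ℝ] W →ₗ[ℝ] ℝ := Q.domRestrict₁₂ W W
  let qW : W →ₗ[ℝ] W →ₗ[ℝ] ℝ := q.domRestrict₁₂ W W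
  -- The complement of the pair is positive definite: a vector of nonpositive square orthogonal to
  -- the null vector `e` is a multiple of `e`, and orthogonality to `f` kills it. The spectral
  -- theorem then applies.
  obtain ⟨B, hB, hBq⟩ := exists_orthonormal_diagonalizing (Q := QW) (fun u v => hs u v)
    (fun u hu => by
      by_contra hcon
      push Not at hcon
      obtain ⟨r, hr⟩ := hyp e u hee.le hcon (by rw [hs]; exact (hW u).2) he0
      have h1 := (hW u).1
      rw [hr, map_smul, LinearMap.smul_apply, hef, smul_eq_mul, mul_one] at h1
      rw [h1, zero_smul] at hr
      exact hu (Subtype.ext hr)) qW (fun u v => hq u v)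
  have heE : ∀ x : W, Q e x = 0 := fun x => by rw [hs]; exact (hW x).2
  have hfE : ∀ x : W, Q f x = 0 := fun x => by rw [hs]; exact (hW x).1
  let E : Fin d → T := fun i => B (Fin.cast hfW.symm i)
  have hEE : ∀ i j, Q (E i) (E j) = if i = j then 1 else 0 := fun i j => by
    have h := hB (Fin.cast hfW.symm i) (Fin.cast hfW.symm j)
    simp only [Fin.cast_inj] at h
    exact h
  have hdec : ∀ y : W, (y : T) = ∑ i, Q y (E i) • E i := by
    intro y
    have h1 : (y : T) = ∑ i, (B.repr y (Fin.cast hfW.symm i)) • E i := by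
      conv_lhs => rw [← B.sum_repr y]
      rw [Submodule.coe_sum]
      exact (Equiv.sum_comp (finCongr hfW.symm) (fun i => ((B.repr y i • B i : W) : T))).symm
    have h2 : ∀ j, Q y (E j) = B.repr y (Fin.cast hfW.symm j) := fun j => by
      rw [h1]
      simp only [map_sum, LinearMap.sum_apply, map_smul, LinearMap.smul_apply, hEE, smul_eq_mul,
        mul_ite, mul_one, mul_zero, Finset.sum_ite_eq', Finset.mem_univ, if_true]
    simp_rw [h2]
    exact h1
  refine ⟨⟨e, f, E, hee, hff, hef, fun i => heE _, fun i => hfE _, hEE, fun x => ?_⟩, rfl, rfl,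
    fun i j hij => hBq _ _ fun h => hij (by simpa using h)⟩
  have hy : x - Q x f • e - Q x e • f ∈ W := by
    rw [LinearMap.mem_ker, hp]
    simp [hee, hff, hef, hfe]
  have h := hdec ⟨_, hy⟩
  simp only [map_sub, map_smul, LinearMap.sub_apply, LinearMap.smul_apply] at h
  have h1 : ∀ i, Q x (E i) - Q x f • Q e (E i) - Q x e • Q f (E i) = Q x (E i) := fun i => by
    have h2 : Q e (E i) = 0 := heE _
    have h3 : Q f (E i) = 0 := hfE _
    rw [h2, h3]; simp
  simp_rw [h1] at h
  rw [← h]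
  abel

end

end AffineTube

namespace AffineTube

/-! ### Models graded by a Witt basis; weights of their tensors. -/

namespace WittBasis

variable {T : Type*} [AddCommGroup T] [Module ℝ T] [FiniteDimensional ℝ T]
  {Q : T →ₗ[ℝ] T →ₗ[ℝ] ℝ} {d : ℕ} (w : WittBasis Q d)

theorem map_eq {M : Type*} [AddCommMonoid M] [Module ℝ M] (φ : T →ₗ[ℝ] M) (x : T) :
    φ x = Q x w.f • φ w.e + Q x w.e • φ w.f + ∑ i, Q x (w.E i) • φ (w.E i) := by
  conv_lhs => rw [w.decomp x]
  simp only [map_add, map_smul, map_sum]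

/-- The vectors of a Witt basis as a single family. -/
def vec : Option (Option (Fin d)) → T
  | none => w.e
  | some none => w.f
  | some (some i) => w.E i

theorem eq_zero_of_vec {M : Type*} [AddCommMonoid M] [Module ℝ M] (φ : T →ₗ[ℝ] M)
    (h : ∀ i, φ (w.vec i) = 0) (x : T) : φ x = 0 := by
  rw [w.map_eq φ x, show φ w.e = 0 from h none, show φ w.f = 0 from h (some none)]
  simp [show ∀ i, φ (w.E i) = 0 from fun i => h (some (some i))]

/-- Reordering of the orthonormal part. -/
def reindex (π : Equiv.Perm (Fin d)) : WittBasis Q d where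
  e := w.e
  f := w.f
  E i := w.E (π i)
  ee := w.ee
  ff := w.ff
  ef := w.ef
  eE i := w.eE _
  fE i := w.fE _
  EE i j := by rw [w.EE]; simp
  decomp x := by
    conv_lhs => rw [w.decomp x]
    rw [Equiv.sum_comp π (fun i => Q x (w.E i) • w.E i)]

end WittBasis

/-- The weights of the vectors of a Witt basis. -/
def wittWeight {d : ℕ} : Option (Option (Fin d)) → ℝ
  | none => 1
  | some none => -1
  | some (some _) => 0

/-- A symmetry model with a grading element and a Witt basis adapted to it. -/
structure GradedModel (𝔤 T : Type*) [AddCommGroup 𝔤] [Module ℝ 𝔤] [AddCommGroup T]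
    [Module ℝ T] [FiniteDimensional ℝ T] (d : ℕ) extends SymmetryModel 𝔤 T where
  D : 𝔤
  b_D : b D = 0
  a_D : a D = 2
  sec : T →ₗ[ℝ] 𝔤
  b_sec : ∀ v, b (sec v) = v
  a_sec : ∀ v, a (sec v) = 0
  wit : WittBasis Q d
  σ : ℝ
  σ_neg : σ < 0
  s_e : toSymmetryModel.skewPart D wit.e = σ • wit.e
  s_f : toSymmetryModel.skewPart D wit.f = -σ • wit.f

namespace GradedModel

variable {𝔤 T : Type*} [AddCommGroup 𝔤] [Module ℝ 𝔤] [AddCommGroup T] [Module ℝ T]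
  [FiniteDimensional ℝ T] {d : ℕ} (G : GradedModel 𝔤 T d)

/-- The skew part of the grading element. -/
abbrev s : T →ₗ[ℝ] T := G.toSymmetryModel.skewPart G.D

theorem s_skew (u v : T) : G.Q (G.s u) v + G.Q u (G.s v) = 0 :=
  G.toSymmetryModel.skewPart_skew G.b_D G.a_D u v

/-- The rotation part of the grading element. -/
def rot : Option (Option (Fin d)) → Option (Option (Fin d)) → ℝ
  | some (some j), some (some i) => G.Q (G.s (G.wit.E i)) (G.wit.E j)
  | _, _ => 0

theorem rot_antisymm (i j) : G.rot i j = -G.rot j i := by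
  rcases i with _ | _ | i <;> rcases j with _ | _ | j <;> simp only [rot, neg_zero]
  have h := G.s_skew (G.wit.E j) (G.wit.E i)
  rw [G.Q_symm (G.wit.E j)] at h
  linarith

theorem weight_eq_of_rot (i j) (h : G.rot i j ≠ 0) :
    G.σ * wittWeight i = G.σ * wittWeight j := by
  rcases i with _ | _ | i <;> rcases j with _ | _ | j <;> simp_all [rot, wittWeight]

/-- By skewness `s` preserves the complement of the pair, where it acts by an antisymmetric matrix.
This is the shape required by `weight_tensor_eq_zero`. -/
theorem s_vec (i) : G.s (G.wit.vec i) =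
    (G.σ * wittWeight i) • G.wit.vec i + ∑ j, G.rot j i • G.wit.vec j := by
  rcases i with _ | _ | i
  · simpa [rot, WittBasis.vec, wittWeight, Fintype.sum_option] using G.s_e
  · simpa [rot, WittBasis.vec, wittWeight, Fintype.sum_option] using G.s_f
  · have h1 := G.s_skew (G.wit.E i) G.wit.f
    have h2 := G.s_skew (G.wit.E i) G.wit.e
    rw [G.s_f, map_smul, G.Q_symm _ G.wit.f, G.Q_symm _ G.wit.f, G.wit.fE] at h1
    rw [G.s_e, map_smul, G.Q_symm _ G.wit.e, G.Q_symm _ G.wit.e, G.wit.eE] at h2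
    rw [smul_zero, add_zero, G.Q_symm] at h1 h2
    have h := G.wit.decomp (G.s (G.wit.E i))
    rw [h1, h2] at h
    simpa [rot, WittBasis.vec, wittWeight, Fintype.sum_option] using h

theorem C_weight (i j k) : (-1 - G.σ * (wittWeight i + wittWeight j + wittWeight k)) *
    G.C (G.wit.vec i) (G.wit.vec j) (G.wit.vec k) = 0 := by
  have h := weight_tensor_eq_zero
    (fun i : Fin 3 → Option (Option (Fin d)) =>
      G.C (G.wit.vec (i 0)) (G.wit.vec (i 1)) (G.wit.vec (i 2)))
    (fun i => G.σ * wittWeight i) G.rot (-1) G.rot_antisymm G.weight_eq_of_rot (fun i => by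
      have h := G.toSymmetryModel.C_weight G.b_D G.a_D (G.wit.vec (i 0)) (G.wit.vec (i 1))
        (G.wit.vec (i 2))
      simp only [G.s_vec, map_add, map_smul, map_sum, LinearMap.add_apply, LinearMap.smul_apply,
        LinearMap.sum_apply, smul_eq_mul] at h
      simp [Fin.sum_univ_three, Function.update, -Fintype.sum_option]
      linarith) ![i, j, k]
  simp only [Fin.sum_univ_three] at h
  have e : ∀ a b c : Option (Option (Fin d)), (![a, b, c] : Fin 3 → _) 2 = c := fun _ _ _ => rfl
  simp only [Matrix.cons_val_zero, Matrix.cons_val_one, e] at h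
  rw [← h]
  ring

theorem w_weight (i j) : (-2 - G.σ * (wittWeight i + wittWeight j)) *
    G.Q (G.w (G.sec (G.wit.vec i))) (G.wit.vec j) = 0 := by
  have h := weight_tensor_eq_zero
    (fun i : Fin 2 → Option (Option (Fin d)) =>
      G.Q (G.w (G.sec (G.wit.vec (i 0)))) (G.wit.vec (i 1)))
    (fun i => G.σ * wittWeight i) G.rot (-2) G.rot_antisymm G.weight_eq_of_rot (fun i => by
      have h := G.toSymmetryModel.w_weight G.b_D G.a_D G.b_sec (G.wit.vec (i 0)) (G.wit.vec (i 1))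
      simp only [G.s_vec, map_add, map_smul, map_sum, LinearMap.add_apply, LinearMap.smul_apply,
        LinearMap.sum_apply, smul_eq_mul] at h
      simp [Fin.sum_univ_two, Function.update, -Fintype.sum_option]
      linarith) ![i, j]
  simp only [Fin.sum_univ_two, Matrix.cons_val_zero, Matrix.cons_val_one] at h
  rw [← h]
  ring

/-- The derivative of the cubic form as a function of the value at the base point. -/
def K (v x y z : T) : ℝ := G.cubicDeriv (G.sec v) x y z

theorem K_weight (i j k l) :
    (-2 - G.σ * (wittWeight i + wittWeight j + wittWeight k + wittWeight l)) *
      G.K (G.wit.vec i) (G.wit.vec j) (G.wit.vec k) (G.wit.vec l) = 0 := by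
  have h := weight_tensor_eq_zero
    (fun i : Fin 4 → Option (Option (Fin d)) => G.K (G.wit.vec (i 0)) (G.wit.vec (i 1))
      (G.wit.vec (i 2)) (G.wit.vec (i 3)))
    (fun i => G.σ * wittWeight i) G.rot (-2) G.rot_antisymm G.weight_eq_of_rot (fun i => by
      have h := G.toSymmetryModel.cubicDeriv_weight G.b_D G.a_D G.b_sec G.a_sec (G.wit.vec (i 0))
        (G.wit.vec (i 1)) (G.wit.vec (i 2)) (G.wit.vec (i 3))
      simp only [G.s_vec, map_add, map_smul, map_sum, LinearMap.add_apply, LinearMap.smul_apply,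
        LinearMap.sum_apply, smul_eq_mul] at h
      simp [Fin.sum_univ_four, Function.update, K, -Fintype.sum_option]
      linarith) ![i, j, k, l]
  simp only [Fin.sum_univ_four] at h
  have e2 : ∀ a b c d' : Option (Option (Fin d)), (![a, b, c, d'] : Fin 4 → _) 2 = c :=
    fun _ _ _ _ => rfl
  have e3 : ∀ a b c d' : Option (Option (Fin d)), (![a, b, c, d'] : Fin 4 → _) 3 = d' :=
    fun _ _ _ _ => rfl
  simp only [Matrix.cons_val_zero, Matrix.cons_val_one, e2, e3] at h
  rw [← h]
  ring

theorem cubicDeriv_eq_K (X : 𝔤) (x y z : T) :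
    G.cubicDeriv X x y z = G.K (G.b X) x y z + G.a X * G.C x y z := by
  have h := G.toSymmetryModel.cubicDeriv_of_b_eq (X := X) (Y := G.sec (G.b X))
    (G.b_sec _).symm x y z
  rw [G.a_sec] at h
  rw [K]
  linarith

theorem w_eq (X : 𝔤) : G.w X = G.w (G.sec (G.b X)) :=
  G.toSymmetryModel.w_of_b_eq (G.b_sec _).symm

theorem K_eq (v x y z : T) : G.K v x y z = G.Q v G.wit.f * G.K G.wit.e x y z +
    G.Q v G.wit.e * G.K G.wit.f x y z + ∑ i, G.Q v (G.wit.E i) * G.K (G.wit.E i) x y z := by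
  simp only [K]
  conv_lhs => rw [G.wit.map_eq G.sec v]
  simp only [map_add, map_smul, map_sum, LinearMap.add_apply, LinearMap.smul_apply,
    LinearMap.sum_apply, smul_eq_mul]

/-- A nonvanishing component of `C` has total weight `-1/σ > 0`, and three weights from `{1, 0, -1}`
can only add up to 1, 2 or 3. -/
theorem σ_cases (hC : G.C ≠ 0) : G.σ = -1 ∨ G.σ = -1 / 2 ∨ G.σ = -1 / 3 := by
  obtain ⟨i, j, k, h⟩ : ∃ i j k, G.C (G.wit.vec i) (G.wit.vec j) (G.wit.vec k) ≠ 0 := by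
    by_contra hcon
    push Not at hcon
    refine hC (LinearMap.ext fun x => ?_)
    refine G.wit.eq_zero_of_vec G.C (fun i => LinearMap.ext fun y => ?_) x
    refine G.wit.eq_zero_of_vec (G.C (G.wit.vec i)) (fun j => LinearMap.ext fun z => ?_) y
    exact G.wit.eq_zero_of_vec _ (fun k => hcon i j k) z
  have h1 := (mul_eq_zero.1 (G.C_weight i j k)).resolve_right h
  have hσ := G.σ_neg
  rcases i with _ | _ | i <;> rcases j with _ | _ | j <;> rcases k with _ | _ | k <;>
    simp only [wittWeight] at h1 <;>
    first
    | (exfalso; linarith)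
    | (left; linarith)
    | (right; left; linarith)
    | (right; right; linarith)

/-- Reordering of the orthonormal part of the Witt basis. -/
def reindex (π : Equiv.Perm (Fin d)) : GradedModel 𝔤 T d where
  toSymmetryModel := G.toSymmetryModel
  D := G.D
  b_D := G.b_D
  a_D := G.a_D
  sec := G.sec
  b_sec := G.b_sec
  a_sec := G.a_sec
  wit := G.wit.reindex π
  σ := G.σ
  σ_neg := G.σ_neg
  s_e := G.s_e
  s_f := G.s_f

end GradedModel

namespace SymmetryModel

variable {𝔤 T : Type*} [AddCommGroup 𝔤] [Module ℝ 𝔤] [AddCommGroup T] [Module ℝ T]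
  [FiniteDimensional ℝ T] (S : SymmetryModel 𝔤 T)

theorem IsLorentzian.isHyperbolic {n : ℕ} (hS : S.IsLorentzian (n + 1)) : IsHyperbolic S.Q := by
  obtain ⟨B, hB⟩ := hS
  exact isHyperbolic_of_basis S.Q S.Q_symm B hB

theorem IsLorentzian.finrank_eq {n : ℕ} (hS : S.IsLorentzian n) : Module.finrank ℝ T = n := by
  obtain ⟨B, hB⟩ := hS
  rw [Module.finrank_eq_card_basis B, Fintype.card_fin]

/-- If the cubic form does not vanish, there is an adapted Witt basis, which moreover
diagonalizes a form depending on the vector of lowest weight. -/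
theorem exists_gradedModel {d : ℕ} (hS : S.IsLorentzian (d + 2)) (hC : S.C ≠ 0) {D : 𝔤}
    (hDb : S.b D = 0) (hDa : S.a D = 2) (q : T → T →ₗ[ℝ] T →ₗ[ℝ] ℝ)
    (hq : ∀ e u v, q e u v = q e v u) :
    ∃ G : GradedModel 𝔤 T d, G.toSymmetryModel = S ∧
      ∀ i j, i ≠ j → q G.wit.e (G.wit.E i) (G.wit.E j) = 0 := by
  obtain ⟨c, φ, hφ, hc, hφs⟩ := exists_eigenfunctional (S.skewPart D) S.C hC
    (S.C_weight hDb hDa)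
  obtain ⟨τ, e₀, hτ, he₀, hse₀⟩ := exists_real_eigenvector S.Q_symm S.Q_nondegenerate
    hS.isHyperbolic (S.skewPart_skew hDb hDa) hφ hc hφs
  obtain ⟨σ, e, f, hσ, hee, hff, hef, hse, hsf⟩ := exists_hyperbolic_pair S.Q_symm
    S.Q_nondegenerate hS.isHyperbolic (S.skewPart_skew hDb hDa) hτ he₀ hse₀
  obtain ⟨w, rfl, rfl, hw⟩ := exists_wittBasis S.Q_symm hS.isHyperbolic hS.finrank_eq (q e) (hq e)
    hee hff hef
  obtain ⟨sec, hsb, hsa⟩ := S.exists_section hDb hDa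
  exact ⟨⟨S, D, hDb, hDa, sec, hsb, hsa, w, σ, hσ, hse, hsf⟩, rfl, hw⟩

end SymmetryModel

end AffineTube

namespace AffineTube

/-! ### Cubic forms of weight three and two, and the vanishing cubic form. -/

namespace GradedModel

variable {𝔤 T : Type*} [AddCommGroup 𝔤] [Module ℝ 𝔤] [AddCommGroup T] [Module ℝ T]
  [FiniteDimensional ℝ T] {d : ℕ} (G : GradedModel 𝔤 T d)

theorem wittWeight_none : wittWeight (none : Option (Option (Fin d))) = 1 := rfl

theorem wittWeight_some_none : wittWeight (some none : Option (Option (Fin d))) = -1 := rfl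

theorem wittWeight_some_some (i : Fin d) : wittWeight (some (some i)) = 0 := rfl

theorem C_vec_eq_zero {m : ℝ} (hm : m ≠ 0) (hσ : G.σ = -1 / m) {i j k}
    (h : wittWeight i + wittWeight j + wittWeight k ≠ m) :
    G.C (G.wit.vec i) (G.wit.vec j) (G.wit.vec k) = 0 := by
  refine (mul_eq_zero.1 (G.C_weight i j k)).resolve_left fun h0 => h ?_
  rw [hσ] at h0
  field_simp at h0
  linarith

theorem w_vec_eq_zero {m : ℝ} (hm : m ≠ 0) (hσ : G.σ = -1 / m) {i j}
    (h : wittWeight i + wittWeight j ≠ 2 * m) :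
    G.Q (G.w (G.sec (G.wit.vec i))) (G.wit.vec j) = 0 := by
  refine (mul_eq_zero.1 (G.w_weight i j)).resolve_left fun h0 => h ?_
  rw [hσ] at h0
  field_simp at h0
  linarith

theorem K_vec_eq_zero {m : ℝ} (hm : m ≠ 0) (hσ : G.σ = -1 / m) {i j k l}
    (h : wittWeight i + wittWeight j + wittWeight k + wittWeight l ≠ 2 * m) :
    G.K (G.wit.vec i) (G.wit.vec j) (G.wit.vec k) (G.wit.vec l) = 0 := by
  refine (mul_eq_zero.1 (G.K_weight i j k l)).resolve_left fun h0 => h ?_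
  rw [hσ] at h0
  field_simp at h0
  linarith

theorem C_rotate (x y z : T) : G.C x y z = G.C y z x := by
  rw [G.C_swap_left, G.C_swap_right]

theorem cubicDeriv_eq (X : 𝔤) (x y z : T) : G.K (G.b X) x y z + G.a X * G.C x y z =
    G.C y z (G.A X x) + G.C x z (G.A X y) + G.C x y (G.A X z) := by
  rw [← G.cubicDeriv_eq_K, SymmetryModel.cubicDeriv_apply, G.C_rotate (G.A X x),
    G.C_swap_right x (G.A X y)]

theorem K_swap_left (v x y z : T) : G.K v x y z = G.K v y x z :=
  G.toSymmetryModel.cubicDeriv_swap_left _ _ _ _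

theorem K_swap_right (v x y z : T) : G.K v x y z = G.K v x z y :=
  G.toSymmetryModel.cubicDeriv_swap_right _ _ _ _

theorem K_codazzi (x y u v : T) : G.K x y u v - G.K y x u v +
      (G.Q u (G.w (G.sec x)) * G.Q y v + G.Q v (G.w (G.sec x)) * G.Q y u) -
      (G.Q u (G.w (G.sec y)) * G.Q x v + G.Q v (G.w (G.sec y)) * G.Q x u) = 0 := by
  have h := G.toSymmetryModel.codazzi (G.a_sec x) (G.a_sec y) u v
  rwa [G.b_sec, G.b_sec] at h

/-- A trilinear form all of whose components except one vanish. -/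
theorem trilinear_eq (B : T →ₗ[ℝ] T →ₗ[ℝ] T →ₗ[ℝ] ℝ)
    (hB : ∀ i j k, (i ≠ none ∨ j ≠ none ∨ k ≠ none) →
      B (G.wit.vec i) (G.wit.vec j) (G.wit.vec k) = 0) (x y z : T) :
    B x y z = B G.wit.e G.wit.e G.wit.e *
      (G.Q x G.wit.f * G.Q y G.wit.f * G.Q z G.wit.f) := by
  have h1 : ∀ i, i ≠ none → B (G.wit.vec i) = 0 := fun i hi => by
    refine LinearMap.ext fun y => ?_
    refine G.wit.eq_zero_of_vec (B (G.wit.vec i)) (fun j => LinearMap.ext fun z => ?_) y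
    exact G.wit.eq_zero_of_vec _ (fun k => hB i j k (Or.inl hi)) z
  have h2 : ∀ j, j ≠ none → B G.wit.e (G.wit.vec j) = 0 := fun j hj => LinearMap.ext fun z =>
    G.wit.eq_zero_of_vec _ (fun k => hB none j k (Or.inr (Or.inl hj))) z
  have h3 : ∀ k, k ≠ none → B G.wit.e G.wit.e (G.wit.vec k) = 0 := fun k hk =>
    hB none none k (Or.inr (Or.inr hk))
  rw [G.wit.map_eq B x, show B G.wit.f = 0 from h1 (some none) (by simp)]
  simp only [show ∀ i, B (G.wit.E i) = 0 from fun i => h1 (some (some i)) (by simp), smul_zero,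
    Finset.sum_const_zero, add_zero, LinearMap.smul_apply]
  rw [G.wit.map_eq (B G.wit.e) y, show B G.wit.e G.wit.f = 0 from h2 (some none) (by simp)]
  simp only [show ∀ i, B G.wit.e (G.wit.E i) = 0 from fun i => h2 (some (some i)) (by simp),
    smul_zero, Finset.sum_const_zero, add_zero, LinearMap.smul_apply]
  rw [G.wit.map_eq (B G.wit.e G.wit.e) z,
    show B G.wit.e G.wit.e G.wit.f = 0 from h3 (some none) (by simp)]
  simp only [show ∀ i, B G.wit.e G.wit.e (G.wit.E i) = 0 from
    fun i => h3 (some (some i)) (by simp), smul_eq_mul, mul_zero, Finset.sum_const_zero, add_zero]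
  ring

/-- Its components need total weight `2m > 2`, but two weights add up to at most 2. -/
theorem w_eq_zero_of_two_le {m : ℝ} (hm : 1 < m) (hσ : G.σ = -1 / m) (X : 𝔤) : G.w X = 0 := by
  have h : ∀ i j : Option (Option (Fin d)), wittWeight i + wittWeight j ≠ 2 * m := by
    intro i j
    rcases i with _ | _ | i <;> rcases j with _ | _ | j <;> simp only [wittWeight] <;>
      intro h <;> linarith
  have h1 : ∀ i, G.w (G.sec (G.wit.vec i)) = 0 := fun i => G.Q_nondegenerate _ fun v =>
    G.wit.eq_zero_of_vec _ (fun j => G.w_vec_eq_zero (by positivity) hσ (h i j)) v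
  rw [G.w_eq]
  exact G.wit.eq_zero_of_vec (G.w ∘ₗ G.sec) h1 _

section WeightThree

theorem C_eq_of_three (hσ : G.σ = -1 / 3) (x y z : T) : G.C x y z = G.C G.wit.e G.wit.e G.wit.e *
      (G.Q x G.wit.f * G.Q y G.wit.f * G.Q z G.wit.f) := by
  refine G.trilinear_eq _ (fun i j k h => G.C_vec_eq_zero (by norm_num) hσ ?_) x y z
  rcases i with _ | _ | i <;> rcases j with _ | _ | j <;> rcases k with _ | _ | k <;>
    simp [wittWeight] at h ⊢ <;> norm_num

/-- Total weight 6 would be needed from four weights at most 1. -/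
theorem K_eq_zero_of_three (hσ : G.σ = -1 / 3) (v x y z : T) : G.K v x y z = 0 := by
  have h : ∀ i j k l : Option (Option (Fin d)),
      wittWeight i + wittWeight j + wittWeight k + wittWeight l ≠ 2 * (3 : ℝ) := by
    have : ∀ i : Option (Option (Fin d)), wittWeight i ≤ 1 := fun i => by
      rcases i with _ | _ | i <;> simp [wittWeight]
    intro i j k l h
    linarith [this i, this j, this k, this l]
  have h1 : ∀ i, G.cubicDeriv (G.sec (G.wit.vec i)) = 0 := fun i => by
    refine LinearMap.ext fun y => G.wit.eq_zero_of_vec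
      (G.cubicDeriv (G.sec (G.wit.vec i))) (fun j => LinearMap.ext fun z => ?_) y
    refine G.wit.eq_zero_of_vec (G.cubicDeriv (G.sec (G.wit.vec i)) (G.wit.vec j))
      (fun k => LinearMap.ext fun z => ?_) z
    exact G.wit.eq_zero_of_vec _ (fun l => G.K_vec_eq_zero (by norm_num) hσ (h i j k l)) z
  have h2 := G.wit.eq_zero_of_vec (G.cubicDeriv ∘ₗ G.sec) h1 v
  have h3 : G.cubicDeriv (G.sec v) = 0 := h2
  rw [K, h3]
  rfl

end WeightThree

section WeightTwo

/-- Total weight 4 is reached only when all four vectors are `e`. -/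
theorem K_eq_of_two (hσ : G.σ = -1 / 2) (v x y z : T) :
    G.K v x y z = G.K G.wit.e G.wit.e G.wit.e G.wit.e *
      (G.Q v G.wit.f * G.Q x G.wit.f * G.Q y G.wit.f * G.Q z G.wit.f) := by
  have hw : ∀ i : Option (Option (Fin d)), wittWeight i ≤ 1 ∧ (i ≠ none → wittWeight i ≤ 0) :=
    fun i => by rcases i with _ | _ | i <;> simp [wittWeight]
  have h1 : ∀ i, i ≠ none → G.cubicDeriv (G.sec (G.wit.vec i)) = 0 := fun i hi => by
    refine LinearMap.ext fun y => G.wit.eq_zero_of_vec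
      (G.cubicDeriv (G.sec (G.wit.vec i))) (fun j => LinearMap.ext fun z => ?_) y
    refine G.wit.eq_zero_of_vec (G.cubicDeriv (G.sec (G.wit.vec i)) (G.wit.vec j))
      (fun k => LinearMap.ext fun z => ?_) z
    refine G.wit.eq_zero_of_vec _ (fun l => G.K_vec_eq_zero (m := 2) (by norm_num) hσ ?_) z
    intro h
    linarith [(hw i).2 hi, (hw j).1, (hw k).1, (hw l).1]
  have h2 : ∀ i j k : Option (Option (Fin d)), (i ≠ none ∨ j ≠ none ∨ k ≠ none) →
      G.cubicDeriv (G.sec G.wit.e) (G.wit.vec i) (G.wit.vec j) (G.wit.vec k) = 0 := by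
    intro i j k h
    refine G.K_vec_eq_zero (m := 2) (i := none) (by norm_num) hσ ?_
    intro h0
    simp only [wittWeight_none, wittWeight_some_none, wittWeight_some_some] at h0
    rcases h with h | h | h <;> linarith [(hw i).1, (hw j).1, (hw k).1, (hw _).2 h]
  have hK : ∀ x y z, G.K G.wit.f x y z = 0 := fun x y z => by
    rw [K, show G.cubicDeriv (G.sec G.wit.f) = 0 from h1 (some none) (by simp)]; rfl
  have hKE : ∀ i x y z, G.K (G.wit.E i) x y z = 0 := fun i x y z => by
    rw [K, show G.cubicDeriv (G.sec (G.wit.E i)) = 0 from h1 (some (some i)) (by simp)]; rfl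
  rw [G.K_eq, hK]
  simp only [hKE, mul_zero, Finset.sum_const_zero, add_zero]
  rw [K, G.trilinear_eq _ h2, K]
  ring

variable {G} in
-- Total weight 2 leaves only the components with two `e` and one vector of the complement; the
-- hypothesis singles out one such vector.
theorem C_eq_of_two (hσ : G.σ = -1 / 2) {i₀ : Fin d}
    (h0 : ∀ i, i ≠ i₀ → G.C G.wit.e G.wit.e (G.wit.E i) = 0) (x y z : T) :
    G.C x y z = G.C G.wit.e G.wit.e (G.wit.E i₀) *
      (G.Q x G.wit.f * G.Q y G.wit.f * G.Q z (G.wit.E i₀) +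
        G.Q x G.wit.f * G.Q y (G.wit.E i₀) * G.Q z G.wit.f +
        G.Q x (G.wit.E i₀) * G.Q y G.wit.f * G.Q z G.wit.f) := by
  have hz : ∀ i j k : Option (Option (Fin d)), wittWeight i + wittWeight j + wittWeight k ≠ 2 →
      G.C (G.wit.vec i) (G.wit.vec j) (G.wit.vec k) = 0 := fun i j k h =>
    G.C_vec_eq_zero (by norm_num) hσ h
  have hw : ∀ i : Option (Option (Fin d)), wittWeight i ≤ 1 ∧ (i ≠ none → wittWeight i ≤ 0) :=
    fun i => by rcases i with _ | _ | i <;> simp [wittWeight]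
  have hf : G.C G.wit.f = 0 := by
    refine LinearMap.ext fun y => ?_
    refine G.wit.eq_zero_of_vec (G.C G.wit.f) (fun j => LinearMap.ext fun z => ?_) y
    refine G.wit.eq_zero_of_vec _ (fun k => hz (some none) j k fun h => ?_) z
    simp only [wittWeight_none, wittWeight_some_none, wittWeight_some_some] at h
    linarith [(hw j).1, (hw k).1]
  obtain ⟨l, hl⟩ : ∃ l : Fin d → ℝ, ∀ i, G.C G.wit.e G.wit.e (G.wit.E i) = l i :=
    ⟨_, fun _ => rfl⟩
  simp only [hl] at h0 ⊢
  have hee : ∀ z, G.C G.wit.e G.wit.e z = l i₀ *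
      G.Q z (G.wit.E i₀) := fun z => by
    rw [G.wit.map_eq (G.C G.wit.e G.wit.e) z,
      show G.C G.wit.e G.wit.e G.wit.e = 0 from hz none none none (by simp [wittWeight]; norm_num),
      show G.C G.wit.e G.wit.e G.wit.f = 0 from hz none none (some none) (by simp [wittWeight]),
      Finset.sum_eq_single i₀ (fun i _ hi => by rw [hl, h0 i hi, smul_zero]) (by simp), hl]
    simp [mul_comm]
  have hef : ∀ z, G.C G.wit.e G.wit.f z = 0 := fun z => by
    rw [G.C_swap_left, hf]; rfl
  have hEE : ∀ i j z, G.C (G.wit.E i) (G.wit.E j) z = 0 := fun i j z => by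
    refine G.wit.eq_zero_of_vec _ (fun k => hz (some (some i)) (some (some j)) k fun h => ?_) z
    simp only [wittWeight_none, wittWeight_some_none, wittWeight_some_some] at h
    linarith [(hw k).1]
  have heE : ∀ i z, G.C G.wit.e (G.wit.E i) z = l i *
      G.Q z G.wit.f := fun i z => by
    rw [G.wit.map_eq (G.C G.wit.e (G.wit.E i)) z, G.C_swap_right G.wit.e (G.wit.E i) G.wit.f, hef,
      G.C_swap_right G.wit.e (G.wit.E i) G.wit.e, hl, Finset.sum_eq_zero fun j _ => by
        rw [G.C_swap_left, G.C_swap_right, hEE, smul_zero]]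
    simp [mul_comm]
  have he : ∀ y z, G.C G.wit.e y z = l i₀ *
      (G.Q y G.wit.f * G.Q z (G.wit.E i₀) + G.Q y (G.wit.E i₀) * G.Q z G.wit.f) := fun y z => by
    rw [G.wit.map_eq (G.C G.wit.e) y]
    simp only [LinearMap.add_apply, LinearMap.smul_apply, LinearMap.sum_apply, hee, hef, heE,
      smul_eq_mul]
    rw [Finset.sum_eq_single i₀ (fun i _ hi => by rw [h0 i hi]; ring) (by simp)]
    ring
  have hE : ∀ i y z, G.C (G.wit.E i) y z = l i *
      (G.Q y G.wit.f * G.Q z G.wit.f) := fun i y z => by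
    rw [G.C_swap_left, G.wit.map_eq G.C y, hf]
    simp only [LinearMap.add_apply, LinearMap.smul_apply, LinearMap.sum_apply, hEE, heE,
      smul_eq_mul, LinearMap.zero_apply, mul_zero, Finset.sum_const_zero]
    ring
  rw [G.wit.map_eq G.C x, hf]
  simp only [LinearMap.add_apply, LinearMap.smul_apply, LinearMap.sum_apply, he, hE, smul_eq_mul,
    LinearMap.zero_apply, mul_zero]
  rw [Finset.sum_eq_single i₀ (fun i _ hi => by rw [h0 i hi]; ring) (by simp)]
  ring

/-- The derivative of `C` on `(e, E i₀, x)` vanishes because `K` is supported on `e`. With skewness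
of `A X` at `E i₀` this determines the `f`-pairing of `A X` completely. -/
theorem A_section_of_two (hσ : G.σ = -1 / 2) {i₀ : Fin d}
    (h0 : ∀ i, i ≠ i₀ → G.C G.wit.e G.wit.e (G.wit.E i) = 0)
    (hl : G.C G.wit.e G.wit.e (G.wit.E i₀) ≠ 0) {X : 𝔤} (hX : G.a X = 0) (x : T) :
    G.Q (G.A X x) G.wit.f = 0 := by
  have hC := C_eq_of_two hσ h0
  have h1 : ∀ x, G.Q (G.A X G.wit.e) G.wit.f * G.Q x G.wit.f +
      G.Q (G.A X (G.wit.E i₀)) G.wit.f * G.Q x (G.wit.E i₀) +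
      G.Q (G.A X (G.wit.E i₀)) (G.wit.E i₀) * G.Q x G.wit.f + G.Q (G.A X x) G.wit.f = 0 := by
    intro x
    have h := G.cubicDeriv_eq X G.wit.e (G.wit.E i₀) x
    rw [G.K_eq_of_two hσ, hX, zero_mul, add_zero, hC (G.wit.E i₀) x, hC G.wit.e x,
      hC G.wit.e (G.wit.E i₀), G.Q_symm (G.wit.E i₀) G.wit.f, G.wit.fE, G.wit.eE, G.wit.ef,
      G.wit.EE] at h
    simp only [if_true] at h
    refine (mul_eq_zero.1 ?_).resolve_left hl
    linarith
  have h2 : G.Q (G.A X (G.wit.E i₀)) (G.wit.E i₀) = 0 := by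
    have h := G.compat X (G.wit.E i₀) (G.wit.E i₀)
    rw [hX, hC, G.Q_symm (G.wit.E i₀) G.wit.f, G.wit.fE, G.Q_symm (G.wit.E i₀) (G.A X _)] at h
    linarith
  have h3 : G.Q (G.A X (G.wit.E i₀)) G.wit.f = 0 := by
    have h := h1 (G.wit.E i₀)
    rw [G.Q_symm (G.wit.E i₀) G.wit.f, G.wit.fE, G.wit.EE, if_pos rfl] at h
    linarith
  have h4 : G.Q (G.A X G.wit.e) G.wit.f = 0 := by
    have h := h1 G.wit.e
    rw [G.wit.ef, h2, h3] at h
    linarith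
  have h := h1 x
  rw [h2, h3, h4] at h
  linarith

/-- After subtracting `(a X / 2) D` the previous lemma applies; the factor 1/4 comes from the action
`1 + σ = 1/2` of `D`. It is exactly what makes the quartic term `x₁⁴` relatively invariant. -/
theorem A_of_two (hσ : G.σ = -1 / 2) {i₀ : Fin d}
    (h0 : ∀ i, i ≠ i₀ → G.C G.wit.e G.wit.e (G.wit.E i) = 0)
    (hl : G.C G.wit.e G.wit.e (G.wit.E i₀) ≠ 0) (X : 𝔤) (x : T) :
    G.Q (G.A X x) G.wit.f = G.a X / 4 * G.Q x G.wit.f := by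
  have h := G.A_section_of_two hσ h0 hl (X := X - (G.a X / 2) • G.D) (by simp [G.a_D]) x
  have h1 := G.s_skew x G.wit.f
  rw [G.s_f, map_smul, hσ, smul_eq_mul] at h1
  simp only [map_sub, map_smul, LinearMap.sub_apply, LinearMap.smul_apply,
    G.toSymmetryModel.A_eq_add_skewPart G.D, map_add, LinearMap.add_apply, smul_eq_mul] at h
  linear_combination h + G.a X / 2 * h1

end WeightTwo

end GradedModel

namespace SymmetryModel

variable {𝔤 T : Type*} [AddCommGroup 𝔤] [Module ℝ 𝔤] [AddCommGroup T] [Module ℝ T]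
  [FiniteDimensional ℝ T] (S : SymmetryModel 𝔤 T)

/-- For `C = 0` the Codazzi equation makes the shape operator preserve every line, so it is a
scalar. A scalar commutes with the skew part of `D`, hence has weight zero, while the weight has to
be -2. -/
theorem w_eq_zero_of_C_eq_zero (hC : S.C = 0) {D : 𝔤} (hDb : S.b D = 0) (hDa : S.a D = 2)
    (X : 𝔤) : S.w X = 0 := by
  obtain ⟨σ, hσb, hσa⟩ := S.exists_section hDb hDa
  have hK : ∀ X x y z, S.cubicDeriv X x y z = 0 := fun X x y z => by
    rw [cubicDeriv_apply, hC]; simp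
  have hcod : ∀ x y u, S.Q u (S.w (σ x)) * S.Q y u = S.Q u (S.w (σ y)) * S.Q x u := by
    intro x y u
    have h := S.codazzi (hσa x) (hσa y) u u
    rw [hK, hK, hσb, hσb] at h
    linarith
  have hsym : ∀ x y, S.Q x (S.w (σ y)) = S.Q y (S.w (σ x)) := by
    intro x y
    have h := S.a_bracket_eq_zero (σ x) (σ y)
    rw [S.a_bracket, hσb, hσb] at h
    linarith
  obtain ⟨c, hc⟩ : ∃ c : ℝ, S.w ∘ₗ σ = c • LinearMap.id := by
    refine LinearMap.exists_eq_smul_id_of_forall_notLinearIndependent fun u => ?_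
    by_cases hu : u = 0
    · intro h
      exact h.ne_zero 0 hu
    obtain ⟨y, hy⟩ : ∃ y, S.Q u y ≠ 0 := by
      by_contra hcon
      push Not at hcon
      exact hu (S.Q_nondegenerate u hcon)
    have h1 : S.Q u y • S.w (σ u) = S.Q y (S.w (σ u)) • u := by
      rw [← sub_eq_zero]
      refine S.Q_nondegenerate _ fun x => ?_
      have h2 := hcod x y u
      rw [hsym u x, hsym u y, S.Q_symm y u, S.Q_symm x u, S.Q_symm x (S.w _)] at h2
      simp only [map_sub, map_smul, LinearMap.sub_apply, LinearMap.smul_apply, smul_eq_mul]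
      linarith
    intro h
    rw [LinearIndependent.pair_iff] at h
    have h3 := h (S.Q y (S.w (σ u))) (-S.Q u y) (by
      rw [← h1, LinearMap.comp_apply, neg_smul, add_neg_cancel])
    exact hy (neg_eq_zero.1 h3.2)
  have hc0 : ∀ u, S.w (σ u) = c • u := fun u => DFunLike.congr_fun hc u
  have hcz : ∀ u, S.w (σ u) = 0 := by
    intro u
    refine S.Q_nondegenerate _ fun v => ?_
    have h := S.w_weight hDb hDa hσb u v
    have h1 := S.skewPart_skew hDb hDa u v
    rw [hc0, hc0] at h
    rw [hc0]
    simp only [map_smul, LinearMap.smul_apply, smul_eq_mul] at h ⊢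
    linear_combination (1 / 2) * h - c / 2 * h1
  rw [S.w_of_b_eq (Y := σ (S.b X)) (hσb _).symm, hcz]

end SymmetryModel

end AffineTube

namespace AffineTube

/-! ### Cubic forms of weight one: components of the symmetries. -/

/-- A graded model whose cubic form is homogeneous of weight one, with a Witt basis diagonalizing
the quadratic form `C e`. -/
structure DiagonalModel (𝔤 T : Type*) [AddCommGroup 𝔤] [Module ℝ 𝔤] [AddCommGroup T]
    [Module ℝ T] [FiniteDimensional ℝ T] (d : ℕ) extends GradedModel 𝔤 T d where
  σ_eq : σ = -1
  diag : ∀ i j, i ≠ j → C wit.e (wit.E i) (wit.E j) = 0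
  C_ne_zero : C ≠ 0

namespace DiagonalModel

variable {𝔤 T : Type*} [AddCommGroup 𝔤] [Module ℝ 𝔤] [AddCommGroup T] [Module ℝ T]
  [FiniteDimensional ℝ T] {d : ℕ} (G : DiagonalModel 𝔤 T d)

/-- The coefficient `C e e f`. -/
def β : ℝ := G.C G.wit.e G.wit.e G.wit.f

/-- The diagonal coefficients of `C e`. -/
def q (i : Fin d) : ℝ := G.C G.wit.e (G.wit.E i) (G.wit.E i)

theorem σ_eq' : G.σ = -1 / 1 := by rw [G.σ_eq]; norm_num

theorem C_zero (i j k) (h : wittWeight i + wittWeight j + wittWeight k ≠ 1) :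
    G.C (G.wit.vec i) (G.wit.vec j) (G.wit.vec k) = 0 :=
  G.C_vec_eq_zero one_ne_zero G.σ_eq' h

theorem K_zero (i j k l) (h : wittWeight i + wittWeight j + wittWeight k + wittWeight l ≠ 2) :
    G.K (G.wit.vec i) (G.wit.vec j) (G.wit.vec k) (G.wit.vec l) = 0 :=
  G.K_vec_eq_zero one_ne_zero G.σ_eq' (by simpa using h)

theorem w_zero (i j) (h : wittWeight i + wittWeight j ≠ 2) :
    G.Q (G.w (G.sec (G.wit.vec i))) (G.wit.vec j) = 0 :=
  G.w_vec_eq_zero one_ne_zero G.σ_eq' (by simpa using h)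

theorem fe : G.Q G.wit.f G.wit.e = 1 := by rw [G.Q_symm, G.wit.ef]

theorem Ee (i) : G.Q (G.wit.E i) G.wit.e = 0 := by rw [G.Q_symm, G.wit.eE]

theorem Ef (i) : G.Q (G.wit.E i) G.wit.f = 0 := by rw [G.Q_symm, G.wit.fE]

theorem C_ee (z : T) : G.C G.wit.e G.wit.e z = G.β * G.Q z G.wit.e := by
  rw [G.wit.map_eq (G.C G.wit.e G.wit.e) z,
    show G.C G.wit.e G.wit.e G.wit.e = 0 from
      G.C_zero none none none (by norm_num [wittWeight]),
    Finset.sum_eq_zero fun i _ => by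
      rw [show G.C G.wit.e G.wit.e (G.wit.E i) = 0 from
        G.C_zero none none (some (some i)) (by norm_num [wittWeight]), smul_zero]]
  rw [β, smul_eq_mul, smul_eq_mul]
  ring

theorem C_ef (z : T) : G.C G.wit.e G.wit.f z = G.β * G.Q z G.wit.f := by
  rw [G.wit.map_eq (G.C G.wit.e G.wit.f) z,
    show G.C G.wit.e G.wit.f G.wit.f = 0 from
      G.C_zero none (some none) (some none) (by norm_num [wittWeight]),
    Finset.sum_eq_zero fun i _ => by
      rw [show G.C G.wit.e G.wit.f (G.wit.E i) = 0 from
        G.C_zero none (some none) (some (some i)) (by norm_num [wittWeight]), smul_zero],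
    G.C_swap_right, ← β, smul_eq_mul, smul_eq_mul]
  ring

theorem C_eE (i) (z : T) : G.C G.wit.e (G.wit.E i) z = G.q i * G.Q z (G.wit.E i) := by
  rw [G.wit.map_eq (G.C G.wit.e (G.wit.E i)) z,
    show G.C G.wit.e (G.wit.E i) G.wit.f = 0 from
      G.C_zero none (some (some i)) (some none) (by norm_num [wittWeight]),
    show G.C G.wit.e (G.wit.E i) G.wit.e = 0 from
      G.C_zero none (some (some i)) none (by norm_num [wittWeight]),
    Finset.sum_eq_single i (fun j _ hj => by rw [G.diag i j hj.symm, smul_zero]) (by simp),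
    ← q, smul_eq_mul, smul_eq_mul, smul_eq_mul]
  ring

theorem C_ff (z : T) : G.C G.wit.f G.wit.f z = 0 := by
  refine G.wit.eq_zero_of_vec _ (fun k => G.C_zero (some none) (some none) k ?_) z
  rcases k with _ | _ | k <;> norm_num [wittWeight]

theorem C_fE (i) (z : T) : G.C G.wit.f (G.wit.E i) z = 0 := by
  refine G.wit.eq_zero_of_vec _ (fun k => G.C_zero (some none) (some (some i)) k ?_) z
  rcases k with _ | _ | k <;> norm_num [wittWeight]

theorem C_EE (i j) (z : T) : G.C (G.wit.E i) (G.wit.E j) z =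
    if i = j then G.q i * G.Q z G.wit.f else 0 := by
  rw [G.wit.map_eq (G.C (G.wit.E i) (G.wit.E j)) z,
    show G.C (G.wit.E i) (G.wit.E j) G.wit.f = 0 from
      G.C_zero (some (some i)) (some (some j)) (some none) (by norm_num [wittWeight]),
    Finset.sum_eq_zero fun k _ => by
      rw [show G.C (G.wit.E i) (G.wit.E j) (G.wit.E k) = 0 from
        G.C_zero (some (some i)) (some (some j)) (some (some k)) (by norm_num [wittWeight]),
        smul_zero],
    G.C_swap_right, G.C_swap_left, G.C_eE, G.wit.EE]
  by_cases h : i = j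
  · simp [h, mul_comm]
  · rw [if_neg h, if_neg (Ne.symm h)]; simp

/-- Trace-freeness of `C e`: the pair contributes β twice and the complement the `q i`. -/
theorem trace_eq : 2 * G.β + ∑ i, G.q i = 0 := by
  have h := G.C_traceless G.wit.e (G.β • (G.Q.flip G.wit.f).smulRight G.wit.e +
    G.β • (G.Q.flip G.wit.e).smulRight G.wit.f +
    ∑ i, G.q i • (G.Q.flip (G.wit.E i)).smulRight (G.wit.E i)) (fun u x => by
      rw [G.wit.map_eq (G.C G.wit.e) u]
      simp only [LinearMap.add_apply, LinearMap.smul_apply, LinearMap.sum_apply, G.C_ee, G.C_ef,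
        G.C_eE, LinearMap.smulRight_apply, LinearMap.flip_apply, map_add, map_smul, map_sum,
        smul_eq_mul]
      rw [G.Q_symm G.wit.e x, G.Q_symm G.wit.f x]
      simp only [G.Q_symm (G.wit.E _) x]
      congr 1
      · ring
      · exact Finset.sum_congr rfl fun i _ => by ring)
  simp only [map_add, map_smul, map_sum, LinearMap.trace_smulRight, LinearMap.flip_apply,
    G.wit.ef, G.fe, G.wit.EE, if_true, smul_eq_mul, mul_one] at h
  linarith

/-- Otherwise the trace condition reads `β (2 + d / 2) = 0`, and all components of `C` would vanish.
-/
theorem exists_q_ne : ∃ i, G.q i ≠ G.β / 2 := by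
  by_contra hcon
  push Not at hcon
  have h := G.trace_eq
  simp only [hcon, Finset.sum_const, Finset.card_univ, Fintype.card_fin, nsmul_eq_mul] at h
  have h1 : G.β * (2 + d / 2 : ℝ) = 0 := by linarith
  have hβ : G.β = 0 := (mul_eq_zero.1 h1).resolve_right (by positivity)
  have hq : ∀ i, G.q i = 0 := fun i => by rw [hcon, hβ, zero_div]
  have he : ∀ y z, G.C G.wit.e y z = 0 := fun y z => by
    rw [G.wit.map_eq (G.C G.wit.e) y]
    simp [C_ee, C_ef, C_eE, hβ, hq]
  have hf : ∀ y z, G.C G.wit.f y z = 0 := fun y z => by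
    rw [G.wit.map_eq (G.C G.wit.f) y]
    simp [C_ff, C_fE, G.C_swap_left G.wit.f G.wit.e, he]
  have hE : ∀ i y z, G.C (G.wit.E i) y z = 0 := fun i y z => by
    rw [G.wit.map_eq (G.C (G.wit.E i)) y]
    simp [C_EE, G.C_swap_left (G.wit.E i) G.wit.e, G.C_swap_left (G.wit.E i) G.wit.f, he, hf, hq]
  refine G.C_ne_zero (LinearMap.ext fun x => LinearMap.ext fun y => LinearMap.ext fun z => ?_)
  rw [G.wit.map_eq G.C x]
  simp [he, hf, hE]

theorem exists_q_ne_zero : ∃ i, G.q i ≠ 0 := by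
  by_contra hcon
  push Not at hcon
  have h := G.trace_eq
  simp only [hcon, Finset.sum_const_zero, add_zero] at h
  obtain ⟨i, hi⟩ := G.exists_q_ne
  exact hi (by rw [hcon]; linarith)

section Components

variable (X : 𝔤)

theorem compat_swap (x y : T) : G.Q (G.A X x) y + G.Q (G.A X y) x + G.C x y (G.b X) =
    G.a X * G.Q x y := by
  rw [← G.compat X x y, G.C_rotate (G.b X), G.Q_symm x, G.Q_symm y]
  ring

theorem A_ee : G.Q (G.A X G.wit.e) G.wit.e = -(G.β / 2) * G.Q (G.b X) G.wit.e := by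
  have h := G.compat_swap X G.wit.e G.wit.e
  rw [G.C_ee, G.wit.ee] at h
  linarith

theorem A_ff : G.Q (G.A X G.wit.f) G.wit.f = 0 := by
  have h := G.compat_swap X G.wit.f G.wit.f
  rw [G.C_ff, G.wit.ff] at h
  linarith

theorem A_fe : G.Q (G.A X G.wit.f) G.wit.e =
    G.a X - G.β * G.Q (G.b X) G.wit.f - G.Q (G.A X G.wit.e) G.wit.f := by
  have h := G.compat_swap X G.wit.e G.wit.f
  rw [G.C_ef, G.wit.ef] at h
  linarith

theorem A_Ee (i) : G.Q (G.A X (G.wit.E i)) G.wit.e =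
    -(G.q i * G.Q (G.b X) (G.wit.E i)) - G.Q (G.A X G.wit.e) (G.wit.E i) := by
  have h := G.compat_swap X G.wit.e (G.wit.E i)
  rw [G.C_eE, G.wit.eE] at h
  linarith

theorem A_EE (i j) : G.Q (G.A X (G.wit.E i)) (G.wit.E j) + G.Q (G.A X (G.wit.E j)) (G.wit.E i) =
    if i = j then G.a X - G.q i * G.Q (G.b X) G.wit.f else 0 := by
  have h := G.compat_swap X (G.wit.E i) (G.wit.E j)
  rw [G.C_EE, G.wit.EE] at h
  split_ifs at h ⊢ <;> linarith

theorem A_EE_self (i) : 2 * G.Q (G.A X (G.wit.E i)) (G.wit.E i) =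
    G.a X - G.q i * G.Q (G.b X) G.wit.f := by
  have h := G.A_EE X i i
  rw [if_pos rfl] at h
  linarith

/-- Evaluate the derivative of `C` on `(E i, E j, E j)` with `q j ≠ 0`: the `K`-term has total
weight at most 1 and therefore vanishes. -/
theorem A_Ef (i) : G.Q (G.A X (G.wit.E i)) G.wit.f = 0 := by
  obtain ⟨j, hj⟩ := G.exists_q_ne_zero
  have h := G.cubicDeriv_eq X (G.wit.E i) (G.wit.E j) (G.wit.E j)
  have hK : ∀ v, G.K v (G.wit.E i) (G.wit.E j) (G.wit.E j) = 0 := fun v =>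
    G.wit.eq_zero_of_vec (((G.cubicDeriv.flip (G.wit.E i)).flip (G.wit.E j)).flip
      (G.wit.E j) ∘ₗ G.sec) (fun k => G.K_zero k (some (some i)) (some (some j)) (some (some j)) (by
        rcases k with _ | _ | k <;> norm_num [wittWeight])) v
  rw [hK, G.C_EE j j, if_pos rfl, G.C_EE, G.C_EE, G.Ef] at h
  by_cases hij : i = j
  · subst hij
    simp only [if_true, mul_zero] at h
    exact (mul_eq_zero.1 (show G.q i * G.Q (G.A X (G.wit.E i)) G.wit.f = 0 by linarith)
      ).resolve_left hj
  · simp only [if_neg hij, mul_zero, add_zero] at h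
    exact (mul_eq_zero.1 h.symm).resolve_left hj

theorem A_fE (i) : G.Q (G.A X G.wit.f) (G.wit.E i) = 0 := by
  have h := G.compat_swap X G.wit.f (G.wit.E i)
  rw [G.C_fE, G.wit.fE, G.A_Ef] at h
  linarith

/-- The coefficient describing the `e`-components of the linear parts. -/
def ν : ℝ := G.Q (G.A (G.sec G.wit.e) G.wit.e) G.wit.f

theorem K_of_weight_one {x y z : T} (h : ∀ k, k ≠ none → G.K (G.wit.vec k) x y z = 0) (v : T) :
    G.K v x y z = G.Q v G.wit.f * G.K G.wit.e x y z := by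
  rw [G.K_eq, show G.K G.wit.f x y z = 0 from h (some none) (by simp),
    Finset.sum_eq_zero fun i _ => by
      rw [show G.K (G.wit.E i) x y z = 0 from h (some (some i)) (by simp), mul_zero]]
  ring

theorem K_eEE (i j) (v : T) : G.K v G.wit.e (G.wit.E i) (G.wit.E j) =
    G.Q v G.wit.f * G.K G.wit.e G.wit.e (G.wit.E i) (G.wit.E j) := by
  refine G.K_of_weight_one (fun k hk => G.K_zero k none (some (some i)) (some (some j)) ?_) v
  rcases k with _ | _ | k
  · exact absurd rfl hk
  all_goals norm_num [wittWeight]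

theorem K_self_eq (i) : G.q i * G.Q (G.A X G.wit.e) G.wit.f =
    G.Q (G.b X) G.wit.f * (G.K G.wit.e G.wit.e (G.wit.E i) (G.wit.E i) + G.q i ^ 2) := by
  have h := G.cubicDeriv_eq X G.wit.e (G.wit.E i) (G.wit.E i)
  rw [G.K_eEE, G.C_EE, G.C_eE, G.wit.EE, if_pos rfl, if_pos rfl, G.C_eE] at h
  have h1 := G.A_EE_self X i
  linear_combination -h - G.q i * h1

/-- By `K_self_eq` at an index with `q j ≠ 0`, the left side is proportional to `Q (b X) f` with a
factor independent of `X`. -/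
theorem A_ef : G.Q (G.A X G.wit.e) G.wit.f = G.ν * G.Q (G.b X) G.wit.f := by
  obtain ⟨j, hj⟩ := G.exists_q_ne_zero
  have h1 := G.K_self_eq X j
  have h2 := G.K_self_eq (G.sec G.wit.e) j
  rw [G.b_sec, G.wit.ef, ← ν, one_mul] at h2
  rw [← h2] at h1
  have h3 : G.q j * (G.Q (G.A X G.wit.e) G.wit.f - G.ν * G.Q (G.b X) G.wit.f) = 0 := by linarith
  linarith [(mul_eq_zero.1 h3).resolve_left hj]

theorem K_eeEE_self (i) :
    G.K G.wit.e G.wit.e (G.wit.E i) (G.wit.E i) = G.q i * (G.ν - G.q i) := by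
  have h2 := G.K_self_eq (G.sec G.wit.e) i
  rw [G.b_sec, G.wit.ef, ← ν, one_mul] at h2
  linarith

/-- For isotropy elements the right side is zero, so rotations can mix only directions with equal
`q`. -/
theorem K_eeEE_of_ne {i j} (hij : i ≠ j) : (G.q j - G.q i) * G.Q (G.A X (G.wit.E i)) (G.wit.E j) =
    G.Q (G.b X) G.wit.f * G.K G.wit.e G.wit.e (G.wit.E i) (G.wit.E j) := by
  have h := G.cubicDeriv_eq X G.wit.e (G.wit.E i) (G.wit.E j)
  rw [G.K_eEE, G.C_EE, if_neg hij, G.diag i j hij, G.C_eE, G.C_eE] at h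
  have h1 := G.A_EE X i j
  rw [if_neg hij] at h1
  linear_combination -h - G.q i * h1

/-- The coefficient of the affine shape operator. -/
def τ : ℝ := G.Q (G.w (G.sec G.wit.e)) G.wit.e

theorem w_sec_e : G.w (G.sec G.wit.e) = G.τ • G.wit.f := by
  have h := G.wit.decomp (G.w (G.sec G.wit.e))
  rw [show G.Q (G.w (G.sec G.wit.e)) G.wit.f = 0 from
      G.w_zero none (some none) (by norm_num [wittWeight]),
    Finset.sum_eq_zero fun i _ => by
      rw [show G.Q (G.w (G.sec G.wit.e)) (G.wit.E i) = 0 from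
        G.w_zero none (some (some i)) (by norm_num [wittWeight]), zero_smul], ← τ] at h
  rw [h]
  simp

theorem w_sec_vec {k} (hk : k ≠ none) : G.w (G.sec (G.wit.vec k)) = 0 := by
  refine G.Q_nondegenerate _ fun v => G.wit.eq_zero_of_vec _ (fun j => G.w_zero k j ?_) v
  rcases k with _ | _ | k
  · exact absurd rfl hk
  all_goals rcases j with _ | _ | j <;> norm_num [wittWeight]

theorem w_eq_smul : G.w X = (G.τ * G.Q (G.b X) G.wit.f) • G.wit.f := by
  rw [G.toGradedModel.w_eq]
  have h := G.wit.map_eq (G.w ∘ₗ G.sec) (G.b X)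
  simp only [LinearMap.comp_apply] at h
  rw [h, G.w_sec_e, show G.w (G.sec G.wit.f) = 0 from G.w_sec_vec (k := some none) (by simp),
    Finset.sum_eq_zero fun i _ => by
      rw [show G.w (G.sec (G.wit.E i)) = 0 from G.w_sec_vec (k := some (some i)) (by simp),
        smul_zero]]
  rw [smul_zero, add_zero, add_zero, smul_smul, mul_comm]

/-- The Codazzi equation for the pair `e, f`; it expresses the only component of the shape operator
by the cubic data. -/
theorem two_mul_τ : 2 * G.τ = -(G.β * (G.ν + G.β / 2)) := by
  have h := G.K_codazzi G.wit.e G.wit.f G.wit.e G.wit.e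
  rw [G.w_sec_e, show G.w (G.sec G.wit.f) = 0 from G.w_sec_vec (k := some none) (by simp),
    G.K_swap_left, G.K_swap_right, map_smul, G.wit.ef, G.fe] at h
  have h1 := G.cubicDeriv_eq (G.sec G.wit.e) G.wit.e G.wit.e G.wit.f
  rw [G.b_sec, G.a_sec, G.C_ef, G.C_ee, G.C_ee, G.A_fe, ← ν, G.b_sec, G.a_sec, G.wit.ef] at h1
  have h2 := G.cubicDeriv_eq (G.sec G.wit.f) G.wit.e G.wit.e G.wit.e
  rw [G.b_sec, G.a_sec, G.C_ee, G.C_ee, G.A_ee, G.b_sec, G.fe] at h2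
  simp only [smul_eq_mul, map_zero, zero_mul, mul_zero, add_zero, sub_zero, mul_one] at h h1 h2
  linear_combination h - h1 + h2

theorem K_Eee (i j) : G.K (G.wit.E j) G.wit.e G.wit.e (G.wit.E i) =
    G.K G.wit.e G.wit.e (G.wit.E i) (G.wit.E j) + if i = j then G.τ else 0 := by
  have h := G.K_codazzi G.wit.e (G.wit.E j) G.wit.e (G.wit.E i)
  rw [G.w_sec_e, show G.w (G.sec (G.wit.E j)) = 0 from G.w_sec_vec (k := some (some j)) (by simp),
    G.K_swap_left, G.K_swap_right _ _ (G.wit.E j), map_smul, map_smul, G.wit.ef, G.wit.EE,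
    G.Ee, map_zero, map_zero] at h
  simp only [smul_eq_mul, zero_mul, mul_zero, add_zero, sub_zero, mul_one, eq_comm (a := j)] at h
  split_ifs at h ⊢ <;> linarith

/-- The derivative of `C` on `(e, e, E i)`. The exceptional value `q i = β/2` is the one for which
this equation leaves the `E i`-component of `A X e` free. -/
theorem A_eE (i) : (2 * G.q i - G.β) * G.Q (G.A X G.wit.e) (G.wit.E i) =
    G.β * G.q i * G.Q (G.b X) (G.wit.E i) + ∑ j, G.Q (G.b X) (G.wit.E j) *
      G.K (G.wit.E j) G.wit.e G.wit.e (G.wit.E i) := by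
  have h := G.cubicDeriv_eq X G.wit.e G.wit.e (G.wit.E i)
  rw [G.K_eq, show G.K G.wit.e G.wit.e G.wit.e (G.wit.E i) = 0 from
      G.K_zero none none none (some (some i)) (by norm_num [wittWeight]),
    show G.K G.wit.f G.wit.e G.wit.e (G.wit.E i) = 0 from
      G.K_zero (some none) none none (some (some i)) (by norm_num [wittWeight]),
    G.C_ee, G.Ee, G.C_eE, G.C_ee, G.A_Ee] at h
  linear_combination -h

end Components

end DiagonalModel

end AffineTube

namespace AffineTube

/-! ### Counting isotropy dimensions. -/

/-- The pairs of indices in increasing order are half of all pairs of distinct indices. -/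
theorem card_filter_lt_fin (d : ℕ) :
    (Finset.univ.filter fun x : Fin d × Fin d => x.1 < x.2).card = d * (d - 1) / 2 := by
  have h1 : (Finset.univ.filter fun x : Fin d × Fin d => x.1 < x.2).card =
      (Finset.univ.filter fun x : Fin d × Fin d => x.2 < x.1).card :=
    Finset.card_bij (fun x _ => x.swap) (by simp) (by
      intro x _ y _ h
      exact Prod.swap_injective h) (by
      intro x hx
      exact ⟨x.swap, by simpa using hx, by simp⟩)
  have h2 : (Finset.univ.filter fun x : Fin d × Fin d => x.1 = x.2).card = d := by
    have : (Finset.univ.filter fun x : Fin d × Fin d => x.1 = x.2) =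
        Finset.univ.image fun i : Fin d => (i, i) := by
      ext ⟨a, b⟩
      simp [eq_comm]
    rw [this, Finset.card_image_of_injective _ (fun a b h => by simpa using h)]
    simp
  have h3 : (Finset.univ.filter fun x : Fin d × Fin d => x.1 < x.2).card +
      (Finset.univ.filter fun x : Fin d × Fin d => x.2 < x.1).card +
      (Finset.univ.filter fun x : Fin d × Fin d => x.1 = x.2).card = d * d := by
    rw [← Finset.card_union_of_disjoint, ← Finset.card_union_of_disjoint]
    · have : (Finset.univ.filter fun x : Fin d × Fin d => x.1 < x.2) ∪
          (Finset.univ.filter fun x : Fin d × Fin d => x.2 < x.1) ∪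
          (Finset.univ.filter fun x : Fin d × Fin d => x.1 = x.2) = Finset.univ := by
        ext ⟨a, b⟩
        simp only [Finset.mem_union, Finset.mem_filter, Finset.mem_univ, true_and, iff_true]
        rcases lt_trichotomy a b with h | h | h <;> simp [h]
      rw [this]
      simp
    · rw [Finset.disjoint_left]
      simp only [Finset.mem_union, Finset.mem_filter, Finset.mem_univ, true_and]
      rintro x (h | h) h'
      · exact h.ne h'
      · exact h.ne' h'
    · rw [Finset.disjoint_left]
      simp only [Finset.mem_filter, Finset.mem_univ, true_and]
      intro x h h'
      exact lt_asymm h h'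
  rw [← h1, h2] at h3
  rcases d with _ | d
  · simp
  · have h4 : (d + 1) * (d + 1 - 1) = 2 * (Finset.univ.filter
        fun x : Fin (d + 1) × Fin (d + 1) => x.1 < x.2).card := by
      rw [Nat.add_sub_cancel]
      nlinarith
    rw [h4, Nat.mul_div_cancel_left _ (by norm_num)]

/-- If a function takes the value `c` more often than it separates pairs of indices, then it is
constant or takes the value `c` everywhere except once. -/
theorem eq_or_eq_of_card_le {d : ℕ} (q : Fin d → ℝ) (c : ℝ) (hc : ∃ i, q i ≠ c)
    (h : (Finset.univ.filter fun x : Fin d × Fin d => x.1 < x.2 ∧ q x.1 ≠ q x.2).card ≤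
      (Finset.univ.filter fun i => q i = c).card) :
    (∀ i j, q i = q j) ∨ ∃ i, q i ≠ c ∧ ∀ j, j ≠ i → q j = c := by
  obtain ⟨i₀, hi₀⟩ := hc
  by_cases hE : (Finset.univ.filter fun i => q i = c) = ∅
  · left
    rw [hE, Finset.card_empty, Nat.le_zero, Finset.card_eq_zero, Finset.filter_eq_empty_iff] at h
    intro i j
    rcases lt_trichotomy i j with hij | hij | hij
    · by_contra hne
      exact h (Finset.mem_univ (i, j)) ⟨hij, hne⟩
    · rw [hij]
    · by_contra hne
      exact h (Finset.mem_univ (j, i)) ⟨hij, fun h => hne h.symm⟩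
  · right
    by_contra hcon
    push Not at hcon
    -- Two indices `i₀, i₁` with value different from `c` are each separated from every index with
    -- value `c`. This gives twice as many separated pairs as indices with value `c`, too many as
    -- soon as there is one such index.
    obtain ⟨i₁, hi₁, hq₁⟩ := hcon i₀ hi₀
    have hinj : ∀ a : Fin d, q a ≠ c → ((Finset.univ.filter fun i => q i = c).image
        fun j => if a < j then (a, j) else (j, a)) ⊆
          (Finset.univ.filter fun x : Fin d × Fin d => x.1 < x.2 ∧ q x.1 ≠ q x.2) := by
      intro a ha x hx
      rw [Finset.mem_image] at hx
      obtain ⟨j, hj, rfl⟩ := hx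
      rw [Finset.mem_filter] at hj ⊢
      have hne : a ≠ j := by rintro rfl; exact ha hj.2
      refine ⟨Finset.mem_univ _, ?_⟩
      split_ifs with h1
      · exact ⟨h1, by rw [hj.2]; exact ha⟩
      · exact ⟨lt_of_le_of_ne (not_lt.1 h1) hne.symm, by rw [hj.2]; exact ha.symm⟩
    have hcard : ∀ a : Fin d, q a ≠ c → ((Finset.univ.filter fun i => q i = c).image
        fun j => if a < j then (a, j) else (j, a)).card =
          (Finset.univ.filter fun i => q i = c).card := by
      intro a ha
      refine Finset.card_image_of_injOn ?_
      intro j hj k hk hjk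
      have hj' : q j = c := by simpa using hj
      have hk' : q k = c := by simpa using hk
      simp only at hjk
      split_ifs at hjk with h1 h2 h2
      · exact (Prod.mk.inj hjk).2
      · exact absurd (by rw [(Prod.mk.inj hjk).1]; exact hk') ha
      · exact absurd (by rw [← (Prod.mk.inj hjk).1]; exact hj') ha
      · exact (Prod.mk.inj hjk).1
    have hdisj : Disjoint ((Finset.univ.filter fun i => q i = c).image
        fun j => if i₀ < j then (i₀, j) else (j, i₀))
        ((Finset.univ.filter fun i => q i = c).image
        fun j => if i₁ < j then (i₁, j) else (j, i₁)) := by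
      rw [Finset.disjoint_left]
      intro x hx hx'
      rw [Finset.mem_image] at hx hx'
      obtain ⟨j, hj, rfl⟩ := hx
      obtain ⟨k, hk, hjk⟩ := hx'
      have hj' : q j = c := by simpa using hj
      have hk' : q k = c := by simpa using hk
      split_ifs at hjk with h1 h2 h2
      · exact hi₁ (Prod.mk.inj hjk).1
      · exact hq₁ (by rw [(Prod.mk.inj hjk).1]; exact hj')
      · exact hi₀ (by rw [← (Prod.mk.inj hjk).1]; exact hk')
      · exact hi₁ (Prod.mk.inj hjk).2
    have h1 := Finset.card_le_card (Finset.union_subset (hinj i₀ hi₀) (hinj i₁ hq₁))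
    rw [Finset.card_union_of_disjoint hdisj, hcard i₀ hi₀, hcard i₁ hq₁] at h1
    have h2 := Finset.card_pos.2 (Finset.nonempty_iff_ne_empty.2 hE)
    omega

namespace DiagonalModel

variable {𝔤 T : Type*} [AddCommGroup 𝔤] [Module ℝ 𝔤] [AddCommGroup T] [Module ℝ T]
  [FiniteDimensional ℝ T] {d : ℕ} (G : DiagonalModel 𝔤 T d)

theorem ext_wit {x : T} (hf : G.Q x G.wit.f = 0) (he : G.Q x G.wit.e = 0)
    (hE : ∀ i, G.Q x (G.wit.E i) = 0) : x = 0 := by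
  rw [G.wit.decomp x, hf, he]
  simp [hE]

/-- An isotropy element is determined by its linear part. The component of `A X e` along `E i` is
free only if `q i = β/2`, the rotation in the plane of `E i, E j` only if `q i = q j`, and all other
components are determined by these. -/
theorem finrank_isotropy_le : Module.finrank ℝ G.isotropy ≤
    (Finset.univ.filter fun i => G.q i = G.β / 2).card +
    (Finset.univ.filter fun x : Fin d × Fin d => x.1 < x.2 ∧ G.q x.1 = G.q x.2).card := by
  let L₁ (i : Fin d) : 𝔤 →ₗ[ℝ] ℝ :=
    G.Q.flip (G.wit.E i) ∘ₗ LinearMap.applyₗ G.wit.e ∘ₗ G.A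
  let L₂ (i j : Fin d) : 𝔤 →ₗ[ℝ] ℝ :=
    G.Q.flip (G.wit.E j) ∘ₗ LinearMap.applyₗ (G.wit.E i) ∘ₗ G.A
  let L : G.isotropy →ₗ[ℝ]
      ({i // i ∈ Finset.univ.filter fun i => G.q i = G.β / 2} → ℝ) ×
      ({x // x ∈ Finset.univ.filter fun x : Fin d × Fin d =>
        x.1 < x.2 ∧ G.q x.1 = G.q x.2} → ℝ) :=
    (LinearMap.pi fun i => L₁ i.1 ∘ₗ G.isotropy.subtype).prod
      (LinearMap.pi fun x => L₂ x.1.1 x.1.2 ∘ₗ G.isotropy.subtype)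
  have hL : Function.Injective L := by
    refine (injective_iff_map_eq_zero L).2 fun X hX => ?_
    obtain ⟨hXb, hXa⟩ := G.toSymmetryModel.mem_isotropy.1 X.2
    have h1 : ∀ i, G.q i = G.β / 2 → G.Q (G.A X.1 G.wit.e) (G.wit.E i) = 0 := fun i hi =>
      congrFun (congrArg Prod.fst hX) ⟨i, by simpa using hi⟩
    have h2 : ∀ i j, i < j → G.q i = G.q j → G.Q (G.A X.1 (G.wit.E i)) (G.wit.E j) = 0 :=
      fun i j hij hq => congrFun (congrArg Prod.snd hX) ⟨(i, j), by simpa using ⟨hij, hq⟩⟩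
    have hv : ∀ i, G.Q (G.A X.1 G.wit.e) (G.wit.E i) = 0 := by
      intro i
      by_cases hi : G.q i = G.β / 2
      · exact h1 i hi
      · have h := G.A_eE X.1 i
        rw [hXb] at h
        simp only [map_zero, LinearMap.zero_apply, mul_zero, zero_mul, Finset.sum_const_zero,
          add_zero] at h
        refine (mul_eq_zero.1 h).resolve_left fun h0 => hi ?_
        linarith
    have hlt : ∀ i j, i < j → G.Q (G.A X.1 (G.wit.E i)) (G.wit.E j) = 0 := by
      intro i j hij
      by_cases hq : G.q i = G.q j
      · exact h2 i j hij hq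
      · have h := G.K_eeEE_of_ne X.1 hij.ne
        rw [hXb, map_zero, LinearMap.zero_apply, zero_mul] at h
        exact (mul_eq_zero.1 h).resolve_left fun h0 => hq (by linarith)
    have hEE : ∀ i j, G.Q (G.A X.1 (G.wit.E i)) (G.wit.E j) = 0 := by
      intro i j
      rcases lt_trichotomy i j with hij | hij | hij
      · exact hlt i j hij
      · subst hij
        have h := G.A_EE_self X.1 i
        rw [hXa, hXb, map_zero, LinearMap.zero_apply] at h
        linarith
      · have h := G.A_EE X.1 i j
        rw [if_neg hij.ne', hlt j i hij] at h
        linarith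
    have hA : G.A X.1 = 0 := by
      have hef : G.Q (G.A X.1 G.wit.e) G.wit.f = 0 := by rw [G.A_ef, hXb]; simp
      have he : G.A X.1 G.wit.e = 0 :=
        G.ext_wit hef (by rw [G.A_ee, hXb]; simp) hv
      have hf : G.A X.1 G.wit.f = 0 :=
        G.ext_wit (G.A_ff _) (by rw [G.A_fe, hef, hXb, hXa]; simp) (G.A_fE _)
      have hE : ∀ i, G.A X.1 (G.wit.E i) = 0 := fun i =>
        G.ext_wit (G.A_Ef _ _) (by rw [G.A_Ee, hv, hXb]; simp) (hEE i)
      refine LinearMap.ext fun x => ?_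
      rw [G.wit.map_eq (G.A X.1) x, he, hf]
      simp [hE]
    exact Subtype.ext (G.ext_zero X.1 hXb hA (G.toSymmetryModel.w_eq_zero hXb) hXa)
  have h := LinearMap.finrank_le_finrank_of_injective hL
  rw [Module.finrank_prod, Module.finrank_fintype_fun_eq_card,
    Module.finrank_fintype_fun_eq_card, Fintype.card_coe, Fintype.card_coe] at h
  exact h

/-- The bound equals the number of all pairs, so each separated pair must be compensated by an index
with `q i = β/2`. -/
theorem q_eq_or (h : d * (d - 1) / 2 ≤ Module.finrank ℝ G.isotropy) :
    (∀ i j, G.q i = G.q j) ∨ ∃ i, G.q i ≠ G.β / 2 ∧ ∀ j, j ≠ i → G.q j = G.β / 2 := by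
  refine eq_or_eq_of_card_le G.q (G.β / 2) G.exists_q_ne ?_
  have h1 := G.finrank_isotropy_le
  rw [← card_filter_lt_fin] at h
  have h2 : (Finset.univ.filter fun x : Fin d × Fin d => x.1 < x.2 ∧ G.q x.1 = G.q x.2).card +
      (Finset.univ.filter fun x : Fin d × Fin d => x.1 < x.2 ∧ G.q x.1 ≠ G.q x.2).card =
      (Finset.univ.filter fun x : Fin d × Fin d => x.1 < x.2).card := by
    rw [← Finset.filter_filter, ← Finset.filter_filter]
    exact Finset.card_filter_add_card_filter_not _
  omega

/-! ### At most two values of `q`, one of them β/2. -/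

section TwoValues

variable {κ : ℝ}

/-- `A_eE` at the exceptional index `i`, applied to the section over `E j`: the left side vanishes,
and the right side is this component. -/
theorem K_cross {i j} (hi : G.q i = G.β / 2) (hj : G.q j ≠ G.β / 2) :
    G.K G.wit.e G.wit.e (G.wit.E i) (G.wit.E j) = 0 := by
  have hij : i ≠ j := by rintro rfl; exact hj hi
  have h := G.A_eE (G.sec (G.wit.E j)) i
  rw [G.b_sec, G.wit.EE, if_neg hij.symm, Finset.sum_eq_single j
    (fun k _ hk => by rw [G.wit.EE, if_neg hk.symm, zero_mul]) (by simp), G.wit.EE, if_pos rfl,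
    G.K_Eee, if_neg hij, hi] at h
  linarith

theorem A_cross (X : 𝔤) {i j} (hi : G.q i = G.β / 2) (hj : G.q j ≠ G.β / 2) :
    G.Q (G.A X (G.wit.E i)) (G.wit.E j) = 0 := by
  have hij : i ≠ j := by rintro rfl; exact hj hi
  have h := G.K_eeEE_of_ne X hij
  rw [G.K_cross hi hj, mul_zero] at h
  exact (mul_eq_zero.1 h).resolve_left fun h0 => hj (by linarith)

theorem A_cross' (X : 𝔤) {i j} (hi : G.q i = G.β / 2) (hj : G.q j ≠ G.β / 2) :
    G.Q (G.A X (G.wit.E j)) (G.wit.E i) = 0 := by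
  have hij : i ≠ j := by rintro rfl; exact hj hi
  have h := G.A_EE X i j
  rw [if_neg hij, G.A_cross X hi hj] at h
  linarith

/-- In `A_eE` only the term `j = i` survives: `K_cross` removes exceptional `j`, and `K_eeEE_of_ne`
with equal values of `q` removes the others. After `two_mul_τ` the common factor `2 q i - β`
cancels. -/
theorem A_eE_eq (hκ : ∀ i, G.q i ≠ G.β / 2 → G.q i = κ) (X : 𝔤) {i} (hi : G.q i ≠ G.β / 2) :
    G.Q (G.A X G.wit.e) (G.wit.E i) =
      (G.ν + G.β / 2 - κ) / 2 * G.Q (G.b X) (G.wit.E i) := by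
  have h := G.A_eE X i
  rw [Finset.sum_eq_single i (fun j _ hj => by
      rw [G.K_Eee, if_neg hj.symm, add_zero]
      by_cases hq : G.q j = G.β / 2
      · rw [G.K_swap_right, G.K_cross hq hi, mul_zero]
      · have h1 := G.K_eeEE_of_ne (G.sec G.wit.e) hj.symm
        rw [hκ i hi, hκ j hq, sub_self, zero_mul, G.b_sec, G.wit.ef, one_mul] at h1
        rw [← h1, mul_zero]) (by simp), G.K_Eee, if_pos rfl, G.K_eeEE_self] at h
  have h2 := G.two_mul_τ
  have h3 : 2 * G.q i - G.β ≠ 0 := fun h0 => hi (by linarith)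
  rw [← hκ i hi]
  refine mul_left_cancel₀ h3 ?_
  rw [h]
  linear_combination (1 / 2) * G.Q (G.b X) (G.wit.E i) * h2

/-- The `E i`-component of `A [X, Y] e`, for the sections `X` over `e` and `Y` over `E i`, is
computed from `A_eE_eq` and from the bracket formula. Equality of the two is this equation, i.e. `ν
= ±(κ - β/2)`. -/
theorem quadratic (hκ : ∀ i, G.q i ≠ G.β / 2 → G.q i = κ) :
    (G.ν + G.β / 2 - κ) * (G.β / 2 - κ - G.ν) = 0 := by
  obtain ⟨i, hi⟩ := G.exists_q_ne
  set X := G.sec G.wit.e with hX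
  set Y := G.sec (G.wit.E i) with hY
  have h := G.A_eE_eq hκ (G.bracket X Y) hi
  have hbX : G.b X = G.wit.e := G.b_sec _
  have hbY : G.b Y = G.wit.E i := G.b_sec _
  have hXi : G.Q (G.A X (G.wit.E i)) (G.wit.E i) = -κ / 2 := by
    have h1 := G.A_EE_self X i
    rw [hbX, G.wit.ef, hX, G.a_sec, hκ i hi] at h1
    linarith
  have hXe : ∀ j, G.q j ≠ G.β / 2 → G.Q (G.A X G.wit.e) (G.wit.E j) = 0 := fun j hj => by
    rw [G.A_eE_eq hκ X hj, hbX, G.wit.eE, mul_zero]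
  have hYe : ∀ j, G.q j ≠ G.β / 2 → G.Q (G.A Y G.wit.e) (G.wit.E j) =
      if j = i then (G.ν + G.β / 2 - κ) / 2 else 0 := fun j hj => by
    rw [G.A_eE_eq hκ Y hj, hbY, G.wit.EE]
    simp [eq_comm]
  have hXY : G.Q (G.A X (G.A Y G.wit.e)) (G.wit.E i) =
      (G.ν + G.β / 2 - κ) / 2 * (-κ / 2) := by
    have h1 := G.wit.map_eq (G.Q.flip (G.wit.E i) ∘ₗ G.A X) (G.A Y G.wit.e)
    simp only [LinearMap.comp_apply, LinearMap.flip_apply, smul_eq_mul] at h1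
    rw [h1, G.A_ef, hbY, G.Ef, G.A_ee, hbY, G.Ee, Finset.sum_eq_single i (fun j _ hj => by
      by_cases hq : G.q j = G.β / 2
      · rw [G.A_cross X hq hi, mul_zero]
      · rw [hYe j hq, if_neg hj, zero_mul]) (by simp), hYe i hi, if_pos rfl, hXi]
    ring
  have hYX : G.Q (G.A Y (G.A X G.wit.e)) (G.wit.E i) = G.ν * ((G.ν + G.β / 2 - κ) / 2) := by
    have h1 := G.wit.map_eq (G.Q.flip (G.wit.E i) ∘ₗ G.A Y) (G.A X G.wit.e)
    simp only [LinearMap.comp_apply, LinearMap.flip_apply, smul_eq_mul] at h1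
    rw [h1, G.A_ef, hbX, G.wit.ef, G.A_ee, hbX, G.wit.ee, hYe i hi, if_pos rfl,
      Finset.sum_eq_zero fun j _ => by
        by_cases hq : G.q j = G.β / 2
        · rw [G.A_cross Y hq hi, mul_zero]
        · rw [hXe j hq, zero_mul]]
    ring
  rw [G.A_bracket, G.b_bracket, hbX, hbY, G.wit.ee, G.Ee] at h
  simp only [map_sub, LinearMap.sub_apply, zero_smul, add_zero, sub_zero] at h
  rw [hXY, hYX, hXi, hYe i hi, if_pos rfl] at h
  linear_combination 4 * h

end TwoValues

end DiagonalModel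

end AffineTube

namespace AffineTube

/-! ### Coordinates of a Witt basis, and transfer of normal forms to Γ. -/

/-- Points with coordinates `(x₁, xₙ, xₙ₊₁, (x₂, …, xₙ₋₁))`, where `n = d + 2`. -/
abbrev WittSpace (d : ℕ) : Type := ℝ × ℝ × ℝ × (Fin d → ℝ)

theorem WittSpace.ext {d : ℕ} {x y : WittSpace d} (h1 : x.1 = y.1) (h2 : x.2.1 = y.2.1)
    (h3 : x.2.2.1 = y.2.2.1) (h4 : ∀ i, x.2.2.2 i = y.2.2.2 i) : x = y :=
  Prod.ext h1 (Prod.ext h2 (Prod.ext h3 (funext h4)))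

namespace WittBasis

variable {T : Type*} [AddCommGroup T] [Module ℝ T] [FiniteDimensional ℝ T]
  {Q : T →ₗ[ℝ] T →ₗ[ℝ] ℝ} {d : ℕ} (w : WittBasis Q d)

/-- The coordinates relative to a Witt basis. -/
noncomputable def coords (hs : ∀ u v, Q u v = Q v u) : (T × ℝ) ≃ₗ[ℝ] WittSpace d where
  toFun x := (Q x.1 w.f, Q x.1 w.e, x.2, fun i => Q x.1 (w.E i))
  map_add' x y := WittSpace.ext (by simp) (by simp) (by simp) (by simp)
  map_smul' c x := WittSpace.ext (by simp) (by simp) (by simp) (by simp)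
  invFun x := (x.1 • w.e + x.2.1 • w.f + ∑ i, x.2.2.2 i • w.E i, x.2.2.1)
  left_inv x := Prod.ext (w.decomp x.1).symm rfl
  right_inv x := by
    have h1 : Q w.f w.e = 1 := by rw [hs, w.ef]
    have h2 : ∀ i, Q (w.E i) w.e = 0 := fun i => by rw [hs, w.eE]
    have h3 : ∀ i, Q (w.E i) w.f = 0 := fun i => by rw [hs, w.fE]
    refine WittSpace.ext ?_ ?_ rfl fun i => ?_
    · simp [w.ff, w.ef, h3]
    · simp [w.ee, h1, h2]
    · simp [w.eE, w.fE, w.EE]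

theorem coords_apply (hs : ∀ u v, Q u v = Q v u) (x : T × ℝ) :
    w.coords hs x = (Q x.1 w.f, Q x.1 w.e, x.2, fun i => Q x.1 (w.E i)) := rfl

theorem Q_eq (hs : ∀ u v, Q u v = Q v u) (x y : T) : Q x y =
    Q x w.f * Q y w.e + Q x w.e * Q y w.f + ∑ i, Q x (w.E i) * Q y (w.E i) := by
  have h := w.map_eq (Q.flip y) x
  simp only [LinearMap.flip_apply, smul_eq_mul] at h
  rw [h, hs w.e y, hs w.f y]
  simp only [hs (w.E _) y]

end WittBasis

namespace SymmetryModel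

variable {𝔤 T : Type*} [AddCommGroup 𝔤] [Module ℝ 𝔤] [AddCommGroup T] [Module ℝ T]
  [FiniteDimensional ℝ T] (S : SymmetryModel 𝔤 T) {d : ℕ} (w : WittBasis S.Q d)

/-- A function of the coordinates is a relative invariant of the symmetries. -/
structure IsInvariant (u : WittSpace d → ℝ) : Prop where
  contDiff : ContDiff ℝ 1 u
  exists_multiplier : ∀ X, ∃ μ : WittSpace d → ℝ, Continuous μ ∧ ∀ x,
    fderiv ℝ u (w.coords S.Q_symm x) (w.coords S.Q_symm (S.field X x)) =
      μ (w.coords S.Q_symm x) * u (w.coords S.Q_symm x)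

theorem isInvariant_const (c : ℝ) : S.IsInvariant w fun _ => c where
  contDiff := contDiff_const
  exists_multiplier X := ⟨fun _ => 0, continuous_const, fun x => by simp⟩

/-- There is a relative invariant whose zero set is, where it is regular, affinely equivalent to
a listed hypersurface. -/
def HasNormalForm : Prop :=
  ∃ P t : WittSpace d → ℝ, S.IsInvariant w P ∧ S.IsInvariant w t ∧ P 0 = 0 ∧ t 0 ≠ 0 ∧
    (∀ x, t x ≠ 0 → fderiv ℝ P x ≠ 0) ∧ ∃ M, IsListedHypersurface (d + 2) M ∧
      ∃ g : WittSpace d ≃ᵃ[ℝ] (Fin (d + 2 + 1) → ℝ), ∀ x, g x ∈ M ↔ P x = 0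

end SymmetryModel

/-- Relative invariants of the model become relative invariants of Γ through the affine coordinates
centred at `q`, because these coordinates carry the symmetries to `field`. -/
theorem exists_listed_of_hasNormalForm {d : ℕ} {Γ : Set (Fin (d + 2 + 1) → ℝ)}
    (hΓ : IsSmoothHypersurface Γ) (hhom : IsAffinelyHomogeneousHypersurface Γ)
    (hconn : IsConnected Γ) {q : Fin (d + 2 + 1) → ℝ} (hq : q ∈ Γ)
    {T : Submodule ℝ (Fin (d + 2 + 1) → ℝ)} (S : SymmetryModel (symmetryAlgebra Γ) T)
    (Φ : (T × ℝ) ≃L[ℝ] (Fin (d + 2 + 1) → ℝ))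
    (hfield : ∀ (X : symmetryAlgebra Γ) x, X.1 (q + Φ x) = Φ (S.field X x))
    (w : WittBasis S.Q d) (h : S.HasNormalForm w) :
    ∃ M, IsListedHypersurface (d + 2) M ∧ ∀ y ∈ Γ, LocallyAffinelyEquivalentAt Γ M y := by
  obtain ⟨P, t, hP, ht, hP0, ht0, hdP, M, hM, g, hg⟩ := h
  refine ⟨M, hM, ?_⟩
  let L : (Fin (d + 2 + 1) → ℝ) ≃L[ℝ] WittSpace d :=
    Φ.symm.trans (w.coords S.Q_symm).toContinuousLinearEquiv
  have hL : ∀ x, L (Φ x) = w.coords S.Q_symm x := fun x => by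
    change w.coords S.Q_symm (Φ.symm (Φ x)) = _
    rw [Φ.symm_apply_apply]
  have hder : ∀ u : WittSpace d → ℝ, ContDiff ℝ 1 u → ∀ x,
      fderiv ℝ (fun x => u (L (x - q))) x = (fderiv ℝ u (L (x - q))).comp
        (L : (Fin (d + 2 + 1) → ℝ) →L[ℝ] WittSpace d) := by
    intro u hu x
    have h1 : HasFDerivAt (fun x => L (x - q))
        (L : (Fin (d + 2 + 1) → ℝ) →L[ℝ] WittSpace d) x := by
      have h := L.hasFDerivAt.comp x ((hasFDerivAt_id x).sub_const q)
      rwa [ContinuousLinearMap.comp_id] at h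
    exact (((hu.differentiable one_ne_zero) _).hasFDerivAt.comp x h1).fderiv
  have hinv : ∀ u, S.IsInvariant w u → IsRelativeInvariant Γ fun x => u (L (x - q)) := by
    intro u hu
    refine ⟨hu.contDiff.comp (L.contDiff.comp (contDiff_id.sub contDiff_const)), fun X hX => ?_⟩
    obtain ⟨μ, hμ, hμu⟩ := hu.exists_multiplier ⟨X, hX⟩
    refine ⟨fun x => μ (L (x - q)), hμ.comp (L.continuous.comp (continuous_id.sub
      continuous_const)), fun x => ?_⟩
    obtain ⟨z, hz⟩ : ∃ z, x = q + Φ z := ⟨Φ.symm (x - q), by simp⟩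
    have e : L (q + Φ z - q) = w.coords S.Q_symm z := by rw [add_sub_cancel_left, hL]
    rw [hder u hu.contDiff, hz, hfield ⟨X, hX⟩ z]
    change fderiv ℝ u (L (q + Φ z - q)) (L (Φ _)) = μ (L (q + Φ z - q)) * u (L (q + Φ z - q))
    rw [e, hL]
    exact hμu z
  refine locallyAffinelyEquivalentAt_of_isRelativeInvariant hΓ hhom hconn hq (hinv P hP)
    (hinv t ht) (by simpa using hP0) (by simpa using ht0) (fun x hx h0 => ?_)
    (((AffineEquiv.constVAdd ℝ _ (-q)).trans L.toLinearEquiv.toAffineEquiv).trans g)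
    (fun x => ?_)
  · refine hdP _ hx ?_
    rw [hder P hP.contDiff] at h0
    refine ContinuousLinearMap.ext fun v => ?_
    have h1 := DFunLike.congr_fun h0 (L.symm v)
    simpa using h1
  · rw [AffineEquiv.trans_apply, AffineEquiv.trans_apply, hg]
    have : (AffineEquiv.constVAdd ℝ (Fin (d + 2 + 1) → ℝ) (-q)) x = x - q := by
      simp [sub_eq_neg_add]
    rw [this]
    rfl

section Standard

variable {d : ℕ}

/-- The identification of `WittSpace d` with `ℝ^{n+1}`. -/
noncomputable def standardEquiv (d : ℕ) : WittSpace d ≃ₗ[ℝ] (Fin (d + 2 + 1) → ℝ) :=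
  LinearEquiv.symm <| LinearEquiv.ofInjectiveOfFinrankEq
    { toFun := fun v => (coord v 1, coord v (d + 2), coord v (d + 2 + 1),
        fun i : Fin d => coord v (i + 2))
      map_add' := fun _ _ => rfl
      map_smul' := fun _ _ => rfl }
    (by
      refine (injective_iff_map_eq_zero _).2 fun v hv => ?_
      have h1 : coord v 1 = 0 := congrArg Prod.fst hv
      have h2 : coord v (d + 2) = 0 := congrArg (fun x => x.2.1) hv
      have h3 : coord v (d + 2 + 1) = 0 := congrArg (fun x => x.2.2.1) hv
      have h4 : ∀ i : Fin d, coord v (i + 2) = 0 := fun i => congrArg (fun x => x.2.2.2 i) hv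
      funext k
      have hk : ∀ m : ℕ, coord v m = 0 → (k : ℕ) = m - 1 → v k = 0 := by
        intro m hm hkm
        rw [← hm, coord, ← hkm]
        congr 1
        exact (Fin.ofNat_val_eq_self k).symm
      have hk1 := k.2
      by_cases c1 : (k : ℕ) = 0
      · exact hk 1 h1 (by omega)
      by_cases c2 : (k : ℕ) = d + 1
      · exact hk (d + 2) h2 (by omega)
      by_cases c3 : (k : ℕ) = d + 2
      · exact hk (d + 2 + 1) h3 (by omega)
      · exact hk _ (h4 ⟨k - 1, by omega⟩) (by simp; omega))
    (by simp [Module.finrank_prod]; ring)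

theorem standardEquiv_coord (x : WittSpace d) :
    coord (standardEquiv d x) 1 = x.1 ∧ coord (standardEquiv d x) (d + 2) = x.2.1 ∧
      coord (standardEquiv d x) (d + 2 + 1) = x.2.2.1 ∧
      ∀ i : Fin d, coord (standardEquiv d x) (i + 2) = x.2.2.2 i := by
  have h := (standardEquiv d).symm_apply_apply x
  exact ⟨congrArg Prod.fst h, congrArg (fun x => x.2.1) h, congrArg (fun x => x.2.2.1) h,
    fun i => congrArg (fun x => x.2.2.2 i) h⟩

theorem midSq_standardEquiv (x : WittSpace d) :
    midSq (standardEquiv d x) = ∑ i, x.2.2.2 i ^ 2 := by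
  obtain ⟨-, -, -, h⟩ := standardEquiv_coord x
  rw [midSq, show Finset.Icc 2 (d + 2 - 1) = Finset.Ico 2 (d + 2) by ext; simp; omega,
    Finset.sum_Ico_eq_sum_range, Nat.add_sub_cancel, Finset.sum_range]
  exact Finset.sum_congr rfl fun i _ => by rw [add_comm 2, h]

theorem coord_two_standardEquiv (hd : 0 < d) (x : WittSpace d) :
    coord (standardEquiv d x) 2 = x.2.2.2 ⟨0, hd⟩ := by
  obtain ⟨-, -, -, h⟩ := standardEquiv_coord x
  exact h ⟨0, hd⟩

/-- The linear change of coordinates that rescales dually `x₁` and `xₙ + ε xₙ₊₁`, and rescales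
the middle coordinates. -/
noncomputable def rescaleEquiv (d : ℕ) (a r ε : ℝ) (ha : a ≠ 0) (hr : r ≠ 0) :
    WittSpace d ≃ₗ[ℝ] WittSpace d where
  toFun x := (a * x.1, a⁻¹ * (x.2.1 + ε * x.2.2.1), x.2.2.1, fun i => r * x.2.2.2 i)
  map_add' x y := WittSpace.ext (by simp; ring) (by simp; ring) (by simp) (by simp [mul_add])
  map_smul' c x := WittSpace.ext (by simp; ring) (by simp; ring) (by simp)
    (fun i => by simp; ring)
  invFun x := (a⁻¹ * x.1, a * x.2.1 - ε * x.2.2.1, x.2.2.1, fun i => r⁻¹ * x.2.2.2 i)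
  left_inv x := WittSpace.ext (by simp [ha]) (by simp [ha]) rfl (by simp [hr])
  right_inv x := WittSpace.ext (by simp [ha]) (by simp [ha]) rfl (by simp [hr])

theorem rescaleEquiv_apply (a r ε : ℝ) (ha : a ≠ 0) (hr : r ≠ 0) (x : WittSpace d) :
    rescaleEquiv d a r ε ha hr x =
      (a * x.1, a⁻¹ * (x.2.1 + ε * x.2.2.1), x.2.2.1, fun i => r * x.2.2.2 i) := rfl

/-- The linear change of coordinates `xₙ₊₁ ↦ xₙ₊₁ + xₙ`. -/
def shearEquiv (d : ℕ) : WittSpace d ≃ₗ[ℝ] WittSpace d where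
  toFun x := (x.1, x.2.1, x.2.2.1 + x.2.1, x.2.2.2)
  map_add' x y := WittSpace.ext rfl rfl (by simp; ring) (fun _ => rfl)
  map_smul' c x := WittSpace.ext rfl rfl (by simp; ring) (fun _ => rfl)
  invFun x := (x.1, x.2.1, x.2.2.1 - x.2.1, x.2.2.2)
  left_inv x := WittSpace.ext rfl rfl (by simp) (fun _ => rfl)
  right_inv x := WittSpace.ext rfl rfl (by simp) (fun _ => rfl)

/-- The linear change of coordinates that swaps `x₁` and `xₙ` and changes the sign of `xₙ₊₁`. -/
def swapEquiv (d : ℕ) : WittSpace d ≃ₗ[ℝ] WittSpace d where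
  toFun x := (x.2.1, x.1, -x.2.2.1, x.2.2.2)
  map_add' x y := WittSpace.ext rfl rfl (by simp; ring) (fun _ => rfl)
  map_smul' c x := WittSpace.ext rfl rfl (by simp) (fun _ => rfl)
  invFun x := (x.2.1, x.1, -x.2.2.1, x.2.2.2)
  left_inv x := WittSpace.ext rfl rfl (by simp) (fun _ => rfl)
  right_inv x := WittSpace.ext rfl rfl (by simp) (fun _ => rfl)

end Standard

end AffineTube

namespace AffineTube

/-! ### Graph polynomials: types one to three. -/

section LineDerivative

variable {d : ℕ} (x v : WittSpace d)

theorem fderiv_apply_eq {E : Type*} [NormedAddCommGroup E] [NormedSpace ℝ E] {u : E → ℝ}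
    (hu : ContDiff ℝ 1 u) (x v : E) {c : ℝ} (h : HasDerivAt (fun s : ℝ => u (x + s • v)) c 0) :
    fderiv ℝ u x v = c := by
  rw [← ((hu.differentiable one_ne_zero) x).lineDeriv_eq_fderiv]
  exact h.deriv

theorem hasDerivAt_line (a b : ℝ) : HasDerivAt (fun s : ℝ => a + s * b) b 0 := by
  simpa using ((hasDerivAt_id (0 : ℝ)).mul_const b).const_add a

theorem hasDerivAt_line_one : HasDerivAt (fun s : ℝ => (x + s • v).1) v.1 0 :=
  hasDerivAt_line x.1 v.1

theorem hasDerivAt_line_two : HasDerivAt (fun s : ℝ => (x + s • v).2.1) v.2.1 0 :=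
  hasDerivAt_line x.2.1 v.2.1

theorem hasDerivAt_line_three : HasDerivAt (fun s : ℝ => (x + s • v).2.2.1) v.2.2.1 0 :=
  hasDerivAt_line x.2.2.1 v.2.2.1

theorem hasDerivAt_line_four (i : Fin d) :
    HasDerivAt (fun s : ℝ => (x + s • v).2.2.2 i) (v.2.2.2 i) 0 :=
  hasDerivAt_line (x.2.2.2 i) (v.2.2.2 i)

/-- The weighted sum of squares of the middle coordinates. -/
def sumSq (m : Fin d → ℝ) (x : WittSpace d) : ℝ := ∑ i, m i * x.2.2.2 i ^ 2

theorem contDiff_sumSq (m : Fin d → ℝ) : ContDiff ℝ 1 (sumSq m) := by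
  unfold sumSq
  fun_prop

theorem hasDerivAt_line_sumSq (m : Fin d → ℝ) : HasDerivAt (fun s : ℝ => sumSq m (x + s • v))
    (2 * ∑ i, m i * (x.2.2.2 i * v.2.2.2 i)) 0 := by
  have h := HasDerivAt.fun_sum (u := Finset.univ) fun i _ =>
    ((hasDerivAt_line_four x v i).pow 2).const_mul (m i)
  refine h.congr_deriv ?_
  rw [Finset.mul_sum]
  refine Finset.sum_congr rfl fun i _ => ?_
  simp
  ring

end LineDerivative

section Polynomial

variable {d : ℕ}

/-- The polynomial with zero set
`xₙ₊₁ = x₁ xₙ + (1 / 2) ∑ xᵢ ^ 2 + γ x₁ ^ 3 + l x₁ ^ 2 xⱼ + κ x₁ ^ 4`. -/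
noncomputable def graphPoly (j : Fin d) (γ l κ : ℝ) (x : WittSpace d) : ℝ :=
  x.2.2.1 - x.1 * x.2.1 - sumSq (fun _ => 1) x / 2 - γ * x.1 ^ 3 - l * (x.1 ^ 2 * x.2.2.2 j) -
    κ * x.1 ^ 4

theorem contDiff_graphPoly (j : Fin d) (γ l κ : ℝ) : ContDiff ℝ 1 (graphPoly j γ l κ) := by
  have h := contDiff_sumSq (d := d) fun _ => 1
  unfold graphPoly
  fun_prop

theorem fderiv_graphPoly (j : Fin d) (γ l κ : ℝ) (x v : WittSpace d) :
    fderiv ℝ (graphPoly j γ l κ) x v = v.2.2.1 - (x.1 * v.2.1 + x.2.1 * v.1 +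
      ∑ i, x.2.2.2 i * v.2.2.2 i) - 3 * γ * (x.1 ^ 2 * v.1) -
      l * (2 * (x.1 * x.2.2.2 j * v.1) + x.1 ^ 2 * v.2.2.2 j) - 4 * κ * (x.1 ^ 3 * v.1) := by
  have h1 := hasDerivAt_line_one x v
  have h := (((((hasDerivAt_line_three x v).sub (h1.mul (hasDerivAt_line_two x v))).sub
    ((hasDerivAt_line_sumSq x v fun _ => 1).div_const 2)).sub ((h1.pow 3).const_mul γ)).sub
    (((h1.pow 2).mul (hasDerivAt_line_four x v j)).const_mul l)).sub ((h1.pow 4).const_mul κ)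
  refine fderiv_apply_eq (contDiff_graphPoly j γ l κ) x v (h.congr_deriv ?_)
  simp
  ring

namespace SymmetryModel

variable {𝔤 T : Type*} [AddCommGroup 𝔤] [Module ℝ 𝔤] [AddCommGroup T] [Module ℝ T]
  [FiniteDimensional ℝ T] (S : SymmetryModel 𝔤 T) (w : WittBasis S.Q d)

/-- The polynomial is `xₙ₊₁ - Q/2 - C/6 - κ x₁⁴`, and each symmetry multiplies it by `a X`. Degree
by degree, the quadratic part is `compat`, the cubic part is `hK`, and the quartic part is `hA`. -/
theorem isInvariant_graphPoly (j : Fin d) (γ l κ : ℝ) (hw : ∀ X, S.w X = 0)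
    (hC : ∀ u v, S.C u u v = 6 * γ * (S.Q u w.f ^ 2 * S.Q v w.f) +
      2 * l * (2 * (S.Q u w.f * S.Q u (w.E j) * S.Q v w.f) + S.Q u w.f ^ 2 * S.Q v (w.E j)))
    (hK : ∀ X x, S.cubicDeriv X x x x = S.a X * S.C x x x -
      24 * κ * (S.Q (S.b X) w.f * S.Q x w.f ^ 3))
    (hA : κ = 0 ∨ ∀ X x, S.Q (S.A X x) w.f = S.a X / 4 * S.Q x w.f) :
    S.IsInvariant w (graphPoly j γ l κ) where
  contDiff := contDiff_graphPoly j γ l κ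
  exists_multiplier X := by
    refine ⟨fun _ => S.a X, continuous_const, fun x => ?_⟩
    obtain ⟨u, y⟩ := x
    have hQ := w.Q_eq S.Q_symm u (S.b X + S.A X u)
    have hQu := w.Q_eq S.Q_symm u u
    have hCv := hC u (S.b X + S.A X u)
    have hCu := hC u u
    have h1 := S.compat X u u
    have h2 := hK X u
    rw [S.cubicDeriv_apply, S.C_swap_left (S.A X u), S.C_swap_right u (S.A X u)] at h2
    have h3 : κ * S.Q (S.A X u) w.f = κ * (S.a X / 4 * S.Q u w.f) := by
      rcases hA with h | h
      · rw [h, zero_mul, zero_mul]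
      · rw [h]
    rw [S.C_swap_left (S.b X), S.C_swap_right u (S.b X)] at h1
    rw [fderiv_graphPoly, field, hw, smul_zero, add_zero]
    simp only [w.coords_apply, graphPoly, sumSq, one_mul]
    simp only [map_add, LinearMap.add_apply] at hQ hCv ⊢
    simp only [← sq] at hQu
    rw [S.Q_symm u (S.b X)] at hQ
    linear_combination hQ - (S.a X / 2) * hQu + (1 / 2) * hCv - (S.a X / 6) * hCu - (1 / 2) * h1 -
      (1 / 6) * h2 - 4 * (S.Q u w.f) ^ 3 * h3

theorem fderiv_graphPoly_ne_zero (j : Fin d) (γ l κ : ℝ) (x : WittSpace d) :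
    fderiv ℝ (graphPoly j γ l κ) x ≠ 0 := by
  intro h
  have h1 := fderiv_graphPoly j γ l κ x (0, 0, 1, 0)
  rw [h] at h1
  simp at h1

theorem hasNormalForm_of_graphPoly {j : Fin d} {γ l κ : ℝ}
    (h : S.IsInvariant w (graphPoly j γ l κ)) {M : Set (Fin (d + 2 + 1) → ℝ)}
    (hM : IsListedHypersurface (d + 2) M) (g : WittSpace d ≃ᵃ[ℝ] (Fin (d + 2 + 1) → ℝ))
    (hg : ∀ x, g x ∈ M ↔ graphPoly j γ l κ x = 0) : S.HasNormalForm w :=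
  ⟨graphPoly j γ l κ, fun _ => 1, h, S.isInvariant_const w 1, by simp [graphPoly, sumSq],
    one_ne_zero, fun x _ => fderiv_graphPoly_ne_zero j γ l κ x, M, hM, g, hg⟩

theorem hasNormalForm_quadric {j : Fin d} (h : S.IsInvariant w (graphPoly j 0 0 0)) :
    S.HasNormalForm w := by
  have hr : (√2)⁻¹ ≠ (0 : ℝ) := by positivity
  have hr2 : ((√2)⁻¹ : ℝ) ^ 2 = 1 / 2 := by rw [inv_pow, Real.sq_sqrt (by norm_num)]; norm_num
  refine S.hasNormalForm_of_graphPoly w h .quadric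
    ((rescaleEquiv d 1 (√2)⁻¹ 0 one_ne_zero hr).trans (standardEquiv d)).toAffineEquiv fun x => ?_
  change standardEquiv d (rescaleEquiv d 1 (√2)⁻¹ 0 one_ne_zero hr x) ∈ _ ↔ _
  obtain ⟨e1, e2, e3, -⟩ := standardEquiv_coord (rescaleEquiv d 1 (√2)⁻¹ 0 one_ne_zero hr x)
  rw [Set.mem_ofPred_eq, e1, e2, e3, midSq_standardEquiv, rescaleEquiv_apply, graphPoly, sumSq]
  simp only [mul_pow, hr2, ← Finset.mul_sum, one_mul, inv_one, zero_mul, add_zero, sub_zero]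
  constructor <;> intro h <;> linarith

theorem exists_cube_eq (γ : ℝ) : ∃ c : ℝ, c ^ 3 = γ := by
  rcases le_total 0 γ with h | h
  · exact ⟨γ ^ (((3 : ℕ) : ℝ)⁻¹), Real.rpow_inv_natCast_pow h (by norm_num)⟩
  · refine ⟨-(-γ) ^ (((3 : ℕ) : ℝ)⁻¹), ?_⟩
    rw [Odd.neg_pow (by decide), Real.rpow_inv_natCast_pow (neg_nonneg.2 h) (by norm_num), neg_neg]

theorem hasNormalForm_cubic {j : Fin d} {γ : ℝ} (hγ : γ ≠ 0)
    (h : S.IsInvariant w (graphPoly j γ 0 0)) : S.HasNormalForm w := by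
  obtain ⟨c, rfl⟩ := exists_cube_eq γ
  have hc : c ≠ 0 := by rintro rfl; simp at hγ
  have hr : (√2)⁻¹ ≠ (0 : ℝ) := by positivity
  have hr2 : ((√2)⁻¹ : ℝ) ^ 2 = 1 / 2 := by rw [inv_pow, Real.sq_sqrt (by norm_num)]; norm_num
  refine S.hasNormalForm_of_graphPoly w h .cubic
    ((rescaleEquiv d c (√2)⁻¹ 0 hc hr).trans (standardEquiv d)).toAffineEquiv fun x => ?_
  change standardEquiv d (rescaleEquiv d c (√2)⁻¹ 0 hc hr x) ∈ _ ↔ _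
  obtain ⟨e1, e2, e3, -⟩ := standardEquiv_coord (rescaleEquiv d c (√2)⁻¹ 0 hc hr x)
  rw [Set.mem_ofPred_eq, e1, e2, e3, midSq_standardEquiv, rescaleEquiv_apply, graphPoly, sumSq]
  simp only [mul_pow, hr2, ← Finset.mul_sum, one_mul, zero_mul, add_zero, sub_zero]
  have h1 : c * x.1 * (c⁻¹ * x.2.1) = x.1 * x.2.1 := by field_simp
  rw [h1]
  constructor <;> intro h <;> linarith

theorem hasNormalForm_winkelmann (hd : 0 < d) {l κ : ℝ} (hl : l ≠ 0)
    (h : S.IsInvariant w (graphPoly ⟨0, hd⟩ 0 l κ)) : S.HasNormalForm w := by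
  -- The factor `s` has to halve the squares, so its size is fixed and only `c` can absorb `|l|`;
  -- the sign of `l` goes into `s`.
  obtain ⟨c, s, hc, hs, hcs⟩ : ∃ c s : ℝ, c ≠ 0 ∧ s ^ 2 = 1 / 2 ∧ c ^ 2 * s = l := by
    have h2 : (√2 : ℝ) ^ 2 = 2 := Real.sq_sqrt (by norm_num)
    have h2' : √2 ≠ (0 : ℝ) := by positivity
    have hs2 : ((√2)⁻¹ : ℝ) ^ 2 = 1 / 2 := by rw [inv_pow, h2]; norm_num
    rcases lt_or_gt_of_ne hl with h | h
    · refine ⟨√(√2 * -l), -(√2)⁻¹, ?_, by rw [neg_sq, hs2], ?_⟩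
      · have : 0 < √2 * -l := mul_pos (by positivity) (by linarith)
        positivity
      · rw [Real.sq_sqrt (mul_nonneg (by positivity) (by linarith))]
        field_simp
    · refine ⟨√(√2 * l), (√2)⁻¹, ?_, hs2, ?_⟩
      · positivity
      · rw [Real.sq_sqrt (by positivity)]
        field_simp
  have hs0 : s ≠ 0 := by rintro rfl; norm_num at hs
  refine S.hasNormalForm_of_graphPoly w h (.winkelmann (κ / c ^ 4))
    ((rescaleEquiv d c s 0 hc hs0).trans (standardEquiv d)).toAffineEquiv fun x => ?_
  change standardEquiv d (rescaleEquiv d c s 0 hc hs0 x) ∈ _ ↔ _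
  obtain ⟨e1, e2, e3, -⟩ := standardEquiv_coord (rescaleEquiv d c s 0 hc hs0 x)
  rw [Set.mem_ofPred_eq, e1, e2, e3, midSq_standardEquiv, coord_two_standardEquiv hd,
    rescaleEquiv_apply, graphPoly, sumSq]
  simp only [mul_pow, hs, ← Finset.mul_sum, one_mul, zero_mul, add_zero, sub_zero]
  have h1 : c * x.1 * (c⁻¹ * x.2.1) = x.1 * x.2.1 := by field_simp
  have h2 : c ^ 2 * x.1 ^ 2 * (s * x.2.2.2 ⟨0, hd⟩) = l * (x.1 ^ 2 * x.2.2.2 ⟨0, hd⟩) := by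
    rw [← hcs]; ring
  have h3 : κ / c ^ 4 * (c ^ 4 * x.1 ^ 4) = κ * x.1 ^ 4 := by field_simp
  rw [h1, h2, h3]
  constructor <;> intro h <;> linarith

end SymmetryModel

end Polynomial

end AffineTube

namespace AffineTube

/-! ### Invariant polynomials of types four to seven. -/

/-- The quadratic form of a matrix whose symmetric part is diagonal, on the coordinates selected
by a weight constant on the blocks of the matrix. -/
theorem sum_mul_sum_of_blocks {d : ℕ} (m x ρ : Fin d → ℝ) (R : Fin d → Fin d → ℝ)
    (hR : ∀ i j, R i j + R j i = if i = j then ρ i else 0)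
    (hm : ∀ i j, m i ≠ m j → R i j = 0) :
    ∑ i, m i * (x i * ∑ j, x j * R j i) = (1 / 2) * ∑ i, m i * (ρ i * x i ^ 2) := by
  have h1 : ∑ i, m i * (x i * ∑ j, x j * R j i) = ∑ i, ∑ j, m i * (x i * x j) * R j i :=
    Finset.sum_congr rfl fun i _ => by
      rw [Finset.mul_sum, Finset.mul_sum]
      exact Finset.sum_congr rfl fun j _ => by ring
  have h2 : ∑ i, ∑ j, m i * (x i * x j) * R j i = ∑ i, ∑ j, m i * (x i * x j) * R i j := by
    rw [Finset.sum_comm]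
    refine Finset.sum_congr rfl fun i _ => Finset.sum_congr rfl fun j _ => ?_
    by_cases h : m i = m j
    · rw [h]; ring
    · rw [hm i j h, mul_zero, mul_zero]
  have h3 : ∑ i, ∑ j, m i * (x i * x j) * R j i + ∑ i, ∑ j, m i * (x i * x j) * R i j =
      ∑ i, m i * (ρ i * x i ^ 2) := by
    rw [← Finset.sum_add_distrib]
    refine Finset.sum_congr rfl fun i _ => ?_
    rw [← Finset.sum_add_distrib]
    simp only [← mul_add, add_comm (R _ i), hR]
    simp
    ring
  rw [h1]
  linarith

section Polynomial

variable {d : ℕ}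

/-- The defining function of the models of types four and six. -/
noncomputable def cubicPoly (m : Fin d → ℝ) (β c : ℝ) (x : WittSpace d) : ℝ :=
  x.2.2.1 - x.1 * (x.2.1 + β / 2 * x.2.2.1) -
    (1 / 2) * (sumSq (fun i => 1 - m i) x + sumSq m x) - c / 2 * (x.1 * sumSq m x)

/-- The defining function of the models of types five and seven. -/
noncomputable def rationalPoly (m : Fin d → ℝ) (β c : ℝ) (x : WittSpace d) : ℝ :=
  (1 - c * x.1) * (x.2.2.1 - x.1 * (x.2.1 + β / 2 * x.2.2.1) -
    (1 / 2) * sumSq (fun i => 1 - m i) x) - (1 / 2) * sumSq m x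

theorem contDiff_cubicPoly (m : Fin d → ℝ) (β c : ℝ) : ContDiff ℝ 1 (cubicPoly m β c) := by
  have h1 := contDiff_sumSq m
  have h2 := contDiff_sumSq fun i => 1 - m i
  unfold cubicPoly
  fun_prop

theorem contDiff_rationalPoly (m : Fin d → ℝ) (β c : ℝ) : ContDiff ℝ 1 (rationalPoly m β c) := by
  have h1 := contDiff_sumSq m
  have h2 := contDiff_sumSq fun i => 1 - m i
  unfold rationalPoly
  fun_prop

theorem fderiv_cubicPoly (m : Fin d → ℝ) (β c : ℝ) (x v : WittSpace d) :
    fderiv ℝ (cubicPoly m β c) x v =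
      v.2.2.1 - (v.1 * (x.2.1 + β / 2 * x.2.2.1) + x.1 * (v.2.1 + β / 2 * v.2.2.1)) -
        (∑ i, (1 - m i) * (x.2.2.2 i * v.2.2.2 i) + ∑ i, m i * (x.2.2.2 i * v.2.2.2 i)) -
        c / 2 * (v.1 * sumSq m x + 2 * (x.1 * ∑ i, m i * (x.2.2.2 i * v.2.2.2 i))) := by
  have h1 := hasDerivAt_line_one x v
  have h3 := hasDerivAt_line_three x v
  have hm := hasDerivAt_line_sumSq x v m
  have h := ((h3.sub (h1.mul ((hasDerivAt_line_two x v).add (h3.const_mul (β / 2))))).sub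
    (((hasDerivAt_line_sumSq x v fun i => 1 - m i).add hm).const_mul (1 / 2))).sub
    ((h1.mul hm).const_mul (c / 2))
  refine fderiv_apply_eq (contDiff_cubicPoly m β c) x v (h.congr_deriv ?_)
  simp
  ring

theorem fderiv_rationalPoly (m : Fin d → ℝ) (β c : ℝ) (x v : WittSpace d) :
    fderiv ℝ (rationalPoly m β c) x v =
      -(c * v.1) * (x.2.2.1 - x.1 * (x.2.1 + β / 2 * x.2.2.1) -
        (1 / 2) * sumSq (fun i => 1 - m i) x) +
      (1 - c * x.1) * (v.2.2.1 - (v.1 * (x.2.1 + β / 2 * x.2.2.1) +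
        x.1 * (v.2.1 + β / 2 * v.2.2.1)) - ∑ i, (1 - m i) * (x.2.2.2 i * v.2.2.2 i)) -
      ∑ i, m i * (x.2.2.2 i * v.2.2.2 i) := by
  have h1 := hasDerivAt_line_one x v
  have h3 := hasDerivAt_line_three x v
  have h := (((h1.const_mul c).const_sub 1).mul
    ((h3.sub (h1.mul ((hasDerivAt_line_two x v).add (h3.const_mul (β / 2))))).sub
      ((hasDerivAt_line_sumSq x v fun i => 1 - m i).const_mul (1 / 2)))).sub
    ((hasDerivAt_line_sumSq x v m).const_mul (1 / 2))
  refine fderiv_apply_eq (contDiff_rationalPoly m β c) x v (h.congr_deriv ?_)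
  simp

theorem fderiv_one_sub (c : ℝ) (x v : WittSpace d) :
    fderiv ℝ (fun x : WittSpace d => 1 - c * x.1) x v = -(c * v.1) :=
  fderiv_apply_eq (by fun_prop) x v (((hasDerivAt_line_one x v).const_mul c).const_sub 1)

theorem fderiv_cubicPoly_ne_zero (m : Fin d → ℝ) (β c : ℝ) (x : WittSpace d) :
    fderiv ℝ (cubicPoly m β c) x ≠ 0 := by
  intro h
  -- In this direction `x₁` and `xₙ + (β/2) xₙ₊₁` do not change, so only the linear term `xₙ₊₁`
  -- contributes.
  have h1 := fderiv_cubicPoly m β c x (0, -β / 2, 1, 0)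
  rw [h] at h1
  simp at h1
  rw [neg_div, neg_add_cancel] at h1
  norm_num at h1

theorem fderiv_rationalPoly_ne_zero (m : Fin d → ℝ) (β c : ℝ) (x : WittSpace d)
    (hx : 1 - c * x.1 ≠ 0) : fderiv ℝ (rationalPoly m β c) x ≠ 0 := by
  intro h
  have h1 := fderiv_rationalPoly m β c x (0, -β / 2, 1, 0)
  rw [h] at h1
  simp at h1
  rcases h1 with h1 | h1
  · exact hx h1
  · rw [neg_div, neg_add_cancel] at h1
    norm_num at h1

end Polynomial

namespace DiagonalModel

variable {𝔤 T : Type*} [AddCommGroup 𝔤] [Module ℝ 𝔤] [AddCommGroup T] [Module ℝ T]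
  [FiniteDimensional ℝ T] {d : ℕ} (G : DiagonalModel 𝔤 T d)

section Field

variable (X : 𝔤) (x : T × ℝ)

theorem field_f : G.Q (G.field X x).1 G.wit.f =
    G.Q (G.b X) G.wit.f + G.Q x.1 G.wit.f * (G.ν * G.Q (G.b X) G.wit.f) := by
  have h := G.wit.map_eq (G.Q.flip G.wit.f ∘ₗ G.A X) x.1
  simp only [LinearMap.comp_apply, LinearMap.flip_apply, smul_eq_mul, G.A_ef, G.A_ff, G.A_Ef,
    mul_zero, Finset.sum_const_zero, add_zero] at h
  simp only [SymmetryModel.field, map_add, LinearMap.add_apply, map_smul, LinearMap.smul_apply,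
    G.w_eq_smul, G.wit.ff, h, smul_zero, add_zero]

theorem field_e : G.Q (G.field X x).1 G.wit.e =
    G.Q (G.b X) G.wit.e - G.β / 2 * (G.Q x.1 G.wit.f * G.Q (G.b X) G.wit.e) +
      G.Q x.1 G.wit.e * (G.a X - (G.β + G.ν) * G.Q (G.b X) G.wit.f) -
      (∑ i, G.q i * (G.Q x.1 (G.wit.E i) * G.Q (G.b X) (G.wit.E i)) +
        ∑ i, G.Q x.1 (G.wit.E i) * G.Q (G.A X G.wit.e) (G.wit.E i)) +
      x.2 * (G.τ * G.Q (G.b X) G.wit.f) := by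
  have h := G.wit.map_eq (G.Q.flip G.wit.e ∘ₗ G.A X) x.1
  simp only [LinearMap.comp_apply, LinearMap.flip_apply, smul_eq_mul, G.A_ee, G.A_fe, G.A_Ee,
    G.A_ef] at h
  have h1 : ∑ i, G.Q x.1 (G.wit.E i) * (-(G.q i * G.Q (G.b X) (G.wit.E i)) -
      G.Q (G.A X G.wit.e) (G.wit.E i)) =
      -(∑ i, G.q i * (G.Q x.1 (G.wit.E i) * G.Q (G.b X) (G.wit.E i)) +
        ∑ i, G.Q x.1 (G.wit.E i) * G.Q (G.A X G.wit.e) (G.wit.E i)) := by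
    rw [← Finset.sum_add_distrib, ← Finset.sum_neg_distrib]
    exact Finset.sum_congr rfl fun i _ => by ring
  rw [h1] at h
  simp only [SymmetryModel.field, map_add, LinearMap.add_apply, map_smul, LinearMap.smul_apply,
    G.w_eq_smul, G.fe, h, smul_eq_mul]
  ring

theorem field_E (i) : G.Q (G.field X x).1 (G.wit.E i) =
    G.Q (G.b X) (G.wit.E i) + G.Q x.1 G.wit.f * G.Q (G.A X G.wit.e) (G.wit.E i) +
      ∑ j, G.Q x.1 (G.wit.E j) * G.Q (G.A X (G.wit.E j)) (G.wit.E i) := by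
  have h := G.wit.map_eq (G.Q.flip (G.wit.E i) ∘ₗ G.A X) x.1
  simp only [LinearMap.comp_apply, LinearMap.flip_apply, smul_eq_mul, G.A_fE, mul_zero,
    add_zero] at h
  simp only [SymmetryModel.field, map_add, LinearMap.add_apply, map_smul, LinearMap.smul_apply,
    G.w_eq_smul, G.wit.fE, smul_zero, add_zero, h]
  ring

/-- Rotations inside the blocks of the mask cancel; only the diagonal symmetric part given by `A_EE`
survives. -/
theorem sum_mul_field_E (m : Fin d → ℝ)
    (hA : ∀ i j, m i ≠ m j → G.Q (G.A X (G.wit.E i)) (G.wit.E j) = 0) :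
    ∑ i, m i * (G.Q x.1 (G.wit.E i) * G.Q (G.field X x).1 (G.wit.E i)) =
      ∑ i, m i * (G.Q x.1 (G.wit.E i) * G.Q (G.b X) (G.wit.E i)) +
      G.Q x.1 G.wit.f * ∑ i, m i * (G.Q x.1 (G.wit.E i) * G.Q (G.A X G.wit.e) (G.wit.E i)) +
      (1 / 2) * ∑ i, m i * ((G.a X - G.q i * G.Q (G.b X) G.wit.f) * G.Q x.1 (G.wit.E i) ^ 2) := by
  have h := sum_mul_sum_of_blocks m (fun i => G.Q x.1 (G.wit.E i))
    (fun i => G.a X - G.q i * G.Q (G.b X) G.wit.f)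
    (fun i j => G.Q (G.A X (G.wit.E i)) (G.wit.E j)) (G.A_EE X) hA
  rw [← h, Finset.mul_sum, ← Finset.sum_add_distrib, ← Finset.sum_add_distrib]
  refine Finset.sum_congr rfl fun i _ => ?_
  rw [G.field_E]
  ring

end Field

section Mask

variable {m : Fin d → ℝ} {c : ℝ}

theorem q_of_ne (hm : ∀ i, m i = 0 ∨ m i = 1) (hq : ∀ i, G.q i = G.β / 2 + c * m i) (i)
    (hi : G.q i ≠ G.β / 2) : G.q i = G.β / 2 + c := by
  rcases hm i with h | h
  · exact absurd (by rw [hq, h]; ring) hi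
  · rw [hq, h, mul_one]

theorem q_ne_of_mask (hq : ∀ i, G.q i = G.β / 2 + c * m i) (hc : c ≠ 0) {i} (hi : m i = 1) :
    G.q i ≠ G.β / 2 := by
  rw [hq, hi]; intro h; exact hc (by linarith)

theorem A_blocks (hm : ∀ i, m i = 0 ∨ m i = 1) (hq : ∀ i, G.q i = G.β / 2 + c * m i) (hc : c ≠ 0)
    (X : 𝔤) (i j) (hij : m i ≠ m j) : G.Q (G.A X (G.wit.E i)) (G.wit.E j) = 0 := by
  have h0 : ∀ i, m i = 0 → G.q i = G.β / 2 := fun i hi => by rw [hq, hi]; ring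
  rcases hm i with hi | hi <;> rcases hm j with hj | hj
  · exact absurd (hi.trans hj.symm) hij
  · exact G.A_cross X (h0 i hi) (G.q_ne_of_mask hq hc hj)
  · exact G.A_cross' X (h0 j hj) (G.q_ne_of_mask hq hc hi)
  · exact absurd (hi.trans hj.symm) hij

theorem mask_mul_A_eE (hm : ∀ i, m i = 0 ∨ m i = 1) (hq : ∀ i, G.q i = G.β / 2 + c * m i)
    (hc : c ≠ 0) (X : 𝔤) (i) : m i * G.Q (G.A X G.wit.e) (G.wit.E i) =
    m i * ((G.ν - c) / 2 * G.Q (G.b X) (G.wit.E i)) := by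
  rcases hm i with hi | hi
  · rw [hi, zero_mul, zero_mul]
  · rw [G.A_eE_eq (G.q_of_ne hm hq) X (G.q_ne_of_mask hq hc hi)]
    ring

theorem ν_eq_or (hm : ∀ i, m i = 0 ∨ m i = 1) (hq : ∀ i, G.q i = G.β / 2 + c * m i) :
    G.ν = c ∨ G.ν = -c := by
  rcases mul_eq_zero.1 (G.quadratic (G.q_of_ne hm hq)) with h | h
  · exact Or.inl (by linarith)
  · exact Or.inr (by linarith)

/-- The components of the symmetries in terms of sums over the two groups of coordinates. -/
theorem exists_field_components (hm : ∀ i, m i = 0 ∨ m i = 1)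
    (hq : ∀ i, G.q i = G.β / 2 + c * m i) (hc : c ≠ 0) (X : 𝔤) (x : T × ℝ) : ∃ B B' U : ℝ,
    (G.field X x).2 = G.Q (G.b X) G.wit.f * G.Q x.1 G.wit.e +
      G.Q (G.b X) G.wit.e * G.Q x.1 G.wit.f + (B' + B) + x.2 * G.a X ∧
    G.Q (G.field X x).1 G.wit.e = G.Q (G.b X) G.wit.e -
      G.β / 2 * (G.Q x.1 G.wit.f * G.Q (G.b X) G.wit.e) +
      G.Q x.1 G.wit.e * (G.a X - (G.β + G.ν) * G.Q (G.b X) G.wit.f) -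
      (G.β / 2 * (B' + B) + c * B + ((G.ν - c) / 2 * B + U)) +
      x.2 * (G.τ * G.Q (G.b X) G.wit.f) ∧
    ∑ i, m i * (G.Q x.1 (G.wit.E i) * G.Q (G.field X x).1 (G.wit.E i)) =
      B + G.Q x.1 G.wit.f * ((G.ν - c) / 2 * B) + (1 / 2) *
        ((G.a X - (G.β / 2 + c) * G.Q (G.b X) G.wit.f) *
          ∑ i, m i * G.Q x.1 (G.wit.E i) ^ 2) ∧
    ∑ i, (1 - m i) * (G.Q x.1 (G.wit.E i) * G.Q (G.field X x).1 (G.wit.E i)) =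
      B' + G.Q x.1 G.wit.f * U + (1 / 2) *
        ((G.a X - G.β / 2 * G.Q (G.b X) G.wit.f) *
          ∑ i, (1 - m i) * G.Q x.1 (G.wit.E i) ^ 2) := by
  have hmm : ∀ i, m i * m i = m i := fun i => by rcases hm i with h | h <;> rw [h] <;> norm_num
  have hv := G.mask_mul_A_eE hm hq hc X
  refine ⟨∑ i, m i * (G.Q x.1 (G.wit.E i) * G.Q (G.b X) (G.wit.E i)),
    ∑ i, (1 - m i) * (G.Q x.1 (G.wit.E i) * G.Q (G.b X) (G.wit.E i)),
    ∑ i, (1 - m i) * (G.Q x.1 (G.wit.E i) * G.Q (G.A X G.wit.e) (G.wit.E i)), ?_, ?_, ?_, ?_⟩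
  · rw [← Finset.sum_add_distrib]
    change G.Q (G.b X) x.1 + x.2 * G.a X = _
    rw [G.wit.Q_eq G.Q_symm (G.b X) x.1]
    congr 2
    exact Finset.sum_congr rfl fun i _ => by ring
  · rw [G.field_e]
    congr 2
    simp only [Finset.mul_sum, ← Finset.sum_add_distrib]
    refine Finset.sum_congr rfl fun i _ => ?_
    rw [hq]
    linear_combination G.Q x.1 (G.wit.E i) * hv i
  · rw [G.sum_mul_field_E X x m (G.A_blocks hm hq hc X)]
    congr 2
    · congr 1
      rw [Finset.mul_sum]
      exact Finset.sum_congr rfl fun i _ => by linear_combination G.Q x.1 (G.wit.E i) * hv i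
    · rw [Finset.mul_sum]
      refine Finset.sum_congr rfl fun i _ => ?_
      rw [hq]
      linear_combination -(c * G.Q (G.b X) G.wit.f * G.Q x.1 (G.wit.E i) ^ 2) * hmm i
  · rw [G.sum_mul_field_E X x (fun i => 1 - m i) fun i j hij =>
      G.A_blocks hm hq hc X i j fun h => hij (by rw [h])]
    congr 2
    rw [Finset.mul_sum]
    refine Finset.sum_congr rfl fun i _ => ?_
    rw [hq]
    linear_combination (c * G.Q (G.b X) G.wit.f * G.Q x.1 (G.wit.E i) ^ 2) * hmm i

/-- For `ν = c` the masked part of `A X e` vanishes. The unmasked part enters only through its sum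
`U`, which cancels between the `xₙ`-component and the unmasked squares; `two_mul_τ` handles the
terms with `xₙ₊₁`. -/
theorem isInvariant_cubicPoly (hm : ∀ i, m i = 0 ∨ m i = 1)
    (hq : ∀ i, G.q i = G.β / 2 + c * m i) (hc : c ≠ 0) (hν : G.ν = c) :
    G.toSymmetryModel.IsInvariant G.wit (cubicPoly m G.β c) where
  contDiff := contDiff_cubicPoly m G.β c
  exists_multiplier X := by
    refine ⟨fun _ => G.a X - G.β / 2 * G.Q (G.b X) G.wit.f, continuous_const, fun x => ?_⟩
    obtain ⟨B, B', U, h1, h2, h3, h4⟩ := G.exists_field_components hm hq hc X x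
    have hτ := G.two_mul_τ
    have h5 := G.field_f X x
    rw [fderiv_cubicPoly]
    simp only [cubicPoly, sumSq, WittBasis.coords_apply]
    rw [h1, h2, h3, h4, h5, hν]
    rw [hν] at hτ
    linear_combination (-x.2 * G.Q x.1 G.wit.f * G.Q (G.b X) G.wit.f / 2) * hτ

/-- By `field_f` a symmetry changes `x₁` at the rate `Q (b X) f (1 + ν x₁)`. The hyperplane where
this factor vanishes is preserved, and it is exactly where the differential of `rationalPoly` may
vanish. -/
theorem isInvariant_one_sub (hν : G.ν = -c) :
    G.toSymmetryModel.IsInvariant G.wit (fun x => 1 - c * x.1) where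
  contDiff := by fun_prop
  exists_multiplier X := by
    refine ⟨fun _ => -c * G.Q (G.b X) G.wit.f, continuous_const, fun x => ?_⟩
    have h5 := G.field_f X x
    rw [fderiv_one_sub]
    simp only [WittBasis.coords_apply]
    rw [h5, hν]
    ring

theorem isInvariant_rationalPoly (hm : ∀ i, m i = 0 ∨ m i = 1)
    (hq : ∀ i, G.q i = G.β / 2 + c * m i) (hc : c ≠ 0) (hν : G.ν = -c) :
    G.toSymmetryModel.IsInvariant G.wit (rationalPoly m G.β c) where
  contDiff := contDiff_rationalPoly m G.β c
  exists_multiplier X := by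
    refine ⟨fun _ => G.a X - (G.β / 2 + c) * G.Q (G.b X) G.wit.f, continuous_const, fun x => ?_⟩
    obtain ⟨B, B', U, h1, h2, h3, h4⟩ := G.exists_field_components hm hq hc X x
    have hτ := G.two_mul_τ
    have h5 := G.field_f X x
    rw [fderiv_rationalPoly]
    simp only [rationalPoly, sumSq, WittBasis.coords_apply]
    rw [h1, h2, h3, h4, h5, hν]
    rw [hν] at hτ
    linear_combination
      (-x.2 * G.Q x.1 G.wit.f * G.Q (G.b X) G.wit.f / 2 * (1 - c * G.Q x.1 G.wit.f)) * hτ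

end Mask

end DiagonalModel

end AffineTube

namespace AffineTube

/-! ### Affine reduction to the listed equations, and assembly of the cases. -/

namespace SymmetryModel

variable {𝔤 T : Type*} [AddCommGroup 𝔤] [Module ℝ 𝔤] [AddCommGroup T] [Module ℝ T]
  [FiniteDimensional ℝ T] (S : SymmetryModel 𝔤 T) {d : ℕ} (w : WittBasis S.Q d)

theorem hasNormalForm_of_cubicPoly {m : Fin d → ℝ} {β c : ℝ}
    (h : S.IsInvariant w (cubicPoly m β c)) {M : Set (Fin (d + 2 + 1) → ℝ)}
    (hM : IsListedHypersurface (d + 2) M) (g : WittSpace d ≃ᵃ[ℝ] (Fin (d + 2 + 1) → ℝ))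
    (hg : ∀ x, g x ∈ M ↔ cubicPoly m β c x = 0) : S.HasNormalForm w :=
  ⟨cubicPoly m β c, fun _ => 1, h, S.isInvariant_const w 1, by simp [cubicPoly, sumSq],
    one_ne_zero, fun x _ => fderiv_cubicPoly_ne_zero m β c x, M, hM, g, hg⟩

theorem hasNormalForm_of_rationalPoly {m : Fin d → ℝ} {β c : ℝ}
    (h : S.IsInvariant w (rationalPoly m β c)) (ht : S.IsInvariant w fun x => 1 - c * x.1)
    {M : Set (Fin (d + 2 + 1) → ℝ)}
    (hM : IsListedHypersurface (d + 2) M) (g : WittSpace d ≃ᵃ[ℝ] (Fin (d + 2 + 1) → ℝ))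
    (hg : ∀ x, g x ∈ M ↔ rationalPoly m β c x = 0) : S.HasNormalForm w :=
  ⟨rationalPoly m β c, fun x => 1 - c * x.1, h, ht, by simp [rationalPoly, sumSq],
    by simp, fun x hx => fderiv_rationalPoly_ne_zero m β c x hx, M, hM, g, hg⟩

theorem inv_sqrt_two_sq : ((√2)⁻¹ : ℝ) ^ 2 = 1 / 2 := by
  rw [inv_pow, Real.sq_sqrt (by norm_num)]; norm_num

/-- When every middle square is masked, they are all multiplied by `1 + c x₁`, which the translation
makes the new `x₁`. The shear compensates the linear term created by the translation, and rescaling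
with `ε = β/2` absorbs β into `xₙ`. -/
theorem hasNormalForm_typeFour {β c : ℝ} (hc : c ≠ 0)
    (h : S.IsInvariant w (cubicPoly (fun _ => 1) β c)) : S.HasNormalForm w := by
  have hr : (√2)⁻¹ ≠ (0 : ℝ) := by positivity
  refine S.hasNormalForm_of_cubicPoly w h .typeFour
    (((((rescaleEquiv d c (√2)⁻¹ (β / 2) hc hr).trans (shearEquiv d)).toAffineEquiv).trans
      (AffineEquiv.constVAdd ℝ (WittSpace d) ((1, 0, 0, 0) : WittSpace d))).trans
      (standardEquiv d).toAffineEquiv) fun x => ?_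
  change standardEquiv d ((1, 0, 0, 0) + shearEquiv d (rescaleEquiv d c (√2)⁻¹ (β / 2) hc hr x)) ∈
    _ ↔ _
  obtain ⟨e1, e2, e3, -⟩ := standardEquiv_coord
    ((1, 0, 0, 0) + shearEquiv d (rescaleEquiv d c (√2)⁻¹ (β / 2) hc hr x))
  rw [Set.mem_ofPred_eq, e1, e2, e3, midSq_standardEquiv, rescaleEquiv_apply, cubicPoly, sumSq,
    sumSq]
  have hs : shearEquiv d (c * x.1, c⁻¹ * (x.2.1 + β / 2 * x.2.2.1), x.2.2.1,
      fun i => (√2)⁻¹ * x.2.2.2 i) = (c * x.1, c⁻¹ * (x.2.1 + β / 2 * x.2.2.1),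
      x.2.2.1 + c⁻¹ * (x.2.1 + β / 2 * x.2.2.1), fun i => (√2)⁻¹ * x.2.2.2 i) := rfl
  rw [hs]
  simp only [Prod.mk_add_mk, zero_add, mul_pow, inv_sqrt_two_sq, ← Finset.mul_sum, sub_self,
    zero_mul, Finset.sum_const_zero, one_mul]
  have h1 : (1 + c * x.1) * (c⁻¹ * (x.2.1 + β / 2 * x.2.2.1)) =
      c⁻¹ * (x.2.1 + β / 2 * x.2.2.1) + x.1 * (x.2.1 + β / 2 * x.2.2.1) := by field_simp
  rw [h1]
  constructor <;> intro h <;> linear_combination h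

theorem sumSq_single (i₀ : Fin d) (x : WittSpace d) :
    sumSq (fun i => if i = i₀ then 1 else 0) x = x.2.2.2 i₀ ^ 2 := by
  simp [sumSq]

theorem sumSq_one_sub (m : Fin d → ℝ) (x : WittSpace d) :
    sumSq (fun i => 1 - m i) x = ∑ i, x.2.2.2 i ^ 2 - sumSq m x := by
  rw [sumSq, sumSq, ← Finset.sum_sub_distrib]
  exact Finset.sum_congr rfl fun i _ => by ring

theorem hasNormalForm_typeSix (hd : 0 < d) {β c : ℝ} (hc : c ≠ 0)
    (h : S.IsInvariant w (cubicPoly (fun i => if i = ⟨0, hd⟩ then 1 else 0) β c)) :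
    S.HasNormalForm w := by
  have hr : (√2)⁻¹ ≠ (0 : ℝ) := by positivity
  refine S.hasNormalForm_of_cubicPoly w h .typeSix
    ((rescaleEquiv d c (√2)⁻¹ (β / 2) hc hr).trans (standardEquiv d)).toAffineEquiv fun x => ?_
  change standardEquiv d (rescaleEquiv d c (√2)⁻¹ (β / 2) hc hr x) ∈ _ ↔ _
  obtain ⟨e1, e2, e3, -⟩ := standardEquiv_coord (rescaleEquiv d c (√2)⁻¹ (β / 2) hc hr x)
  rw [Set.mem_ofPred_eq, e1, e2, e3, midSq_standardEquiv, coord_two_standardEquiv hd,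
    rescaleEquiv_apply, cubicPoly, sumSq_one_sub, sumSq_single]
  simp only [mul_pow, inv_sqrt_two_sq, ← Finset.mul_sum]
  have h1 : c * x.1 * (c⁻¹ * (x.2.1 + β / 2 * x.2.2.1)) =
      x.1 * (x.2.1 + β / 2 * x.2.2.1) := by field_simp
  rw [h1]
  constructor <;> intro h <;> linear_combination h

theorem swap_rescale_apply {c ε : ℝ} (hc : c ≠ 0) (x : WittSpace d) :
    swapEquiv d (rescaleEquiv d c 1 ε hc one_ne_zero x) =
      (c⁻¹ * (x.2.1 + ε * x.2.2.1), c * x.1, -x.2.2.1, fun i => x.2.2.2 i) := by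
  rw [rescaleEquiv_apply]
  simp only [one_mul]
  rfl

/-- The listed form has its factor `1 - 2 xₙ` in the variable `xₙ`: hence the swap, and rescaling by
`c / 2` rather than `c`. -/
theorem hasNormalForm_typeFive {β c : ℝ} (hc : c ≠ 0)
    (h : S.IsInvariant w (rationalPoly (fun _ => 1) β c))
    (ht : S.IsInvariant w fun x => 1 - c * x.1) : S.HasNormalForm w := by
  have hc2 : c / 2 ≠ 0 := by positivity
  refine S.hasNormalForm_of_rationalPoly w h ht .typeFive
    (((rescaleEquiv d (c / 2) 1 (β / 2) hc2 one_ne_zero).trans (swapEquiv d)).trans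
      (standardEquiv d)).toAffineEquiv fun x => ?_
  change standardEquiv d (swapEquiv d (rescaleEquiv d (c / 2) 1 (β / 2) hc2 one_ne_zero x)) ∈ _ ↔ _
  rw [swap_rescale_apply]
  obtain ⟨e1, e2, e3, -⟩ := standardEquiv_coord ((c / 2)⁻¹ * (x.2.1 + β / 2 * x.2.2.1),
    c / 2 * x.1, -x.2.2.1, fun i => x.2.2.2 i)
  rw [Set.mem_ofPred_eq, e1, e2, e3, midSq_standardEquiv, rationalPoly, sumSq_one_sub, sumSq]
  simp only [one_mul]
  have h1 : (c / 2)⁻¹ * (x.2.1 + β / 2 * x.2.2.1) * (c / 2 * x.1) =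
      x.1 * (x.2.1 + β / 2 * x.2.2.1) := by field_simp
  constructor <;> intro h
  · linear_combination h + (1 - c * x.1) * h1
  · linear_combination h - (1 - c * x.1) * h1

theorem hasNormalForm_typeSeven (hd : 0 < d) {β c : ℝ} (hc : c ≠ 0)
    (h : S.IsInvariant w (rationalPoly (fun i => if i = ⟨0, hd⟩ then 1 else 0) β c))
    (ht : S.IsInvariant w fun x => 1 - c * x.1) : S.HasNormalForm w := by
  have hc2 : c / 2 ≠ 0 := by positivity
  refine S.hasNormalForm_of_rationalPoly w h ht .typeSeven
    (((rescaleEquiv d (c / 2) 1 (β / 2) hc2 one_ne_zero).trans (swapEquiv d)).trans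
      (standardEquiv d)).toAffineEquiv fun x => ?_
  change standardEquiv d (swapEquiv d (rescaleEquiv d (c / 2) 1 (β / 2) hc2 one_ne_zero x)) ∈ _ ↔ _
  rw [swap_rescale_apply]
  obtain ⟨e1, e2, e3, -⟩ := standardEquiv_coord ((c / 2)⁻¹ * (x.2.1 + β / 2 * x.2.2.1),
    c / 2 * x.1, -x.2.2.1, fun i => x.2.2.2 i)
  rw [Set.mem_ofPred_eq, e1, e2, e3, midSq_standardEquiv, coord_two_standardEquiv hd,
    rationalPoly, sumSq_one_sub, sumSq_single]
  have h1 : (c / 2)⁻¹ * (x.2.1 + β / 2 * x.2.2.1) * (c / 2 * x.1) =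
      x.1 * (x.2.1 + β / 2 * x.2.2.1) := by field_simp
  rw [h1]
  constructor <;> intro h <;> linear_combination h

end SymmetryModel

namespace DiagonalModel

variable {𝔤 T : Type*} [AddCommGroup 𝔤] [Module ℝ 𝔤] [AddCommGroup T] [Module ℝ T]
  [FiniteDimensional ℝ T] {d : ℕ} (G : DiagonalModel 𝔤 T d)

/-- Reordering of the orthonormal part of the Witt basis. -/
def reindex (π : Equiv.Perm (Fin d)) : DiagonalModel 𝔤 T d where
  toGradedModel := G.toGradedModel.reindex π
  σ_eq := G.σ_eq
  diag i j hij := G.diag (π i) (π j) (π.injective.ne hij)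
  C_ne_zero := G.C_ne_zero

theorem hasNormalForm_of_single (hd : 0 < d) (h0 : G.q ⟨0, hd⟩ ≠ G.β / 2)
    (h : ∀ j, j ≠ ⟨0, hd⟩ → G.q j = G.β / 2) : G.toSymmetryModel.HasNormalForm G.wit := by
  have hc : G.q ⟨0, hd⟩ - G.β / 2 ≠ 0 := sub_ne_zero.2 h0
  have hm : ∀ i : Fin d, (if i = ⟨0, hd⟩ then (1 : ℝ) else 0) = 0 ∨
      (if i = ⟨0, hd⟩ then (1 : ℝ) else 0) = 1 := fun i => by split_ifs <;> simp
  have hq : ∀ i, G.q i = G.β / 2 + (G.q ⟨0, hd⟩ - G.β / 2) * if i = ⟨0, hd⟩ then 1 else 0 :=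
    fun i => by
      split_ifs with hi
      · rw [hi]; ring
      · rw [h i hi]; ring
  rcases G.ν_eq_or hm hq with hν | hν
  · exact G.hasNormalForm_typeSix G.wit hd hc (G.isInvariant_cubicPoly hm hq hc hν)
  · exact G.hasNormalForm_typeSeven G.wit hd hc (G.isInvariant_rationalPoly hm hq hc hν)
      (G.isInvariant_one_sub hν)

theorem hasNormalForm_of_forall_eq (h : ∀ i j, G.q i = G.q j) :
    G.toSymmetryModel.HasNormalForm G.wit := by
  obtain ⟨i₀, h0⟩ := G.exists_q_ne
  have hc : G.q i₀ - G.β / 2 ≠ 0 := sub_ne_zero.2 h0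
  have hm : ∀ i : Fin d, (fun _ : Fin d => (1 : ℝ)) i = 0 ∨ (fun _ : Fin d => (1 : ℝ)) i = 1 :=
    fun i => Or.inr rfl
  have hq : ∀ i, G.q i = G.β / 2 + (G.q i₀ - G.β / 2) * (fun _ => 1) i := fun i => by
    rw [h i i₀]; ring
  rcases G.ν_eq_or hm hq with hν | hν
  · exact G.hasNormalForm_typeFour G.wit hc (G.isInvariant_cubicPoly hm hq hc hν)
  · exact G.hasNormalForm_typeFive G.wit hc (G.isInvariant_rationalPoly hm hq hc hν)
      (G.isInvariant_one_sub hν)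

/-- If a single index is distinguished, a transposition moves it to position zero, which is the
coordinate `x₂` of the list. -/
theorem exists_hasNormalForm (h : d * (d - 1) / 2 ≤ Module.finrank ℝ G.isotropy) :
    ∃ w, G.toSymmetryModel.HasNormalForm (d := d) w := by
  rcases G.q_eq_or h with h | ⟨i, hi, h⟩
  · exact ⟨G.wit, G.hasNormalForm_of_forall_eq h⟩
  · have hd : 0 < d := i.pos
    refine ⟨_, (G.reindex (Equiv.swap ⟨0, hd⟩ i)).hasNormalForm_of_single hd ?_ fun j hj => ?_⟩
    · change G.q (Equiv.swap ⟨0, hd⟩ i ⟨0, hd⟩) ≠ G.β / 2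
      rwa [Equiv.swap_apply_left]
    · refine h (Equiv.swap ⟨0, hd⟩ i j) fun h0 => hj ?_
      rw [Equiv.swap_apply_eq_iff] at h0
      rw [h0, Equiv.swap_apply_right]

end DiagonalModel

namespace GradedModel

variable {𝔤 T : Type*} [AddCommGroup 𝔤] [Module ℝ 𝔤] [AddCommGroup T] [Module ℝ T]
  [FiniteDimensional ℝ T] {d : ℕ} (G : GradedModel 𝔤 T d)

theorem hasNormalForm_of_three (hd : 0 < d) (hC : G.C ≠ 0) (hσ : G.σ = -1 / 3) :
    G.toSymmetryModel.HasNormalForm G.wit := by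
  have hCe := G.C_eq_of_three hσ
  have hγ : G.C G.wit.e G.wit.e G.wit.e / 6 ≠ 0 := by
    refine div_ne_zero (fun h0 => hC ?_) (by norm_num)
    refine LinearMap.ext fun x => LinearMap.ext fun y => LinearMap.ext fun z => ?_
    rw [hCe, h0, zero_mul]
    rfl
  refine G.hasNormalForm_cubic G.wit (j := ⟨0, hd⟩) hγ (G.isInvariant_graphPoly G.wit _ _ _ _
    (G.w_eq_zero_of_two_le (by norm_num) hσ) (fun u v => ?_) (fun X x => ?_) (Or.inl rfl))
  · rw [hCe]; ring
  · rw [G.cubicDeriv_eq_K, G.K_eq_zero_of_three hσ]; ring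

theorem hasNormalForm_of_two (hd : 0 < d) (hσ : G.σ = -1 / 2)
    (h0 : ∀ i, i ≠ ⟨0, hd⟩ → G.C G.wit.e G.wit.e (G.wit.E i) = 0)
    (hl : G.C G.wit.e G.wit.e (G.wit.E ⟨0, hd⟩) ≠ 0) :
    G.toSymmetryModel.HasNormalForm G.wit := by
  refine G.hasNormalForm_winkelmann G.wit hd
    (l := G.C G.wit.e G.wit.e (G.wit.E ⟨0, hd⟩) / 2)
    (κ := -G.K G.wit.e G.wit.e G.wit.e G.wit.e / 24) (div_ne_zero hl two_ne_zero)
    (G.isInvariant_graphPoly G.wit _ _ _ _ (G.w_eq_zero_of_two_le (by norm_num) hσ)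
      (fun u v => ?_) (fun X x => ?_) (Or.inr (G.A_of_two hσ h0 hl)))
  · rw [C_eq_of_two hσ h0]; ring
  · rw [G.cubicDeriv_eq_K, G.K_eq_of_two hσ (G.b X)]; ring

/-- `hdiag` serves two weights at once. In weight one `C e e` vanishes on the complement, and the
condition says that `C e` is diagonal. In weight two `C e` vanishes there, and the condition says
that at most one `C e e (E i)` is nonzero. -/
theorem exists_hasNormalForm (hd : 0 < d) (hC : G.C ≠ 0)
    (h : d * (d - 1) / 2 ≤ Module.finrank ℝ G.isotropy)
    (hdiag : ∀ i j, i ≠ j → G.C G.wit.e G.wit.e (G.wit.E i) * G.C G.wit.e G.wit.e (G.wit.E j) +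
      G.C G.wit.e (G.wit.E i) (G.wit.E j) = 0) :
    ∃ w, G.toSymmetryModel.HasNormalForm (d := d) w := by
  rcases G.σ_cases hC with hσ | hσ | hσ
  · let G' : DiagonalModel 𝔤 T d := ⟨G, hσ, fun i j hij => by
      have h1 := hdiag i j hij
      have h2 : G.C G.wit.e G.wit.e (G.wit.E i) = 0 :=
        G.C_vec_eq_zero (i := none) (j := none) (k := some (some i)) one_ne_zero
          (by rw [hσ]; norm_num) (by norm_num [wittWeight])
      rwa [h2, zero_mul, zero_add] at h1, hC⟩
    exact G'.exists_hasNormalForm h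
  · have hE : ∀ i j, G.C G.wit.e (G.wit.E i) (G.wit.E j) = 0 := fun i j =>
      G.C_vec_eq_zero (i := none) (j := some (some i)) (k := some (some j)) two_ne_zero hσ
        (by norm_num [wittWeight])
    obtain ⟨i₀, hi₀⟩ : ∃ i, G.C G.wit.e G.wit.e (G.wit.E i) ≠ 0 := by
      by_contra hcon
      push Not at hcon
      refine hC (LinearMap.ext fun x => LinearMap.ext fun y => LinearMap.ext fun z => ?_)
      rw [C_eq_of_two hσ (i₀ := ⟨0, hd⟩) fun i _ => hcon i, hcon, zero_mul]
      rfl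
    have h0 : ∀ i, i ≠ i₀ → G.C G.wit.e G.wit.e (G.wit.E i) = 0 := fun i hi => by
      have h1 := hdiag i i₀ hi
      rw [hE, add_zero] at h1
      exact (mul_eq_zero.1 h1).resolve_right hi₀
    refine ⟨_, (G.reindex (Equiv.swap ⟨0, hd⟩ i₀)).hasNormalForm_of_two hd hσ (fun j hj => ?_) ?_⟩
    · refine h0 (Equiv.swap ⟨0, hd⟩ i₀ j) fun h0 => hj ?_
      rw [Equiv.swap_apply_eq_iff] at h0
      rw [h0, Equiv.swap_apply_right]
    · change G.C G.wit.e G.wit.e (G.wit.E (Equiv.swap ⟨0, hd⟩ i₀ ⟨0, hd⟩)) ≠ 0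
      rwa [Equiv.swap_apply_left]
  · exact ⟨_, G.hasNormalForm_of_three hd hC hσ⟩

end GradedModel

namespace SymmetryModel

variable {𝔤 T : Type*} [AddCommGroup 𝔤] [Module ℝ 𝔤] [AddCommGroup T] [Module ℝ T]
  [FiniteDimensional ℝ T] (S : SymmetryModel 𝔤 T) {d : ℕ}

theorem exists_hasNormalForm_of_C_eq_zero (hd : 0 < d) (hS : S.IsLorentzian (d + 2))
    (hC : S.C = 0) {D : 𝔤} (hDb : S.b D = 0) (hDa : S.a D = 2) :
    ∃ w, S.HasNormalForm (d := d) w := by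
  obtain ⟨B, hB⟩ := id hS
  have h00 : S.Q (B 0) (B 0) = -1 := by rw [hB]; simp
  have h11 : S.Q (B 1) (B 1) = 1 := by rw [hB]; simp
  have h01 : S.Q (B 0) (B 1) = 0 := by rw [hB]; simp
  have h10 : S.Q (B 1) (B 0) = 0 := by rw [S.Q_symm, h01]
  -- Without a cubic form no null pair is distinguished; one is built from a timelike and a
  -- spacelike basis vector, and there is nothing to diagonalize.
  obtain ⟨w, -, -, -⟩ := exists_wittBasis S.Q_symm hS.isHyperbolic hS.finrank_eq 0
    (fun _ _ => rfl) (e := B 1 + B 0) (f := (1 / 2 : ℝ) • (B 1 - B 0))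
    (by simp [h00, h11, h01, h10]) (by simp [h00, h11, h01, h10])
    (by simp [h00, h11, h01, h10]; norm_num)
  refine ⟨w, S.hasNormalForm_quadric w (j := ⟨0, hd⟩) (S.isInvariant_graphPoly w _ _ _ _
    (S.w_eq_zero_of_C_eq_zero hC hDb hDa) (fun u v => ?_) (fun X x => ?_) (Or.inl rfl))⟩
  · simp [hC]
  · simp [S.cubicDeriv_apply, hC]

theorem exists_hasNormalForm (hd : 0 < d) (hS : S.IsLorentzian (d + 2)) {D : 𝔤}
    (hDb : S.b D = 0) (hDa : S.a D = 2) (h : d * (d - 1) / 2 ≤ Module.finrank ℝ S.isotropy) :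
    ∃ w, S.HasNormalForm (d := d) w := by
  by_cases hC : S.C = 0
  · exact S.exists_hasNormalForm_of_C_eq_zero hd hS hC hDb hDa
  · obtain ⟨G, rfl, hG⟩ := S.exists_gradedModel hS hC hDb hDa
      (fun e => (S.C e e).smulRight (S.C e e) + S.C e) (fun e u v => by
        simp [S.C_swap_right e u v, mul_comm])
    exact G.exists_hasNormalForm hd hC h fun i j hij => by simpa using hG i j hij

end SymmetryModel

end AffineTube

/-! ### The classification. -/

theorem theorem2 (n : ℕ) (hn : 4 ≤ n)
    (D : Set (Fin (n + 1) → ℂ)) (Ω Γ : Set (Fin (n + 1) → ℝ))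
    (hD : AffineTube.IsAffinelyHomogeneousTubeDomain D Ω)
    (hΓbd : AffineTube.IsBoundaryPart Γ Ω)
    (hΓconn : IsConnected Γ)
    (hΓsmooth : AffineTube.IsSmoothHypersurface Γ)
    (hΓhom : AffineTube.IsAffinelyHomogeneousHypersurface Γ)
    (hΓlor : ∀ p ∈ Γ, AffineTube.HasLorentzianSecondFundamentalForm Γ p)
    (p : Fin (n + 1) → ℝ) (hp : p ∈ Ω)
    (hiso : (n - 2) * (n - 3) / 2 ≤ Module.finrank ℝ (AffineTube.isotropyAlgebra Ω p)) :
    ∃ M : Set (Fin (n + 1) → ℝ), AffineTube.IsListedHypersurface n M ∧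
      ∀ q ∈ Γ, AffineTube.LocallyAffinelyEquivalentAt Γ M q := by
  obtain ⟨q, hq⟩ := hΓconn.nonempty
  -- `d` counts the middle coordinates `x₂, …, xₙ₋₁`; the isotropy bound is then `d (d - 1) / 2`,
  -- the dimension of their rotation algebra.
  obtain ⟨d, rfl⟩ : ∃ d, n = d + 2 := ⟨n - 2, by omega⟩
  obtain ⟨T, S, Φ, hfield, hS, ⟨D', hDb, hDa⟩, hle⟩ := AffineTube.exists_symmetryModel hD.base hΓbd
    hΓsmooth hΓhom hq (hΓlor q hq) hp
  obtain ⟨w, hw⟩ := S.exists_hasNormalForm (d := d) (by omega) hS hDb hDa (hiso.trans hle)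
  exact AffineTube.exists_listed_of_hasNormalForm hΓsmooth hΓhom hΓconn hq S Φ hfield w hw
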